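/- Let $\mathbb R^+=(0,\infty)$ with Lebesgue measure $|\cdot|$. A *Banach function ideal lattice* (BFIL) is a Banach space $X$ of (a.e. classes of) real measurable functions on $\mathbb R^+$ such that $g\in X$ and $|f|\le|g|$ a.e. imply $f\in X$ and $\|f\|_X\le\|g\|_X$. It is *rearrangement invariant* (r.i.) if $g\in X$ and $f$ equimeasurable with $g$ (that is, $|\{|f|>s\}|=|\{|g|>s\}|$ for all $s\ge0$) imply $f\in X$ and $\|f\|_X=\|g\|_X$. It is *order continuous* if every increasing sequence in $X$ that is order bounded in $X$ converges in norm. It has the *Fatou property* if $f_n\in X$, $0\le f_n\uparrow f$ a.e. and $\sup_n\|f_n\|_X<\infty$ imply $f\in X$ and $\|f_n\|_X\uparrow\|f\|_X$. Let $Sf(x)=\frac1x\int_0^xf(y)\,dy$ be the Hardy operator and $[S,X]=\{f\text{ measurable}: S|f|\in X\}$ with $\|f\|_{[S,X]}=\|S|f|\,\|_X$ (here $S|f|\in X$ includes that $f$ is integrable on every $(0,x]$). Let $\mathcal R$ be the $\delta$-ring of the Borel sets $A\subset\mathbb R^+$ with $|A|<\infty$ and $|A\cap(0,\varepsilon]|=0$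 for some $\varepsilon>0$. A vector measure $\nu:\mathcal R\to X$ is a set function with $\nu(\bigcup_nA_n)=\sum_n\nu(A_n)$, convergent in $X$, for all disjoint $A_n\in\mathcal R$ with $\bigcup_nA_n\in\mathcal R$. For $x^*\in X^*$ let $|x^*\nu|$ be the variation of $x^*\nu$, a measure on the Borel sets of $\mathbb R^+$. Let $L^1_w(\nu)$ be the set of measurable $f$ with $\int|f|\,d|x^*\nu|<\infty$ for all $x^*\in X^*$, and $L^1(\nu)$ the set of those $f\in L^1_w(\nu)$ for which each Borel set $A$ has a vector $v_A\in X$ with $x^*(v_A)=\int_Af\,d(x^*\nu)$ for all $x^*\in X^*$; both carry the norm $\|f\|_\nu=\sup_{\|x^*\|\le1}\int|f|\,d|x^*\nu|$. **Proposition.** Let $X\ne\{0\}$ be an r.i. BFIL whose fundamental function $\varphi_X(t)=\|\chi_{(0,t]}\|_X$ satisfies $\int_y^\infty\frac{\varphi_X'(t)}t\,dt<\infty$ for all $y>0$. Then: (a) $\nu_X(A)=S(\chi_A)$ defines a vector measure $\nu_X:\mathcal R\to X$. (b) $[S,X]$, $L^1(\nu_X)$ and $L^1_w(\nu_X)$ are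 BFILs, and $L^1(\nu_X)\hookrightarrow[S,X]\hookrightarrow L^1_w(\nu_X)$ continuously, with $\|f\|_{[S,X]}=\|f\|_{\nu_X}$ for $f\in L^1(\nu_X)$ and $\|f\|_{\nu_X}\le\|f\|_{[S,X]}$ for $f\in[S,X]$. (c) $L^1(\nu_X)$ is the largest order continuous BFIL contained in $[S,X]$: it is order continuous, and every order continuous BFIL $Y\subset[S,X]$ is continuously contained in $L^1(\nu_X)$. (d) $L^1_w(\nu_X)$ is the smallest BFIL with the Fatou property containing $[S,X]$: it has the Fatou property, and it is continuously contained in every BFIL $Y\supset[S,X]$ with the Fatou property. (e) If $X$ is order continuous, then $L^1(\nu_X)=[S,X]$, with equal norms. (f) If $X$ has the Fatou property, then $L^1_w(\nu_X)=[S,X]$, with equal norms. -/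

import Mathlib

open MeasureTheory Filter Topology
open scoped ENNReal

noncomputable section

namespace HardyDomain

/-! ### Functions on the positive half-line -/

/-- The half-line `(0, ∞)`, with its Borel sets. -/
abbrev RPos : Type := Set.Ioi (0 : ℝ)

/-- Lebesgue measure on `(0, ∞)`: the measure of `A` is that of `A` as a subset of `ℝ`. -/
instance : MeasureSpace RPos := Measure.Subtype.measureSpace

theorem map_coe_volume :
    (volume : Measure RPos).map (fun x : RPos => (x : ℝ)) = volume.restrict (Set.Ioi 0) :=
  map_comap_subtype_coe measurableSet_Ioi volume

instance : SigmaFinite (volume : Measure RPos) := by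
  have h : SigmaFinite ((volume : Measure RPos).map (fun x : RPos => (x : ℝ))) := by
    rw [map_coe_volume]; infer_instance
  exact SigmaFinite.of_map _ measurable_subtype_coe.aemeasurable h

/-- Real valued measurable functions on `(0, ∞)`, modulo equality almost everywhere. -/
abbrev L0 : Type := RPos →ₘ[volume] ℝ

/-- The (class of the) characteristic function of a measurable set. -/
def chi (A : Set RPos) (hA : MeasurableSet A) : L0 :=
  AEEqFun.mk (A.indicator fun _ => (1 : ℝ))
    ((stronglyMeasurable_const.indicator hA).aestronglyMeasurable)

/-- The Hardy operator on functions, `(S f)(x) = (1 / x) ∫₀ˣ f(y) dy`. -/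
def hardyFun (f : RPos → ℝ) (x : RPos) : ℝ :=
  (x : ℝ)⁻¹ * ∫ y in Set.Iic x, f y

theorem stronglyMeasurable_hardyFun {f : RPos → ℝ} (hf : StronglyMeasurable f) :
    StronglyMeasurable (hardyFun f) := by
  have h : StronglyMeasurable fun x : RPos => ∫ y in Set.Iic x, f y := by
    have h2 : StronglyMeasurable (Function.uncurry fun x y : RPos =>
        (Set.Iic x).indicator f y) := by
      have hs : MeasurableSet {p : RPos × RPos | p.2 ≤ p.1} :=
        measurableSet_le measurable_snd measurable_fst
      have h3 := (hf.comp_measurable (measurable_snd (α := RPos) (β := RPos))).indicator hs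
      convert h3 using 1
      ext p
      by_cases hp : p.2 ≤ p.1 <;> simp [Function.uncurry, Set.indicator, hp]
    convert h2.integral_prod_right (ν := (volume : Measure RPos)) using 1
    ext x
    rw [integral_indicator measurableSet_Iic]
  exact (measurable_subtype_coe.inv.stronglyMeasurable).mul h

/-- The Hardy operator on classes of functions.  It is only meaningful for functions that are
integrable on every interval `(0, x)`. -/
def hardy (f : L0) : L0 :=
  AEEqFun.mk (hardyFun f) (stronglyMeasurable_hardyFun f.stronglyMeasurable).aestronglyMeasurable

/-! ### Banach function ideal lattices -/

/-- A set of (classes of) measurable functions with a real function on it, the would-be norm.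
The values of `norm` outside `carrier` carry no meaning. -/
structure FnSpace where
  carrier : Set L0
  norm : L0 → ℝ

/-- `X` is a Banach function ideal lattice: a linear space of measurable functions, complete for
its norm, such that `g ∈ X` and `|f| ≤ |g|` a.e. imply `f ∈ X` and `‖f‖ ≤ ‖g‖`. -/
structure FnSpace.IsBFIL (X : FnSpace) : Prop where
  zero_mem : (0 : L0) ∈ X.carrier
  add_mem : ∀ f ∈ X.carrier, ∀ g ∈ X.carrier, f + g ∈ X.carrier
  smul_mem : ∀ (c : ℝ), ∀ f ∈ X.carrier, c • f ∈ X.carrier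
  norm_nonneg : ∀ f ∈ X.carrier, 0 ≤ X.norm f
  eq_zero_of_norm : ∀ f ∈ X.carrier, X.norm f = 0 → f = 0
  norm_smul : ∀ (c : ℝ), ∀ f ∈ X.carrier, X.norm (c • f) = |c| * X.norm f
  norm_add_le : ∀ f ∈ X.carrier, ∀ g ∈ X.carrier, X.norm (f + g) ≤ X.norm f + X.norm g
  ideal : ∀ g ∈ X.carrier, ∀ f : L0, |f| ≤ |g| → f ∈ X.carrier ∧ X.norm f ≤ X.norm g
  complete : ∀ u : ℕ → L0, (∀ n, u n ∈ X.carrier) →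
    (∀ ε > 0, ∃ N, ∀ m ≥ N, ∀ n ≥ N, X.norm (u m - u n) < ε) →
    ∃ f ∈ X.carrier, Tendsto (fun n => X.norm (u n - f)) atTop (𝓝 0)

/-- A Banach function ideal lattice (bundled). -/
structure BFIL extends FnSpace where
  isBFIL : toFnSpace.IsBFIL

/-- The underlying linear space of a Banach function ideal lattice. -/
def BFIL.submodule (X : BFIL) : Submodule ℝ L0 where
  carrier := X.carrier
  zero_mem' := X.isBFIL.zero_mem
  add_mem' := fun {f g} hf hg => X.isBFIL.add_mem f hf g hg
  smul_mem' := fun c f hf => X.isBFIL.smul_mem c f hf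

/-- The elements of a Banach function ideal lattice, as a normed space. -/
def BFIL.Elem (X : BFIL) : Type := X.submodule

/-- The measurable function underlying an element of `X`. -/
def BFIL.Elem.toFn {X : BFIL} (f : X.Elem) : L0 := Subtype.val (p := (· ∈ X.submodule)) f

instance (X : BFIL) : AddCommGroup X.Elem := inferInstanceAs (AddCommGroup X.submodule)

instance (X : BFIL) : Module ℝ X.Elem := inferInstanceAs (Module ℝ X.submodule)

instance (X : BFIL) : Norm X.Elem := ⟨fun f => X.norm f.toFn⟩

theorem BFIL.core (X : BFIL) : NormedSpace.Core ℝ X.Elem where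
  norm_nonneg f := X.isBFIL.norm_nonneg f.toFn f.2
  norm_smul c f := X.isBFIL.norm_smul c f.toFn f.2
  norm_triangle f g := X.isBFIL.norm_add_le f.toFn f.2 g.toFn g.2
  norm_eq_zero_iff f := by
    constructor
    · intro h
      exact Subtype.ext (X.isBFIL.eq_zero_of_norm f.toFn f.2 h)
    · rintro rfl
      have h := X.isBFIL.norm_smul 0 0 X.isBFIL.zero_mem
      simp only [zero_smul, abs_zero, zero_mul] at h
      exact h

instance (X : BFIL) : NormedAddCommGroup X.Elem := NormedAddCommGroup.ofCore X.core

instance (X : BFIL) : NormedSpace ℝ X.Elem := NormedSpace.ofCore X.core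

/-- Rearrangement invariance: if `g ∈ X` and `f` is equimeasurable with `g`, then `f ∈ X` and
`‖f‖ = ‖g‖`. -/
def FnSpace.RearrangementInvariant (X : FnSpace) : Prop :=
  ∀ g ∈ X.carrier, ∀ f : L0,
    (∀ s : ℝ, 0 ≤ s → volume {x : RPos | s < |f x|} = volume {x : RPos | s < |g x|}) →
    f ∈ X.carrier ∧ X.norm f = X.norm g

/-- Order continuity: every increasing sequence of `X` that is order bounded in `X` converges
in the norm of `X`. -/
def FnSpace.OrderContinuous (X : FnSpace) : Prop :=
  ∀ u : ℕ → L0, (∀ n, u n ∈ X.carrier) → Monotone u →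
    (∃ g ∈ X.carrier, ∀ n, u n ≤ g) →
    ∃ f ∈ X.carrier, Tendsto (fun n => X.norm (u n - f)) atTop (𝓝 0)

/-- The Fatou property: if `fₙ ∈ X`, `0 ≤ fₙ ↑ f` a.e. and `sup ‖fₙ‖ < ∞`, then `f ∈ X` and
`‖fₙ‖ ↑ ‖f‖`. -/
def FnSpace.Fatou (X : FnSpace) : Prop :=
  ∀ (u : ℕ → L0) (f : L0), (∀ n, u n ∈ X.carrier) → (∀ n, 0 ≤ u n) → Monotone u →
    (∀ᵐ x, Tendsto (fun n => u n x) atTop (𝓝 (f x))) →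
    BddAbove (Set.range fun n => X.norm (u n)) →
    f ∈ X.carrier ∧ Tendsto (fun n => X.norm (u n)) atTop (𝓝 (X.norm f))

/-- Continuous inclusion of function spaces. -/
def FnSpace.Embeds (Y Z : FnSpace) : Prop :=
  Y.carrier ⊆ Z.carrier ∧ ∃ C : ℝ, ∀ f ∈ Y.carrier, Z.norm f ≤ C * Y.norm f

/-- Equality of function spaces: the same functions, with the same norms. -/
def FnSpace.Same (Y Z : FnSpace) : Prop :=
  Y.carrier = Z.carrier ∧ ∀ f ∈ Y.carrier, Y.norm f = Z.norm f

/-- The fundamental function `φ(t) = ‖χ_{(0,t]}‖`. -/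
def FnSpace.fundamental (X : FnSpace) (t : ℝ) : ℝ :=
  X.norm (chi {x : RPos | (x : ℝ) ≤ t} (measurableSet_le measurable_subtype_coe measurable_const))

/-- The condition `∫_y^∞ φ'(t) / t dt < ∞` for all `y > 0`. -/
def ThetaCondition (φ : ℝ → ℝ) : Prop :=
  ∀ y : ℝ, 0 < y → IntegrableOn (fun t => deriv φ t / t) (Set.Ioi y)

/-- The space `[S, X]` of the measurable `f` with `S|f| ∈ X` (in particular `S|f|` is finite, that
is, `f` is integrable on every `(0, x]`), with the norm `‖S|f|‖`. -/
def hardyDomain (X : FnSpace) : FnSpace where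
  carrier := {f | (∀ x : RPos, IntegrableOn f (Set.Iic x)) ∧ hardy |f| ∈ X.carrier}
  norm f := X.norm (hardy |f|)

/-! ### The δ-ring and vector measures on it -/

/-- A δ-ring of sets: a ring of sets that is closed under countable intersections. -/
structure IsDeltaRing {α : Type*} (R : Set (Set α)) : Prop where
  empty_mem : ∅ ∈ R
  union_mem : ∀ A ∈ R, ∀ B ∈ R, A ∪ B ∈ R
  diff_mem : ∀ A ∈ R, ∀ B ∈ R, A \ B ∈ R
  iInter_mem : ∀ A : ℕ → Set α, (∀ n, A n ∈ R) → ⋂ n, A n ∈ R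

/-- The Borel sets of finite measure that, up to a null set, avoid a neighbourhood of `0`. -/
def boundedAway : Set (Set RPos) :=
  {A | MeasurableSet A ∧ volume A < ∞ ∧
    ∃ ε : ℝ, 0 < ε ∧ volume (A ∩ {x : RPos | (x : ℝ) ≤ ε}) = 0}

theorem boundedAway_of_subset {A B : Set RPos} (hA : A ∈ boundedAway) (hB : MeasurableSet B)
    (h : B ⊆ A) : B ∈ boundedAway := by
  obtain ⟨-, hA1, ε, hε, h0⟩ := hA
  exact ⟨hB, (measure_mono h).trans_lt hA1, ε, hε,
    measure_mono_null (Set.inter_subset_inter_left _ h) h0⟩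

theorem boundedAway_empty : (∅ : Set RPos) ∈ boundedAway :=
  ⟨MeasurableSet.empty, by simp, 1, one_pos, by simp⟩

theorem boundedAway_union {A B : Set RPos} (hA : A ∈ boundedAway) (hB : B ∈ boundedAway) :
    A ∪ B ∈ boundedAway := by
  obtain ⟨hA, hA1, ε, hε, h0⟩ := hA
  obtain ⟨hB, hB1, δ, hδ, h1⟩ := hB
  refine ⟨hA.union hB, measure_union_lt_top hA1 hB1, min ε δ, lt_min hε hδ, ?_⟩
  rw [Set.union_inter_distrib_right]
  refine measure_union_null (measure_mono_null ?_ h0) (measure_mono_null ?_ h1)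
  · exact Set.inter_subset_inter_right _ fun x hx => show (x : ℝ) ≤ ε from
      le_trans hx (min_le_left _ _)
  · exact Set.inter_subset_inter_right _ fun x hx => show (x : ℝ) ≤ δ from
      le_trans hx (min_le_right _ _)

theorem boundedAway_isDeltaRing : IsDeltaRing boundedAway where
  empty_mem := boundedAway_empty
  union_mem _ hA _ hB := boundedAway_union hA hB
  diff_mem _ hA _ hB := boundedAway_of_subset hA (hA.1.diff hB.1) Set.sdiff_subset
  iInter_mem A hA := boundedAway_of_subset (hA 0) (MeasurableSet.iInter fun n => (hA n).1)
    (Set.iInter_subset A 0)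

/-- A vector measure on the δ-ring `boundedAway`: a countably additive set function on it with
values in `E` (extended by `0` to the other sets). -/
structure RingMeasure (E : Type*) [AddCommMonoid E] [TopologicalSpace E] where
  toFun : Set RPos → E
  apply_of_notMem : ∀ A, A ∉ boundedAway → toFun A = 0
  hasSum_iUnion : ∀ A : ℕ → Set RPos, (∀ n, A n ∈ boundedAway) →
    Pairwise (Function.onFun Disjoint A) → (⋃ n, A n) ∈ boundedAway →
    HasSum (fun n => toFun (A n)) (toFun (⋃ n, A n))

namespace RingMeasure

/-- The scalar measure `x* ν`. -/
def comp {E : Type*} [NormedAddCommGroup E] [NormedSpace ℝ E] (ν : RingMeasure E)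
    (x : StrongDual ℝ E) : RingMeasure ℝ where
  toFun A := x (ν.toFun A)
  apply_of_notMem A hA := by rw [ν.apply_of_notMem A hA, map_zero]
  hasSum_iUnion A hA hd hU := x.hasSum (ν.hasSum_iUnion A hA hd hU)

/-- The opposite of a scalar measure. -/
def neg (μ : RingMeasure ℝ) : RingMeasure ℝ where
  toFun A := -μ.toFun A
  apply_of_notMem A hA := by rw [μ.apply_of_notMem A hA, neg_zero]
  hasSum_iUnion A hA hd hU := (μ.hasSum_iUnion A hA hd hU).neg

theorem apply_empty (μ : RingMeasure ℝ) : μ.toFun ∅ = 0 := by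
  have h := μ.hasSum_iUnion (fun _ => ∅) (fun _ => boundedAway_empty)
    (fun _ _ _ => by simp [Function.onFun]) (by simpa using boundedAway_empty)
  exact tendsto_nhds_unique tendsto_const_nhds h.summable.tendsto_atTop_zero

theorem apply_union (μ : RingMeasure ℝ) {A B : Set RPos} (hA : A ∈ boundedAway)
    (hB : B ∈ boundedAway) (hd : Disjoint A B) :
    μ.toFun (A ∪ B) = μ.toFun A + μ.toFun B := by
  let f : ℕ → Set RPos := fun n => if n = 0 then A else if n = 1 then B else ∅
  have hU : ⋃ n, f n = A ∪ B := by
    ext x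
    simp only [Set.mem_iUnion, Set.mem_union, f]
    constructor
    · rintro ⟨n, hn⟩
      split_ifs at hn <;> simp_all
    · rintro (h | h)
      · exact ⟨0, by simpa using h⟩
      · exact ⟨1, by simpa using h⟩
  have h := μ.hasSum_iUnion f
    (fun n => by
      simp only [f]
      split_ifs
      exacts [hA, hB, boundedAway_empty])
    (fun i j hij => by
      simp only [f, Function.onFun]
      split_ifs <;> simp_all [hd.symm])
    (by rw [hU]; exact boundedAway_union hA hB)
  rw [hU] at h
  have h2 : HasSum (fun n => μ.toFun (f n)) (∑ n ∈ Finset.range 2, μ.toFun (f n)) := by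
    apply hasSum_sum_of_ne_finset_zero
    intro n hn
    have h0 : n ≠ 0 := by rintro rfl; simp at hn
    have h1 : n ≠ 1 := by rintro rfl; simp at hn
    simp [f, h0, h1, μ.apply_empty]
  rw [h.unique h2]
  simp [Finset.sum_range_succ, f]

/-- The supremum of `μ(B)` over the `B ⊆ A` of the δ-ring. -/
def upperFun (μ : RingMeasure ℝ) (A : Set RPos) : ℝ≥0∞ :=
  ⨆ (B : Set RPos) (_ : B ∈ boundedAway) (_ : B ⊆ A), ENNReal.ofReal (μ.toFun B)

theorem le_upperFun (μ : RingMeasure ℝ) {A B : Set RPos} (hB : B ∈ boundedAway) (h : B ⊆ A) :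
    ENNReal.ofReal (μ.toFun B) ≤ μ.upperFun A :=
  le_iSup_of_le B (le_iSup_of_le hB (le_iSup_of_le h le_rfl))

theorem upperFun_le (μ : RingMeasure ℝ) {A : Set RPos} {c : ℝ≥0∞}
    (h : ∀ B ∈ boundedAway, B ⊆ A → ENNReal.ofReal (μ.toFun B) ≤ c) : μ.upperFun A ≤ c :=
  iSup_le fun B => iSup_le fun hB => iSup_le fun hBA => h B hB hBA

theorem upperFun_mono (μ : RingMeasure ℝ) {A B : Set RPos} (h : A ⊆ B) :
    μ.upperFun A ≤ μ.upperFun B :=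
  μ.upperFun_le fun _ hC hCA => μ.le_upperFun hC (hCA.trans h)

theorem upperFun_union (μ : RingMeasure ℝ) {A B : Set RPos} (hd : Disjoint A B) :
    μ.upperFun A + μ.upperFun B ≤ μ.upperFun (A ∪ B) := by
  have key : ∀ C ∈ boundedAway, C ⊆ A → ∀ D ∈ boundedAway, D ⊆ B →
      ENNReal.ofReal (μ.toFun C) + ENNReal.ofReal (μ.toFun D) ≤ μ.upperFun (A ∪ B) := by
    intro C hC hCA D hD hDB
    rcases le_total (μ.toFun C) 0 with h | h
    · rw [ENNReal.ofReal_of_nonpos h, zero_add]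
      exact μ.le_upperFun hD (hDB.trans Set.subset_union_right)
    rcases le_total (μ.toFun D) 0 with h' | h'
    · rw [ENNReal.ofReal_of_nonpos h', add_zero]
      exact μ.le_upperFun hC (hCA.trans Set.subset_union_left)
    rw [← ENNReal.ofReal_add h h', ← μ.apply_union hC hD (hd.mono hCA hDB)]
    exact μ.le_upperFun (boundedAway_union hC hD) (Set.union_subset_union hCA hDB)
  have : ∀ D ∈ boundedAway, D ⊆ B →
      μ.upperFun A + ENNReal.ofReal (μ.toFun D) ≤ μ.upperFun (A ∪ B) := by
    intro D hD hDB
    have h : μ.upperFun A ≤ μ.upperFun (A ∪ B) - ENNReal.ofReal (μ.toFun D) :=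
      μ.upperFun_le fun C hC hCA =>
        ENNReal.le_sub_of_add_le_right ENNReal.ofReal_ne_top (key C hC hCA D hD hDB)
    calc μ.upperFun A + ENNReal.ofReal (μ.toFun D)
        ≤ μ.upperFun (A ∪ B) - ENNReal.ofReal (μ.toFun D) + ENNReal.ofReal (μ.toFun D) := by
          gcongr
      _ = μ.upperFun (A ∪ B) :=
          tsub_add_cancel_of_le (μ.le_upperFun hD (hDB.trans Set.subset_union_right))
  rcases eq_or_ne (μ.upperFun A) ∞ with hA | hA
  · rw [hA, top_add, ← hA]
    exact μ.upperFun_mono Set.subset_union_left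
  have h : μ.upperFun B ≤ μ.upperFun (A ∪ B) - μ.upperFun A :=
    μ.upperFun_le fun D hD hDB =>
      ENNReal.le_sub_of_add_le_left hA (this D hD hDB)
  calc μ.upperFun A + μ.upperFun B
      ≤ μ.upperFun A + (μ.upperFun (A ∪ B) - μ.upperFun A) := by gcongr
    _ = μ.upperFun (A ∪ B) :=
        add_tsub_cancel_of_le (μ.upperFun_mono Set.subset_union_left)

theorem upperFun_iUnion (μ : RingMeasure ℝ) (A : ℕ → Set RPos) (hA : ∀ n, MeasurableSet (A n))
    (hd : Pairwise (Function.onFun Disjoint A)) :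
    μ.upperFun (⋃ n, A n) = ∑' n, μ.upperFun (A n) := by
  apply le_antisymm
  · refine μ.upperFun_le fun B hB hBA => ?_
    have hmem : ∀ n, B ∩ A n ∈ boundedAway := fun n =>
      boundedAway_of_subset hB (hB.1.inter (hA n)) Set.inter_subset_left
    have hU : ⋃ n, B ∩ A n = B := by
      rw [← Set.inter_iUnion, Set.inter_eq_left.mpr hBA]
    have h := μ.hasSum_iUnion (fun n => B ∩ A n) hmem
      (fun i j hij => (hd hij).mono Set.inter_subset_right Set.inter_subset_right)
      (by rw [hU]; exact hB)
    rw [hU] at h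
    have hs : Summable fun n => max (μ.toFun (B ∩ A n)) 0 := by
      refine Summable.of_nonneg_of_le (fun n => le_max_right _ _) (fun n => ?_) h.summable.abs
      exact max_le (le_abs_self _) (abs_nonneg _)
    calc ENNReal.ofReal (μ.toFun B) = ENNReal.ofReal (∑' n, μ.toFun (B ∩ A n)) := by
          rw [h.tsum_eq]
      _ ≤ ENNReal.ofReal (∑' n, max (μ.toFun (B ∩ A n)) 0) :=
          ENNReal.ofReal_le_ofReal (h.summable.tsum_le_tsum (fun n => le_max_left _ _) hs)
      _ = ∑' n, ENNReal.ofReal (max (μ.toFun (B ∩ A n)) 0) :=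
          ENNReal.ofReal_tsum_of_nonneg (fun n => le_max_right _ _) hs
      _ ≤ ∑' n, μ.upperFun (A n) := by
          refine ENNReal.tsum_le_tsum fun n => ?_
          rw [ENNReal.ofReal_max, ENNReal.ofReal_zero, max_eq_left zero_le]
          exact μ.le_upperFun (hmem n) Set.inter_subset_right
  · rw [ENNReal.tsum_eq_iSup_nat]
    refine iSup_le fun N => ?_
    have : ∀ N, ∑ n ∈ Finset.range N, μ.upperFun (A n)
        ≤ μ.upperFun (⋃ n ∈ Finset.range N, A n) := by
      intro N
      induction N with
      | zero => simp
      | succ N ih =>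
        rw [Finset.sum_range_succ]
        refine (add_le_add_left ih _).trans ((μ.upperFun_union ?_).trans (μ.upperFun_mono ?_))
        · rw [Set.disjoint_iUnion₂_left]
          intro i hi
          exact hd (Finset.mem_range.mp hi).ne
        · rw [Finset.range_add_one, Finset.set_biUnion_insert, Set.union_comm]
    exact (this N).trans (μ.upperFun_mono (Set.iUnion₂_subset fun n _ => Set.subset_iUnion A n))

/-- The upper (positive) variation `μ⁺` of a scalar measure on the δ-ring, a measure on the Borel
sets: `μ⁺(A) = sup {μ(B) : B ⊆ A, B in the δ-ring}`. -/
def upper (μ : RingMeasure ℝ) : Measure RPos :=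
  Measure.ofMeasurable (fun A _ => μ.upperFun A)
    (by
      refine le_antisymm (μ.upperFun_le fun B _ hB => ?_) zero_le
      rw [Set.subset_empty_iff.mp hB, μ.apply_empty, ENNReal.ofReal_zero])
    (fun A hA hd => μ.upperFun_iUnion A hA hd)

/-- The lower (negative) variation `μ⁻ = (-μ)⁺`. -/
def lower (μ : RingMeasure ℝ) : Measure RPos := μ.neg.upper

/-- The variation `|μ| = μ⁺ + μ⁻`; see `variation_apply` for its description by partitions. -/
def variation (μ : RingMeasure ℝ) : Measure RPos := μ.upper + μ.lower

theorem upper_apply (μ : RingMeasure ℝ) {A : Set RPos} (hA : MeasurableSet A) :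
    μ.upper A = μ.upperFun A :=
  Measure.ofMeasurable_apply A hA

theorem abs_le_variation (μ : RingMeasure ℝ) {A B : Set RPos} (hB : B ∈ boundedAway)
    (h : B ⊆ A) : ENNReal.ofReal |μ.toFun B| ≤ μ.variation A := by
  have h1 : ENNReal.ofReal |μ.toFun B| ≤ μ.variation B := by
    rw [variation, Measure.add_apply, lower, upper_apply _ hB.1, upper_apply _ hB.1]
    rcases abs_cases (μ.toFun B) with ⟨h', -⟩ | ⟨h', -⟩ <;> rw [h']
    · exact (μ.le_upperFun hB subset_rfl).trans le_self_add
    · exact (μ.neg.le_upperFun hB subset_rfl).trans le_add_self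
  exact h1.trans (measure_mono h)

/-- The variation is the supremum of `∑ |μ(Bᵢ)|` over the finite disjoint families `(Bᵢ)` in the
δ-ring of subsets of `A`. -/
theorem variation_apply (μ : RingMeasure ℝ) {A : Set RPos} (hA : MeasurableSet A) :
    μ.variation A = ⨆ (n : ℕ) (B : Fin n → Set RPos) (_ : ∀ i, B i ∈ boundedAway ∧ B i ⊆ A)
      (_ : Pairwise (Function.onFun Disjoint B)), ∑ i, ENNReal.ofReal |μ.toFun (B i)| := by
  apply le_antisymm
  · set s := ⨆ (n : ℕ) (B : Fin n → Set RPos) (_ : ∀ i, B i ∈ boundedAway ∧ B i ⊆ A)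
      (_ : Pairwise (Function.onFun Disjoint B)), ∑ i, ENNReal.ofReal |μ.toFun (B i)| with hs
    have key : ∀ C ∈ boundedAway, C ⊆ A → ∀ D ∈ boundedAway, D ⊆ A →
        ENNReal.ofReal (μ.toFun C) + ENNReal.ofReal (-μ.toFun D) ≤ s := by
      have pair : ∀ C ∈ boundedAway, C ⊆ A → ∀ D ∈ boundedAway, D ⊆ A → Disjoint C D →
          ENNReal.ofReal |μ.toFun C| + ENNReal.ofReal |μ.toFun D| ≤ s := by
        intro C hC hCA D hD hDA hd
        rw [hs]
        refine le_iSup_of_le 2 (le_iSup_of_le ![C, D] (le_iSup_of_le ?_ (le_iSup_of_le ?_ ?_)))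
        · intro i
          fin_cases i
          exacts [⟨hC, hCA⟩, ⟨hD, hDA⟩]
        · intro i j hij
          fin_cases i <;> fin_cases j <;> simp_all [Function.onFun, hd.symm]
        · simp [Fin.sum_univ_two]
      intro C hC hCA D hD hDA
      have e : (∅ : Set RPos) ∈ boundedAway := boundedAway_empty
      rcases le_total (μ.toFun C) 0 with h | h
      · rw [ENNReal.ofReal_of_nonpos h, zero_add]
        refine le_trans ?_ (pair ∅ e (Set.empty_subset _) D hD hDA (Set.empty_disjoint _))
        exact (ENNReal.ofReal_le_ofReal (neg_le_abs _)).trans le_add_self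
      rcases le_total (-μ.toFun D) 0 with h' | h'
      · rw [ENNReal.ofReal_of_nonpos h', add_zero]
        refine le_trans ?_ (pair C hC hCA ∅ e (Set.empty_subset _) (Set.disjoint_empty _))
        exact (ENNReal.ofReal_le_ofReal (le_abs_self _)).trans le_self_add
      have hCD : C ∩ D ∈ boundedAway :=
        boundedAway_of_subset hC (hC.1.inter hD.1) Set.inter_subset_left
      have hC' : C \ D ∈ boundedAway :=
        boundedAway_of_subset hC (hC.1.diff hD.1) Set.sdiff_subset
      have hD' : D \ C ∈ boundedAway :=
        boundedAway_of_subset hD (hD.1.diff hC.1) Set.sdiff_subset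
      have e1 : μ.toFun C = μ.toFun (C ∩ D) + μ.toFun (C \ D) := by
        rw [← μ.apply_union hCD hC' Set.disjoint_sdiff_inter.symm, Set.inter_union_sdiff]
      have e2 : μ.toFun D = μ.toFun (C ∩ D) + μ.toFun (D \ C) := by
        rw [Set.inter_comm] at hCD ⊢
        rw [← μ.apply_union hCD hD' Set.disjoint_sdiff_inter.symm, Set.inter_union_sdiff]
      refine le_trans ?_ (pair (C \ D) hC' (Set.sdiff_subset.trans hCA) (D \ C) hD'
        (Set.sdiff_subset.trans hDA) (disjoint_sdiff_sdiff))
      rw [← ENNReal.ofReal_add h h', ← ENNReal.ofReal_add (abs_nonneg _) (abs_nonneg _)]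
      apply ENNReal.ofReal_le_ofReal
      have := le_abs_self (μ.toFun (C \ D))
      have := neg_le_abs (μ.toFun (D \ C))
      linarith
    rw [variation, Measure.add_apply, lower, upper_apply _ hA, upper_apply _ hA]
    rcases eq_or_ne s ∞ with hs' | hs'
    · rw [hs']; exact le_top
    have h1 : ∀ D ∈ boundedAway, D ⊆ A →
        μ.upperFun A + ENNReal.ofReal (-μ.toFun D) ≤ s := by
      intro D hD hDA
      have hle : ENNReal.ofReal (-μ.toFun D) ≤ s :=
        le_add_self.trans (key ∅ boundedAway_empty (Set.empty_subset _) D hD hDA)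
      have h : μ.upperFun A ≤ s - ENNReal.ofReal (-μ.toFun D) :=
        μ.upperFun_le fun C hC hCA =>
          ENNReal.le_sub_of_add_le_right ENNReal.ofReal_ne_top (key C hC hCA D hD hDA)
      calc _ ≤ s - ENNReal.ofReal (-μ.toFun D) + ENNReal.ofReal (-μ.toFun D) := by gcongr
        _ = s := tsub_add_cancel_of_le hle
    have hle : μ.upperFun A ≤ s :=
      le_self_add.trans (h1 ∅ boundedAway_empty (Set.empty_subset _))
    have h : μ.neg.upperFun A ≤ s - μ.upperFun A :=
      μ.neg.upperFun_le fun D hD hDA =>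
        ENNReal.le_sub_of_add_le_left (ne_top_of_le_ne_top hs' hle) (h1 D hD hDA)
    calc _ ≤ μ.upperFun A + (s - μ.upperFun A) := by gcongr
      _ = s := add_tsub_cancel_of_le hle
  · refine iSup_le fun n => iSup_le fun B => iSup_le fun hB => iSup_le fun hd => ?_
    calc ∑ i, ENNReal.ofReal |μ.toFun (B i)| ≤ ∑ i, μ.variation (B i) :=
          Finset.sum_le_sum fun i _ => μ.abs_le_variation (hB i).1 subset_rfl
      _ = μ.variation (⋃ i, B i) := by
          rw [measure_iUnion hd fun i => (hB i).1.1, tsum_fintype]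
      _ ≤ μ.variation A := measure_mono (Set.iUnion_subset fun i => (hB i).2)

/-- The integral `∫_A f dμ = ∫_A f dμ⁺ - ∫_A f dμ⁻`, for functions integrable for `|μ|`. -/
def integral (μ : RingMeasure ℝ) (A : Set RPos) (f : RPos → ℝ) : ℝ :=
  (∫ x in A, f x ∂μ.upper) - ∫ x in A, f x ∂μ.lower

end RingMeasure

section Spaces

variable {E : Type*} [NormedAddCommGroup E] [NormedSpace ℝ E]

/-- `‖f‖_ν = sup {∫ |f| d|x* ν| : x* in the unit ball of the dual}`. -/
def vnorm (ν : RingMeasure E) (f : L0) : ℝ :=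
  (⨆ (x : StrongDual ℝ E) (_ : ‖x‖ ≤ 1), ∫⁻ t, ‖f t‖ₑ ∂(ν.comp x).variation).toReal

/-- The space of the `f` that are integrable for `|x* ν|`, for every functional `x*`. -/
def weakL1 (ν : RingMeasure E) : FnSpace where
  carrier := {f | ∀ x : StrongDual ℝ E, Integrable f (ν.comp x).variation}
  norm := vnorm ν

/-- The space of the `ν`-integrable functions: those `f` that are integrable for every `|x* ν|`
and have, over each Borel set `A`, an integral `v ∈ E` with `x* v = ∫_A f d(x* ν)` for all `x*`. -/
def strongL1 (ν : RingMeasure E) : FnSpace where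
  carrier := {f | (∀ x : StrongDual ℝ E, Integrable f (ν.comp x).variation) ∧
    ∀ A : Set RPos, MeasurableSet A →
      ∃ v : E, ∀ x : StrongDual ℝ E, x v = (ν.comp x).integral A f}
  norm := vnorm ν

end Spaces

end HardyDomain

end

open HardyDomain

noncomputable section

namespace HardyDomain

/-! ### Function norms -/

/-! All three spaces are described by function norms, that is, by functionals σ on the [0, ∞]-valued
functions for which f lies in the space exactly when σ(|f|) < ∞. Countable subadditivity of σ is the
Riesz–Fischer property. It gives completeness (`FnSpace.HasFnNorm.isBFIL`) and makes every inclusion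
between such spaces continuous (`IsFnNorm.exists_le_mul`). The norm of any lattice X extends to such
a σ (`FnSpace.IsBFIL.isFnNorm`), and [S, X] then belongs to σ(F) = ‖SF‖_X.

The condition on φ says in effect that θ_ε = χ_(ε,∞)(x)/x belongs to X for each ε > 0. Comparison of
θ_ε with a dyadic step function reduces this to the convergence of ∑ φ(2^k ε)/(2^k ε), and that
follows from ∫ φ'(t)/t dt < ∞ once φ is known to be locally Lipschitz (`BFIL.summable_dyadic`,
`BFIL.fnNorm_theta_lt_top`). For F supported in (ε, ∞) one has SF ≤ (∫F) θ_ε, hence ‖SF‖ ≤ ‖F‖₁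
‖θ_ε‖. So away from the origin the L¹ norm controls everything: A ↦ Sχ_A is countably additive, each
scalar measure x*ν is bounded by a multiple of Lebesgue measure, and x*(Sg) = ∫ g d(x*ν) for
integrable g supported away from 0 (`BFIL.apply_hardyCLM_eq_setIntegral`).

General functions are reached through the truncations F ∧ b_n, where b_n = n χ_(1/(n+1),n]. On
truncated functions the weak norm and ‖S·‖ agree. A Hahn set turns ∫ H d|x*ν| into x*(Sg) with |g| =
H, which gives one inequality; a functional norming SH gives the other. Hence the weak norm is sup_n
‖S(F ∧ b_n)‖ (`BFIL.weakNorm_eq_iSup`), and by Banach–Steinhaus L¹_w(ν) is the space where this is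
finite (`BFIL.hasFnNorm_weakL1`).

The space L¹(ν) is the order continuous part of [S, X]: the f in [S, X] for which dominated
convergence holds below |f|, equivalently for which the tails |f| - |f| ∧ b_n tend to 0 in [S, X].
If f is ν-integrable, then the increasing sequence S(|f| ∧ b_n) converges weakly in X, hence in norm
by Mazur's theorem, and the tails vanish (`BFIL.dominates_of_mem_strongL1`). Conversely, small tails
let S(f χ_A) serve as the integral over A (`BFIL.strongL1_mem_of_dominates`).

The extremal properties and the two equalities follow by truncation: order continuity of Y or X
makes the tails vanish, and the Fatou property lets a bound on all truncations pass to the function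
itself. -/

/-- A function norm: a countably subadditive, positively homogeneous, monotone and definite
functional on the `[0, ∞]`-valued measurable functions on `(0, ∞)`. -/
structure IsFnNorm (σ : (RPos → ℝ≥0∞) → ℝ≥0∞) : Prop where
  mono : ∀ {F G : RPos → ℝ≥0∞}, F ≤ᵐ[volume] G → σ F ≤ σ G
  const_mul : ∀ {c : ℝ≥0∞} (F : RPos → ℝ≥0∞), c ≠ ∞ → σ (fun x => c * F x) = c * σ F
  tsum_le : ∀ F : ℕ → RPos → ℝ≥0∞, (∀ n, Measurable (F n)) →
    σ (fun x => ∑' n, F n x) ≤ ∑' n, σ (F n)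
  eq_zero : ∀ {F : RPos → ℝ≥0∞}, Measurable F → σ F = 0 → F =ᵐ[volume] 0

namespace IsFnNorm

variable {σ τ : (RPos → ℝ≥0∞) → ℝ≥0∞}

theorem congr (hσ : IsFnNorm σ) {F G : RPos → ℝ≥0∞} (h : F =ᵐ[volume] G) : σ F = σ G :=
  le_antisymm (hσ.mono h.le) (hσ.mono h.symm.le)

theorem zero (hσ : IsFnNorm σ) : σ (fun _ => 0) = 0 := by
  simpa using hσ.const_mul (c := 0) (fun _ => 0) (by simp)

theorem add_le (hσ : IsFnNorm σ) {F G : RPos → ℝ≥0∞} (hF : Measurable F) (hG : Measurable G) :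
    σ (fun x => F x + G x) ≤ σ F + σ G := by
  let u : ℕ → RPos → ℝ≥0∞ := fun n => if n = 0 then F else if n = 1 then G else fun _ => 0
  have h2 : ∀ n, n ∉ Finset.range 2 → u n = fun _ => 0 := by
    intro n hn
    have h0 : n ≠ 0 := by rintro rfl; simp at hn
    have h1 : n ≠ 1 := by rintro rfl; simp at hn
    simp [u, h0, h1]
  have h := hσ.tsum_le u (fun n => by
    simp only [u]
    split_ifs
    exacts [hF, hG, measurable_const])
  have e1 : (fun x => ∑' n, u n x) = fun x => F x + G x := by
    ext x
    rw [tsum_eq_sum (s := Finset.range 2) fun n hn => by rw [h2 n hn]]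
    simp [Finset.sum_range_succ, u]
  have e2 : ∑' n, σ (u n) = σ F + σ G := by
    rw [tsum_eq_sum (s := Finset.range 2) fun n hn => by rw [h2 n hn, hσ.zero]]
    simp [Finset.sum_range_succ, u]
  rwa [e1, e2] at h

/-- The function equal to ∞ on {F = ∞} and 0 elsewhere is unchanged by doubling, so its finite norm
equals its own double and must vanish. -/
theorem ae_lt_top (hσ : IsFnNorm σ) {F : RPos → ℝ≥0∞} (hF : Measurable F) (h : σ F < ∞) :
    ∀ᵐ x, F x < ∞ := by
  have hE : MeasurableSet {x | F x = ∞} := hF (measurableSet_singleton _)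
  let G : RPos → ℝ≥0∞ := {x | F x = ∞}.indicator fun _ => ∞
  have hG : Measurable G := measurable_const.indicator hE
  have h1 : σ G ≤ σ F := hσ.mono <| .of_forall fun x => by
    by_cases hx : F x = ∞ <;> simp [G, hx]
  have h2 : σ G = 2 * σ G := by
    rw [← hσ.const_mul G (by simp)]
    congr 1
    ext x
    by_cases hx : F x = ∞ <;> simp [G, hx]
  have h3 : σ G = 0 := by
    have hlt : σ G ≠ ∞ := (h1.trans_lt h).ne
    by_contra h0
    rw [two_mul] at h2
    exact (ENNReal.lt_add_right hlt h0).ne h2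
  filter_upwards [hσ.eq_zero hG h3] with x hx
  by_contra hx'
  have : F x = ∞ := not_lt_top_iff.mp hx'
  simp [G, this] at hx

/-- A function norm that is finite wherever another one is finite is dominated by it. -/
theorem exists_le_mul (hσ : IsFnNorm σ) (hτ : IsFnNorm τ)
    (h : ∀ F, Measurable F → τ F < ∞ → σ F < ∞) :
    ∃ C : ℝ≥0∞, C ≠ ∞ ∧ ∀ F, Measurable F → τ F < ∞ → σ F ≤ C * τ F := by
  by_contra! hC
  choose F hF hFτ hlt using fun n : ℕ => hC (4 ^ n) (ENNReal.pow_ne_top (by simp))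
  have h0 : ∀ n, τ (F n) ≠ 0 := by
    intro n h0
    have := hlt n
    rw [h0, mul_zero, hσ.congr (hτ.eq_zero (hF n) h0)] at this
    exact absurd hσ.zero this.ne'
  have hc : ∀ n, (2 ^ n * τ (F n))⁻¹ ≠ ∞ := fun n => by
    rw [ENNReal.inv_ne_top]
    exact mul_ne_zero (by simp) (h0 n)
  -- Rescaling makes τ(G n) = 2⁻ⁿ, while the factor 4ⁿ in the choice of F n leaves σ(G n) ≥ 2ⁿ. So ∑
  -- G n has finite τ and infinite σ.
  let G : ℕ → RPos → ℝ≥0∞ := fun n x => (2 ^ n * τ (F n))⁻¹ * F n x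
  have hG : ∀ n, Measurable (G n) := fun n => (hF n).const_mul _
  have hGτ : ∀ n, τ (G n) = 2⁻¹ ^ n := by
    intro n
    rw [hτ.const_mul _ (hc n), ENNReal.mul_inv (.inl (by simp)) (.inl (by simp)), mul_assoc,
      ENNReal.inv_mul_cancel (h0 n) (hFτ n).ne, mul_one, ENNReal.inv_pow]
  have hGσ : ∀ n, 2 ^ n ≤ σ (G n) := by
    intro n
    rw [hσ.const_mul _ (hc n)]
    calc (2 : ℝ≥0∞) ^ n = (2 ^ n * τ (F n))⁻¹ * (4 ^ n * τ (F n)) := by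
          have e : (4 : ℝ≥0∞) ^ n = 2 ^ n * 2 ^ n := by
            rw [← mul_pow]; norm_num
          rw [e, mul_assoc, mul_left_comm, ENNReal.inv_mul_cancel, mul_one]
          · exact mul_ne_zero (by simp) (h0 n)
          · exact ENNReal.mul_ne_top (by simp) (hFτ n).ne
      _ ≤ _ := by gcongr; exact (hlt n).le
  have hfin : σ (fun x => ∑' n, G n x) < ∞ := by
    apply h _ (Measurable.tsum hG)
    refine (hτ.tsum_le G hG).trans_lt ?_
    simp only [hGτ, ENNReal.tsum_geometric]
    norm_num
  obtain ⟨n, hn⟩ := ENNReal.exists_nat_gt hfin.ne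
  have h1 : (2 : ℝ≥0∞) ^ n ≤ σ (fun x => ∑' n, G n x) :=
    (hGσ n).trans (hσ.mono (.of_forall fun x => ENNReal.le_tsum n))
  have h2 : (n : ℝ≥0∞) ≤ 2 ^ n := by exact_mod_cast (Nat.lt_two_pow_self (n := n)).le
  exact absurd (h2.trans h1) (not_le.mpr hn)

end IsFnNorm

/-! ### Spaces given by a function norm -/

/-- The absolute value of a function, with values in `[0, ∞]`. -/
def eabs (f : L0) : RPos → ℝ≥0∞ := fun x => ‖f x‖ₑ

theorem measurable_eabs (f : L0) : Measurable (eabs f) := f.measurable.enorm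

theorem eabs_zero : eabs 0 =ᵐ[volume] fun _ => 0 := by
  filter_upwards [AEEqFun.coeFn_zero (α := RPos) (β := ℝ) (μ := volume)] with x hx
  simp [eabs, hx]

theorem eabs_add_le (f g : L0) : eabs (f + g) ≤ᵐ[volume] fun x => eabs f x + eabs g x := by
  filter_upwards [AEEqFun.coeFn_add f g] with x hx
  simpa [eabs, hx] using enorm_add_le _ _

theorem eabs_sub_comm (f g : L0) : eabs (f - g) =ᵐ[volume] eabs (g - f) := by
  filter_upwards [AEEqFun.coeFn_sub f g, AEEqFun.coeFn_sub g f] with x hx hy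
  simp [eabs, hx, hy, enorm_sub_rev]

theorem eabs_smul (c : ℝ) (f : L0) : eabs (c • f) =ᵐ[volume] fun x => ‖c‖ₑ * eabs f x := by
  filter_upwards [AEEqFun.coeFn_smul c f] with x hx
  simp [eabs, hx, enorm_mul]

theorem eabs_abs (f : L0) : eabs |f| =ᵐ[volume] eabs f := by
  filter_upwards [AEEqFun.coeFn_abs f] with x hx
  simp [eabs, hx]

theorem eabs_le_iff {f g : L0} : eabs f ≤ᵐ[volume] eabs g ↔ |f| ≤ |g| := by
  rw [← AEEqFun.coeFn_le]
  have key : ∀ᵐ x, (eabs f x ≤ eabs g x ↔ (|f| : L0) x ≤ (|g| : L0) x) := by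
    filter_upwards [AEEqFun.coeFn_abs f, AEEqFun.coeFn_abs g] with x hx hy
    rw [hx, hy, eabs, eabs, enorm_le_iff_norm_le, Real.norm_eq_abs, Real.norm_eq_abs]
  exact ⟨fun h => by filter_upwards [h, key] with x hx hk using hk.mp hx,
    fun h => by filter_upwards [h, key] with x hx hk using hk.mpr hx⟩

/-- The class of the real function underlying an `[0, ∞]`-valued measurable function. -/
def ofENN (F : RPos → ℝ≥0∞) (hF : Measurable F) : L0 :=
  AEEqFun.mk (fun x => (F x).toReal) hF.ennreal_toReal.aestronglyMeasurable

theorem coeFn_ofENN (F : RPos → ℝ≥0∞) (hF : Measurable F) :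
    ofENN F hF =ᵐ[volume] fun x => (F x).toReal :=
  AEEqFun.coeFn_mk _ _

theorem eabs_ofENN {F : RPos → ℝ≥0∞} (hF : Measurable F) (h : ∀ᵐ x, F x < ∞) :
    eabs (ofENN F hF) =ᵐ[volume] F := by
  filter_upwards [coeFn_ofENN F hF, h] with x hx hlt
  rw [eabs, hx, Real.enorm_of_nonneg ENNReal.toReal_nonneg, ENNReal.ofReal_toReal hlt.ne]

/-- The space `Y` consists of the functions on which the function norm `σ` is finite, with norm
`σ`. -/
structure FnSpace.HasFnNorm (Y : FnSpace) (σ : (RPos → ℝ≥0∞) → ℝ≥0∞) : Prop where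
  mem_iff : ∀ f, f ∈ Y.carrier ↔ σ (eabs f) < ∞
  norm_eq : ∀ f ∈ Y.carrier, Y.norm f = (σ (eabs f)).toReal

namespace FnSpace.HasFnNorm

variable {Y Z : FnSpace} {σ τ : (RPos → ℝ≥0∞) → ℝ≥0∞}

theorem ofReal_norm (h : Y.HasFnNorm σ) {f : L0} (hf : f ∈ Y.carrier) :
    ENNReal.ofReal (Y.norm f) = σ (eabs f) := by
  rw [h.norm_eq f hf, ENNReal.ofReal_toReal ((h.mem_iff f).mp hf).ne]

theorem norm_le_of_le (h : Y.HasFnNorm σ) {f : L0} (hf : f ∈ Y.carrier) {c : ℝ} (hc : 0 ≤ c)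
    (hle : σ (eabs f) ≤ ENNReal.ofReal c) : Y.norm f ≤ c := by
  rwa [← h.ofReal_norm hf, ENNReal.ofReal_le_ofReal_iff hc] at hle

theorem tendsto_norm (h : Y.HasFnNorm σ) {u : ℕ → L0}
    (hu : Tendsto (fun n => σ (eabs (u n))) atTop (𝓝 0)) :
    Tendsto (fun n => Y.norm (u n)) atTop (𝓝 0) := by
  have h1 : Tendsto (fun n => (σ (eabs (u n))).toReal) atTop (𝓝 0) := by
    have := (ENNReal.tendsto_toReal ENNReal.zero_ne_top).comp hu
    rwa [ENNReal.toReal_zero] at this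
  refine h1.congr' ?_
  filter_upwards [hu.eventually_lt_const ENNReal.zero_lt_top] with n hn
  exact (h.norm_eq _ ((h.mem_iff _).mpr hn)).symm

/-- Only completeness has content. A rapidly Cauchy subsequence has increments whose pointwise sum
has finite σ, so it converges almost everywhere, and the tail sums of the increments bound the
distance to the limit. -/
theorem isBFIL (hσ : IsFnNorm σ) (h : Y.HasFnNorm σ) : Y.IsBFIL := by
  have hadd : ∀ f ∈ Y.carrier, ∀ g ∈ Y.carrier, f + g ∈ Y.carrier := fun f hf g hg =>
    (h.mem_iff _).mpr <| (hσ.mono (eabs_add_le f g)).trans_lt <|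
      (hσ.add_le (measurable_eabs f) (measurable_eabs g)).trans_lt <|
        ENNReal.add_lt_top.mpr ⟨(h.mem_iff _).mp hf, (h.mem_iff _).mp hg⟩
  have hsmul' : ∀ (c : ℝ) (f : L0), σ (eabs (c • f)) = ‖c‖ₑ * σ (eabs f) := fun c f => by
    rw [hσ.congr (eabs_smul c f), hσ.const_mul _ (by simp)]
  have hsmul : ∀ (c : ℝ), ∀ f ∈ Y.carrier, c • f ∈ Y.carrier := fun c f hf =>
    (h.mem_iff _).mpr <| by
      rw [hsmul']
      exact ENNReal.mul_lt_top (by simp) ((h.mem_iff _).mp hf)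
  have hsub : ∀ f ∈ Y.carrier, ∀ g ∈ Y.carrier, f - g ∈ Y.carrier := fun f hf g hg => by
    have := hadd f hf _ (hsmul (-1) g hg)
    rwa [neg_one_smul, ← sub_eq_add_neg] at this
  have hnonneg : ∀ f ∈ Y.carrier, 0 ≤ Y.norm f := fun f hf => by
    rw [h.norm_eq f hf]; exact ENNReal.toReal_nonneg
  have hideal : ∀ g ∈ Y.carrier, ∀ f : L0, |f| ≤ |g| → f ∈ Y.carrier ∧ Y.norm f ≤ Y.norm g := by
    intro g hg f hfg
    have hle := hσ.mono (eabs_le_iff.mpr hfg)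
    have hf := (h.mem_iff f).mpr (hle.trans_lt ((h.mem_iff g).mp hg))
    refine ⟨hf, h.norm_le_of_le hf (hnonneg g hg) ?_⟩
    rwa [h.ofReal_norm hg]
  have htri : ∀ f ∈ Y.carrier, ∀ g ∈ Y.carrier, Y.norm (f + g) ≤ Y.norm f + Y.norm g := by
    intro f hf g hg
    refine h.norm_le_of_le (hadd f hf g hg) (add_nonneg (hnonneg f hf) (hnonneg g hg)) ?_
    rw [ENNReal.ofReal_add (hnonneg f hf) (hnonneg g hg), h.ofReal_norm hf, h.ofReal_norm hg]
    exact (hσ.mono (eabs_add_le f g)).trans (hσ.add_le (measurable_eabs f) (measurable_eabs g))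
  refine ⟨?_, hadd, hsmul, hnonneg, ?_, ?_, htri, hideal, ?_⟩
  · rw [h.mem_iff, hσ.congr eabs_zero, hσ.zero]
    exact ENNReal.zero_lt_top
  · intro f hf h0
    have h1 : σ (eabs f) = 0 := by rw [← h.ofReal_norm hf, h0, ENNReal.ofReal_zero]
    apply AEEqFun.ext
    filter_upwards [hσ.eq_zero (measurable_eabs f) h1,
      AEEqFun.coeFn_zero (α := RPos) (β := ℝ) (μ := volume)] with x hx h0
    simpa [eabs, h0] using hx
  · intro c f hf
    rw [h.norm_eq _ (hsmul c f hf), hsmul', ENNReal.toReal_mul, h.norm_eq f hf]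
    simp
  · intro u hu hc
    have hc' : ∀ k : ℕ, ∃ N, ∀ m ≥ N, ∀ n ≥ N, Y.norm (u m - u n) < 2⁻¹ ^ k := fun k =>
      hc _ (by positivity)
    choose N hN using hc'
    -- Running maxima of N, so that the indices of the subsequence increase.
    let φ : ℕ → ℕ := fun k => (Finset.range (k + 1)).sup N
    have hNφ : ∀ k, N k ≤ φ k := fun k => Finset.le_sup (f := N) (by simp)
    have hφ : ∀ k, φ k ≤ φ (k + 1) := fun k => Finset.sup_mono (Finset.range_mono (by omega))
    have hd : ∀ k, ∀ m ≥ φ k, ∀ n ≥ φ k, σ (eabs (u m - u n)) ≤ 2⁻¹ ^ k := by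
      intro k m hm n hn
      rw [← h.ofReal_norm (hsub _ (hu m) _ (hu n))]
      refine (ENNReal.ofReal_le_ofReal
        (hN k m ((hNφ k).trans hm) n ((hNφ k).trans hn)).le).trans ?_
      rw [ENNReal.ofReal_pow (by norm_num), ENNReal.ofReal_inv_of_pos (by norm_num)]
      simp
    let d : ℕ → RPos → ℝ≥0∞ := fun k => eabs (u (φ k) - u (φ (k + 1)))
    have hdm : ∀ k, Measurable (d k) := fun k => measurable_eabs _
    have hdσ : ∀ k, σ (d k) ≤ 2⁻¹ ^ k := fun k => hd k _ le_rfl _ (hφ k)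
    have hgeo : ∀ k : ℕ, σ (fun x => ∑' j, d (k + j) x) ≤ 2⁻¹ ^ k * 2 := by
      intro k
      refine (hσ.tsum_le _ fun j => hdm (k + j)).trans ?_
      calc ∑' j, σ (d (k + j)) ≤ ∑' j, 2⁻¹ ^ k * 2⁻¹ ^ j := by
            refine ENNReal.tsum_le_tsum fun j => ?_
            rw [← pow_add]; exact hdσ _
        _ = 2⁻¹ ^ k * 2 := by
            rw [ENNReal.tsum_mul_left, ENNReal.tsum_geometric]
            congr 1
            rw [ENNReal.one_sub_inv_two, inv_inv]
    have hfin : ∀ᵐ x, ∑' j, d j x < ∞ := by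
      refine hσ.ae_lt_top (Measurable.tsum hdm) ?_
      have := hgeo 0
      simp only [zero_add, pow_zero, one_mul] at this
      exact this.trans_lt (by simp)
    have hdist : ∀ᵐ x, ∀ k, edist (u (φ k) x) (u (φ (k + 1)) x) = d k x := by
      rw [ae_all_iff]
      intro k
      filter_upwards [AEEqFun.coeFn_sub (u (φ k)) (u (φ (k + 1)))] with x hx
      simp [d, eabs, hx, edist_eq_enorm_sub]
    have hlim : ∀ᵐ x, ∃ l : ℝ, Tendsto (fun k => u (φ k) x) atTop (𝓝 l) := by
      filter_upwards [hfin, hdist] with x hx hxd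
      exact cauchySeq_tendsto_of_complete
        (cauchySeq_of_edist_le_of_tsum_ne_top _ (fun k => (hxd k).le) hx.ne)
    obtain ⟨f, hf, hfl⟩ := exists_stronglyMeasurable_limit_of_tendsto_ae
      (fun k => (u (φ k)).aestronglyMeasurable) hlim
    let g : L0 := AEEqFun.mk f hf.aestronglyMeasurable
    have hgf : g =ᵐ[volume] f := AEEqFun.coeFn_mk _ _
    have hkey : ∀ k, σ (eabs (u (φ k) - g)) ≤ 2⁻¹ ^ k * 2 := by
      intro k
      refine (hσ.mono ?_).trans (hgeo k)
      filter_upwards [hfl, hgf, hdist, AEEqFun.coeFn_sub (u (φ k)) g] with x hx hgx hxd hs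
      have := edist_le_tsum_of_edist_le_of_tendsto _ (fun k => (hxd k).le) hx k
      simpa [eabs, hs, hgx, edist_eq_enorm_sub] using this
    have hdiff : ∀ k, u (φ k) - g ∈ Y.carrier := fun k =>
      (h.mem_iff _).mpr ((hkey k).trans_lt (ENNReal.mul_lt_top
        (ENNReal.pow_lt_top (by simp)) (by simp)))
    have hgY : g ∈ Y.carrier := by
      have := hsub _ (hu (φ 0)) _ (hdiff 0)
      rwa [sub_sub_cancel] at this
    refine ⟨g, hgY, ?_⟩
    rw [Metric.tendsto_atTop]
    intro ε hε
    -- The distance from u n to the subsequence costs 2⁻ᵏ and the tail of the series costs 2 · 2⁻ᵏ,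
    -- which accounts for ε / 3.
    obtain ⟨k, hk⟩ := exists_pow_lt_of_lt_one (show 0 < ε / 3 by positivity)
      (show (2⁻¹ : ℝ) < 1 by norm_num)
    refine ⟨φ k, fun n hn => ?_⟩
    rw [Real.dist_eq, sub_zero, abs_of_nonneg (hnonneg _ (hsub _ (hu n) _ hgY))]
    have e : u n - g = (u n - u (φ k)) + (u (φ k) - g) := by abel
    have h1 : Y.norm (u n - u (φ k)) < 2⁻¹ ^ k :=
      hN k n ((hNφ k).trans hn) _ (hNφ k)
    have h2 : Y.norm (u (φ k) - g) ≤ 2⁻¹ ^ k * 2 := by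
      refine h.norm_le_of_le (hdiff k) (by positivity) ((hkey k).trans_eq ?_)
      rw [ENNReal.ofReal_mul (by positivity), ENNReal.ofReal_pow (by norm_num),
        ENNReal.ofReal_inv_of_pos (by norm_num)]
      simp
    rw [e]
    refine (htri _ (hsub _ (hu n) _ (hu _)) _ (hdiff k)).trans_lt ?_
    linarith

theorem embeds (hY : Y.HasFnNorm σ) (hZ : Z.HasFnNorm τ) {C : ℝ≥0∞} (hC : C ≠ ∞)
    (h : ∀ f : L0, σ (eabs f) < ∞ → τ (eabs f) ≤ C * σ (eabs f)) : Y.Embeds Z := by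
  refine ⟨fun f hf => ?_, C.toReal, fun f hf => ?_⟩
  · have hlt := (hY.mem_iff f).mp hf
    exact (hZ.mem_iff f).mpr ((h f hlt).trans_lt (ENNReal.mul_lt_top hC.lt_top hlt))
  · have hlt := (hY.mem_iff f).mp hf
    have hfZ := (hZ.mem_iff f).mpr ((h f hlt).trans_lt (ENNReal.mul_lt_top hC.lt_top hlt))
    rw [hY.norm_eq f hf, hZ.norm_eq f hfZ, ← ENNReal.toReal_mul]
    exact ENNReal.toReal_mono (ENNReal.mul_ne_top hC hlt.ne) (h f hlt)

/-- An inclusion of Banach function ideal lattices bounds the function norms. -/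
theorem exists_le_mul (hσ : IsFnNorm σ) (hτ : IsFnNorm τ) (hY : Y.HasFnNorm σ)
    (hZ : Z.HasFnNorm τ) (h : Y.carrier ⊆ Z.carrier) :
    ∃ C : ℝ≥0∞, C ≠ ∞ ∧ ∀ F, Measurable F → σ F < ∞ → τ F ≤ C * σ F := by
  refine hτ.exists_le_mul hσ fun F hF hlt => ?_
  have e := eabs_ofENN hF (hσ.ae_lt_top hF hlt)
  rw [← hτ.congr e]
  rw [← hσ.congr e] at hlt
  exact (hZ.mem_iff _).mp (h ((hY.mem_iff _).mpr hlt))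

end FnSpace.HasFnNorm

/-! ### The order continuous part of a function norm -/

/-- The dominated convergence theorem holds for `σ` below `F`. -/
def DominatesConvergence (σ : (RPos → ℝ≥0∞) → ℝ≥0∞) (F : RPos → ℝ≥0∞) : Prop :=
  ∀ H : ℕ → RPos → ℝ≥0∞, (∀ n, Measurable (H n)) → (∀ n, H n ≤ᵐ[volume] F) →
    (∀ᵐ x, Tendsto (fun n => H n x) atTop (𝓝 0)) → Tendsto (fun n => σ (H n)) atTop (𝓝 0)

namespace DominatesConvergence

variable {σ : (RPos → ℝ≥0∞) → ℝ≥0∞} {F G : RPos → ℝ≥0∞}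

theorem mono (hG : DominatesConvergence σ G) (h : F ≤ᵐ[volume] G) : DominatesConvergence σ F :=
  fun H hH hle ht => hG H hH (fun n => (hle n).trans h) ht

theorem const_mul (hσ : IsFnNorm σ) (hF : DominatesConvergence σ F) {c : ℝ≥0∞} (hc : c ≠ ∞) :
    DominatesConvergence σ fun x => c * F x := by
  rcases eq_or_ne c 0 with rfl | h0
  · intro H hH hle ht
    have : ∀ n, σ (H n) = 0 := fun n => by
      rw [← hσ.zero]
      refine hσ.congr ?_
      filter_upwards [hle n] with x hx
      simpa using hx
    simp [this]
  intro H hH hle ht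
  have h1 := hF (fun n x => c⁻¹ * H n x) (fun n => (hH n).const_mul _) (fun n => by
    filter_upwards [hle n] with x hx
    rw [mul_comm, ← div_eq_mul_inv]
    exact ENNReal.div_le_of_le_mul (by rwa [mul_comm])) (by
    filter_upwards [ht] with x hx
    simpa using ENNReal.Tendsto.const_mul hx (.inr (ENNReal.inv_ne_top.mpr h0)))
  have h2 := ENNReal.Tendsto.const_mul (a := c) h1 (.inr hc)
  rw [mul_zero] at h2
  refine h2.congr fun n => ?_
  rw [hσ.const_mul _ (ENNReal.inv_ne_top.mpr h0), ← mul_assoc, ENNReal.mul_inv_cancel h0 hc,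
    one_mul]

/-- If `F` is, up to small norm, a finite sum of functions below which dominated convergence
holds, then it holds below `F`. -/
theorem of_split (hσ : IsFnNorm σ) (h : ∀ ε > 0, ∃ G R : RPos → ℝ≥0∞, Measurable G ∧ Measurable R ∧
    DominatesConvergence σ G ∧ σ R ≤ ε ∧ F ≤ᵐ[volume] fun x => G x + R x) :
    DominatesConvergence σ F := by
  intro H hH hle ht
  rw [ENNReal.tendsto_nhds_zero]
  intro ε hε
  obtain ⟨G, R, hG, hR, hGc, hRε, hFle⟩ := h (ε / 2) (ENNReal.half_pos hε.ne')
  have h1 := hGc (fun n x => min (H n x) (G x)) (fun n => (hH n).min hG)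
    (fun n => .of_forall fun _ => min_le_right _ _) (by
      filter_upwards [ht] with x hx
      exact tendsto_of_tendsto_of_tendsto_of_le_of_le tendsto_const_nhds hx
        (fun n => zero_le) (fun n => min_le_left _ _))
  rw [ENNReal.tendsto_nhds_zero] at h1
  filter_upwards [h1 (ε / 2) (ENNReal.half_pos hε.ne')] with n hn
  calc σ (H n) ≤ σ (fun x => min (H n x) (G x) + R x) := by
        apply hσ.mono
        filter_upwards [hle n, hFle] with x hx hx'
        rcases le_total (H n x) (G x) with h | h
        · rw [min_eq_left h]; exact le_self_add
        · rw [min_eq_right h]; exact hx.trans hx'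
    _ ≤ σ (fun x => min (H n x) (G x)) + σ R := hσ.add_le ((hH n).min hG) hR
    _ ≤ ε / 2 + ε / 2 := add_le_add hn hRε
    _ = ε := ENNReal.add_halves ε

theorem add (hσ : IsFnNorm σ) (hFm : Measurable F) (hGm : Measurable G)
    (hF : DominatesConvergence σ F) (hG : DominatesConvergence σ G) :
    DominatesConvergence σ fun x => F x + G x := by
  intro H hH hle ht
  have key : ∀ K : RPos → ℝ≥0∞, Measurable K → DominatesConvergence σ K →
      Tendsto (fun n => σ fun x => min (H n x) (K x)) atTop (𝓝 0) := fun K hKm hK =>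
    hK (fun n x => min (H n x) (K x)) (fun n => (hH n).min hKm)
      (fun n => .of_forall fun _ => min_le_right _ _) (by
        filter_upwards [ht] with x hx
        exact tendsto_of_tendsto_of_tendsto_of_le_of_le tendsto_const_nhds hx
          (fun n => zero_le) (fun n => min_le_left _ _))
  have h1 := (key F hFm hF).add (key G hGm hG)
  rw [add_zero] at h1
  refine tendsto_of_tendsto_of_tendsto_of_le_of_le tendsto_const_nhds h1 (fun n => zero_le)
    fun n => ?_
  refine (hσ.mono ?_).trans (hσ.add_le ((hH n).min hFm) ((hH n).min hGm))
  filter_upwards [hle n] with x hx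
  rcases le_total (H n x) (F x) with h | h
  · rw [min_eq_left h]; exact le_self_add
  rcases le_total (H n x) (G x) with h' | h'
  · rw [min_eq_left h']; exact le_add_self
  rwa [min_eq_right h, min_eq_right h']

theorem zero (hσ : IsFnNorm σ) : DominatesConvergence σ fun _ => 0 := by
  intro H hH hle ht
  have : ∀ n, σ (H n) = 0 := fun n => by
    rw [← hσ.zero]
    refine hσ.congr ?_
    filter_upwards [hle n] with x hx
    simpa using hx
  simp [this]

theorem sum (hσ : IsFnNorm σ) {u : ℕ → RPos → ℝ≥0∞} (hu : ∀ n, Measurable (u n))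
    (h : ∀ n, DominatesConvergence σ (u n)) (N : ℕ) :
    DominatesConvergence σ fun x => ∑ n ∈ Finset.range N, u n x := by
  induction N with
  | zero => simpa using zero hσ
  | succ N ih =>
    simp only [Finset.sum_range_succ]
    exact add hσ (Finset.measurable_sum _ fun n _ => hu n) (hu N) ih (h N)

/-- Partial sums are handled by finite additivity of the property, and the remainder has small norm
because the series of norms converges, so `of_split` applies. -/
theorem tsum (hσ : IsFnNorm σ) {u : ℕ → RPos → ℝ≥0∞} (hu : ∀ n, Measurable (u n))
    (h : ∀ n, DominatesConvergence σ (u n)) (hfin : ∑' n, σ (u n) ≠ ∞) :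
    DominatesConvergence σ fun x => ∑' n, u n x := by
  refine of_split hσ fun ε hε => ?_
  have ht := ENNReal.tendsto_sum_nat_add (fun n => σ (u n)) hfin
  rw [ENNReal.tendsto_nhds_zero] at ht
  obtain ⟨N, hN⟩ := (ht ε hε).exists
  refine ⟨_, fun x => ∑' n, u (n + N) x, Finset.measurable_sum (Finset.range N) fun n _ => hu n,
    Measurable.tsum fun n => hu _, by simpa only [Finset.sum_apply] using sum hσ hu h N,
    (hσ.tsum_le _ fun n => hu _).trans hN, .of_forall fun x => ?_⟩
  exact (ENNReal.summable.sum_add_tsum_nat_add').symm.le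

end DominatesConvergence

open Classical in
/-- The function norm that agrees with `σ` on the functions below which dominated convergence
holds for `σ`, and is infinite on the others. -/
def ocPart (σ : (RPos → ℝ≥0∞) → ℝ≥0∞) (F : RPos → ℝ≥0∞) : ℝ≥0∞ :=
  if DominatesConvergence σ F then σ F else ∞

section ocPart

variable {σ : (RPos → ℝ≥0∞) → ℝ≥0∞} {F : RPos → ℝ≥0∞}

theorem ocPart_of_dominates (h : DominatesConvergence σ F) : ocPart σ F = σ F := if_pos h

theorem le_ocPart (σ : (RPos → ℝ≥0∞) → ℝ≥0∞) (F : RPos → ℝ≥0∞) : σ F ≤ ocPart σ F := by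
  rw [ocPart]; split_ifs
  exacts [le_rfl, le_top]

theorem ocPart_lt_top : ocPart σ F < ∞ ↔ DominatesConvergence σ F ∧ σ F < ∞ := by
  rw [ocPart]; split_ifs with h <;> simp [h]

/-- The functions below which dominated convergence holds form an ideal stable under finite scalars
and norm-convergent series. Assigning ∞ elsewhere therefore breaks none of the axioms, and the
resulting space inherits completeness. -/
theorem isFnNorm_ocPart (hσ : IsFnNorm σ) : IsFnNorm (ocPart σ) where
  mono {F G} h := by
    by_cases hG : DominatesConvergence σ G
    · rw [ocPart_of_dominates hG, ocPart_of_dominates (hG.mono h)]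
      exact hσ.mono h
    · rw [ocPart, ocPart, if_neg hG]; exact le_top
  const_mul {c} F hc := by
    rcases eq_or_ne c 0 with rfl | h0
    · simp only [zero_mul]
      rw [ocPart_of_dominates (.zero hσ), hσ.zero]
    by_cases hF : DominatesConvergence σ F
    · rw [ocPart_of_dominates hF, ocPart_of_dominates (hF.const_mul hσ hc), hσ.const_mul F hc]
    · have h' : ¬ DominatesConvergence σ fun x => c * F x := fun h => hF <| by
        have := h.const_mul hσ (ENNReal.inv_ne_top.mpr h0)
        simpa [← mul_assoc, ENNReal.inv_mul_cancel h0 hc] using this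
      rw [ocPart, ocPart, if_neg hF, if_neg h', ENNReal.mul_top h0]
  tsum_le u hu := by
    rcases eq_or_ne (∑' n, ocPart σ (u n)) ∞ with h | h
    · rw [h]; exact le_top
    have hn : ∀ n, DominatesConvergence σ (u n) := fun n =>
      (ocPart_lt_top.mp (ENNReal.ne_top_of_tsum_ne_top h n).lt_top).1
    simp only [ocPart_of_dominates (hn _)] at h ⊢
    rw [ocPart_of_dominates (.tsum hσ hu hn h)]
    exact hσ.tsum_le u hu
  eq_zero hF h := hσ.eq_zero hF (le_antisymm ((le_ocPart σ _).trans h.le) zero_le)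

end ocPart

/-- An increasing sequence u n bounded by g has an a.e. limit v, and |u n - v| stays below |g| + |u
0|, below which dominated convergence holds. -/
theorem FnSpace.HasFnNorm.orderContinuous {Y : FnSpace} {σ : (RPos → ℝ≥0∞) → ℝ≥0∞}
    (hσ : IsFnNorm σ) (h : Y.HasFnNorm (ocPart σ)) : Y.OrderContinuous := by
  intro u hu hmono hb
  obtain ⟨g, hg, hug⟩ := hb
  have hug' : ∀ᵐ x, ∀ n, u n x ≤ g x := ae_all_iff.mpr fun n => AEEqFun.coeFn_le.mpr (hug n)
  have hmono' : ∀ᵐ x, Monotone fun n => u n x := by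
    have : ∀ᵐ x, ∀ n, u n x ≤ u (n + 1) x :=
      ae_all_iff.mpr fun n => AEEqFun.coeFn_le.mpr (hmono n.le_succ)
    filter_upwards [this] with x hx using monotone_nat_of_le_succ hx
  have hlim : ∀ᵐ x, ∃ l : ℝ, Tendsto (fun n => u n x) atTop (𝓝 l) := by
    filter_upwards [hug', hmono'] with x h1 h2
    exact ⟨_, tendsto_atTop_ciSup h2 ⟨g x, by rintro _ ⟨n, rfl⟩; exact h1 n⟩⟩
  obtain ⟨f, hf, hfl⟩ := exists_stronglyMeasurable_limit_of_tendsto_ae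
    (fun n => (u n).aestronglyMeasurable) hlim
  let v : L0 := AEEqFun.mk f hf.aestronglyMeasurable
  have hvf : v =ᵐ[volume] f := AEEqFun.coeFn_mk _ _
  have hsum : ocPart σ (fun x => eabs g x + eabs (u 0) x) < ∞ :=
    ((isFnNorm_ocPart hσ).add_le (measurable_eabs _) (measurable_eabs _)).trans_lt
      (ENNReal.add_lt_top.mpr ⟨(h.mem_iff _).mp hg, (h.mem_iff _).mp (hu 0)⟩)
  have hbound : ∀ᵐ x, ∀ n, u 0 x ≤ u n x ∧ u n x ≤ v x ∧ v x ≤ g x := by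
    filter_upwards [hug', hmono', hfl, hvf] with x h1 h2 h3 h4 n
    rw [h4]
    exact ⟨h2 n.zero_le, h2.ge_of_tendsto h3 n, le_of_tendsto' h3 h1⟩
  have hv : v ∈ Y.carrier := by
    refine (h.mem_iff _).mpr (((isFnNorm_ocPart hσ).mono ?_).trans_lt hsum)
    filter_upwards [hbound] with x hx
    obtain ⟨h1, h2, h3⟩ := hx 0
    simp only [eabs, Real.enorm_eq_ofReal_abs]
    rw [← ENNReal.ofReal_add (abs_nonneg _) (abs_nonneg _)]
    apply ENNReal.ofReal_le_ofReal
    rw [abs_le]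
    constructor <;> cases abs_cases (g x) <;> cases abs_cases (u 0 x) <;> linarith
  have hle : ∀ n, eabs (u n - v) ≤ᵐ[volume] fun x => eabs g x + eabs (u 0) x := by
    intro n
    filter_upwards [hbound, AEEqFun.coeFn_sub (u n) v] with x hx hs
    obtain ⟨h1, h2, h3⟩ := hx n
    simp only [eabs, hs, Pi.sub_apply, Real.enorm_eq_ofReal_abs]
    rw [← ENNReal.ofReal_add (abs_nonneg _) (abs_nonneg _)]
    apply ENNReal.ofReal_le_ofReal
    rw [abs_le]
    constructor <;> cases abs_cases (g x) <;> cases abs_cases (u 0 x) <;> linarith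
  have hdc := (ocPart_lt_top.mp hsum).1
  have hlim0 : ∀ᵐ x, Tendsto (fun n => eabs (u n - v) x) atTop (𝓝 0) := by
    have hs : ∀ᵐ x, ∀ n, (u n - v : L0) x = u n x - v x :=
      ae_all_iff.mpr fun n => AEEqFun.coeFn_sub (u n) v
    filter_upwards [hfl, hvf, hs] with x h1 h2 h3
    have h4 : Tendsto (fun n => u n x - v x) atTop (𝓝 0) := by
      simpa [h2] using h1.sub_const (f x)
    simpa [eabs, h3] using h4.enorm
  refine ⟨v, hv, h.tendsto_norm ?_⟩
  refine (hdc _ (fun n => measurable_eabs _) hle hlim0).congr fun n => ?_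
  rw [ocPart_of_dominates (hdc.mono (hle n))]

/-! ### The function norm of a Banach function ideal lattice -/

/-- The norm of `X`, as a functional on `[0, ∞]`-valued functions. -/
def FnSpace.fnNorm (X : FnSpace) (F : RPos → ℝ≥0∞) : ℝ≥0∞ :=
  ⨅ (g : L0) (_ : g ∈ X.carrier) (_ : F ≤ᵐ[volume] eabs g), ENNReal.ofReal (X.norm g)

theorem FnSpace.fnNorm_le {X : FnSpace} {F : RPos → ℝ≥0∞} {g : L0} (hg : g ∈ X.carrier)
    (h : F ≤ᵐ[volume] eabs g) : X.fnNorm F ≤ ENNReal.ofReal (X.norm g) :=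
  iInf_le_of_le g (iInf_le_of_le hg (iInf_le_of_le h le_rfl))

theorem FnSpace.exists_of_fnNorm_lt {X : FnSpace} {F : RPos → ℝ≥0∞} {c : ℝ≥0∞}
    (h : X.fnNorm F < c) :
    ∃ g ∈ X.carrier, F ≤ᵐ[volume] eabs g ∧ ENNReal.ofReal (X.norm g) < c := by
  simp only [FnSpace.fnNorm, iInf_lt_iff] at h
  obtain ⟨g, hg, hle, hlt⟩ := h
  exact ⟨g, hg, hle, hlt⟩

namespace FnSpace.IsBFIL

variable {X : FnSpace}

theorem sub_mem (hX : X.IsBFIL) {f g : L0} (hf : f ∈ X.carrier) (hg : g ∈ X.carrier) :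
    f - g ∈ X.carrier := by
  have := hX.add_mem f hf _ (hX.smul_mem (-1) g hg)
  rwa [neg_one_smul, ← sub_eq_add_neg] at this

theorem norm_zero (hX : X.IsBFIL) : X.norm 0 = 0 := by
  have h := hX.norm_smul 0 0 hX.zero_mem
  simpa using h

theorem ideal_eabs (hX : X.IsBFIL) {f g : L0} (hg : g ∈ X.carrier)
    (h : eabs f ≤ᵐ[volume] eabs g) : f ∈ X.carrier ∧ X.norm f ≤ X.norm g :=
  hX.ideal g hg f (eabs_le_iff.mp h)

theorem norm_congr (hX : X.IsBFIL) {f g : L0} (hg : g ∈ X.carrier)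
    (h : eabs f =ᵐ[volume] eabs g) : X.norm f = X.norm g :=
  le_antisymm (hX.ideal_eabs hg h.le).2
    (hX.ideal_eabs (hX.ideal_eabs hg h.le).1 h.symm.le).2

theorem hasFnNorm (hX : X.IsBFIL) : X.HasFnNorm X.fnNorm := by
  have key : ∀ f ∈ X.carrier, X.fnNorm (eabs f) = ENNReal.ofReal (X.norm f) := by
    intro f hf
    refine le_antisymm (FnSpace.fnNorm_le hf (EventuallyLE.refl _ _)) ?_
    exact le_iInf fun g => le_iInf fun hg => le_iInf fun h =>
      ENNReal.ofReal_le_ofReal (hX.ideal_eabs hg h).2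
  refine ⟨fun f => ⟨fun hf => by rw [key f hf]; exact ENNReal.ofReal_lt_top, fun h => ?_⟩,
    fun f hf => by rw [key f hf, ENNReal.toReal_ofReal (hX.norm_nonneg f hf)]⟩
  obtain ⟨g, hg, hle, -⟩ := FnSpace.exists_of_fnNorm_lt h
  exact (hX.ideal_eabs hg hle).1

/-- The norm limit of an increasing sequence is an upper bound. -/
theorem le_of_tendsto_norm (hX : X.IsBFIL) {u : ℕ → L0} (hu : ∀ n, u n ∈ X.carrier)
    (hmono : Monotone u) {f : L0} (hf : f ∈ X.carrier)
    (h : Tendsto (fun n => X.norm (u n - f)) atTop (𝓝 0)) (n : ℕ) : u n ≤ f := by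
  let p : L0 := (u n - f) ⊔ 0
  have hp : p =ᵐ[volume] fun x => max (u n x - f x) 0 := by
    filter_upwards [AEEqFun.coeFn_sup (u n - f) 0, AEEqFun.coeFn_sub (u n) f,
      AEEqFun.coeFn_zero (α := RPos) (β := ℝ) (μ := volume)] with x h1 h2 h3
    simp [p, h1, h2, h3]
  -- For m ≥ n the positive part of u n - f is at most |u m - f|, whose norm tends to 0 with m.
  have hpm : ∀ m, n ≤ m → p ∈ X.carrier ∧ X.norm p ≤ X.norm (u m - f) := by
    intro m hm
    refine hX.ideal_eabs (hX.sub_mem (hu m) hf) ?_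
    filter_upwards [hp, AEEqFun.coeFn_sub (u m) f, AEEqFun.coeFn_le.mpr (hmono hm)] with x h1 h2 h3
    rw [eabs, eabs, h1, h2, enorm_le_iff_norm_le, Real.norm_eq_abs, Real.norm_eq_abs,
      abs_of_nonneg (le_max_right _ _), Pi.sub_apply]
    exact max_le ((sub_le_sub_right h3 _).trans (le_abs_self _)) (abs_nonneg _)
  have h0 : X.norm p ≤ 0 := ge_of_tendsto h (by
    filter_upwards [eventually_ge_atTop n] with m hm using (hpm m hm).2)
  have hp0 : p = 0 := hX.eq_zero_of_norm p (hpm n le_rfl).1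
    (le_antisymm h0 (hX.norm_nonneg p (hpm n le_rfl).1))
  rw [← AEEqFun.coeFn_le]
  filter_upwards [hp, AEEqFun.coeFn_zero (α := RPos) (β := ℝ) (μ := volume)] with x h1 h2
  rw [hp0, h2] at h1
  have := le_max_left (u n x - f x) 0
  rw [← h1] at this
  simpa using this

theorem norm_sum_le (hX : X.IsBFIL) {u : ℕ → L0} (hu : ∀ n, u n ∈ X.carrier) (s : Finset ℕ) :
    (∑ n ∈ s, u n) ∈ X.carrier ∧ X.norm (∑ n ∈ s, u n) ≤ ∑ n ∈ s, X.norm (u n) := by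
  induction s using Finset.induction_on with
  | empty => simpa using ⟨hX.zero_mem, hX.norm_zero.le⟩
  | insert a s ha ih =>
    rw [Finset.sum_insert ha, Finset.sum_insert ha]
    exact ⟨hX.add_mem _ (hu a) _ ih.1,
      (hX.norm_add_le _ (hu a) _ ih.1).trans (by linarith [ih.2])⟩

/-- The Riesz–Fischer property. -/
theorem exists_tsum_le (hX : X.IsBFIL) {u : ℕ → L0} (hu : ∀ n, u n ∈ X.carrier)
    (hs : Summable fun n => X.norm (u n)) :
    ∃ f ∈ X.carrier, (∀ᵐ x, ∑' n, eabs (u n) x ≤ eabs f x) ∧ X.norm f ≤ ∑' n, X.norm (u n) := by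
  have habs : ∀ n, |u n| ∈ X.carrier ∧ X.norm |u n| = X.norm (u n) := fun n =>
    ⟨(hX.ideal_eabs (hu n) (eabs_abs (u n)).le).1, hX.norm_congr (hu n) (eabs_abs (u n))⟩
  let s : ℕ → L0 := fun N => ∑ n ∈ Finset.range N, |u n|
  have hsX : ∀ N, s N ∈ X.carrier := fun N => (hX.norm_sum_le (fun n => (habs n).1) _).1
  have hcoe : ∀ᵐ x, ∀ N, s N x = ∑ n ∈ Finset.range N, |u n x| := by
    rw [ae_all_iff]
    intro N
    have h1 : ∀ᵐ x, ∀ n, (|u n| : L0) x = |u n x| :=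
      ae_all_iff.mpr fun n => AEEqFun.coeFn_abs (u n)
    have h2 : s N =ᵐ[volume] ∑ n ∈ Finset.range N, ⇑(|u n| : L0) := by
      simp only [s]
      induction N with
      | zero => simpa using AEEqFun.coeFn_zero
      | succ N ih =>
        simp only [Finset.sum_range_succ]
        exact (AEEqFun.coeFn_add _ _).trans (ih.add (EventuallyEq.refl _ _))
    filter_upwards [h1, h2] with x h1 h2
    simp [h2, h1]
  have hdiff : ∀ m n, m ≤ n → X.norm (s n - s m) ≤ ∑ k ∈ Finset.Ico m n, X.norm (u k) := by
    intro m n hmn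
    have : s n - s m = ∑ k ∈ Finset.Ico m n, |u k| := (Finset.sum_Ico_eq_sub _ hmn).symm
    rw [this]
    refine (hX.norm_sum_le (fun n => (habs n).1) _).2.trans_eq ?_
    exact Finset.sum_congr rfl fun k _ => (habs k).2
  have hsymm : ∀ m n, X.norm (s m - s n) = X.norm (s n - s m) := fun m n =>
    hX.norm_congr (hX.sub_mem (hsX n) (hsX m)) (eabs_sub_comm _ _)
  have hmono : Monotone s := monotone_nat_of_le_succ fun N => by
    rw [← AEEqFun.coeFn_le]
    filter_upwards [hcoe] with x hx
    rw [hx, hx, Finset.sum_range_succ]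
    linarith [abs_nonneg (u N x)]
  have hcs : CauchySeq fun N => ∑ n ∈ Finset.range N, X.norm (u n) :=
    hs.hasSum.tendsto_sum_nat.cauchySeq
  obtain ⟨f, hf, hlim⟩ := hX.complete s hsX (by
    intro ε hε
    obtain ⟨N, hN⟩ := Metric.cauchySeq_iff.mp hcs ε hε
    have : ∀ m ≥ N, ∀ n ≥ N, m ≤ n → X.norm (s n - s m) < ε := by
      intro m hm n hn hmn
      refine (hdiff m n hmn).trans_lt ?_
      have := hN n hn m hm
      rw [Real.dist_eq, ← Finset.sum_Ico_eq_sub _ hmn] at this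
      exact (le_abs_self _).trans_lt this
    refine ⟨N, fun m hm n hn => ?_⟩
    rcases le_total m n with h | h
    · rw [hsymm]; exact this m hm n hn h
    · exact this n hn m hm h)
  refine ⟨f, hf, ?_, ?_⟩
  · have hle : ∀ᵐ x, ∀ N, s N x ≤ f x :=
      ae_all_iff.mpr fun N => AEEqFun.coeFn_le.mpr (hX.le_of_tendsto_norm hsX hmono hf hlim N)
    filter_upwards [hle, hcoe] with x h1 h2
    rw [ENNReal.tsum_eq_iSup_nat]
    refine iSup_le fun N => ?_
    have h3 := h1 N
    rw [h2] at h3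
    simp only [eabs, Real.enorm_eq_ofReal_abs]
    rw [← ENNReal.ofReal_sum_of_nonneg fun n _ => abs_nonneg _]
    exact ENNReal.ofReal_le_ofReal (h3.trans (le_abs_self _))
  · have h1 : ∀ N, X.norm f ≤ X.norm (s N - f) + ∑' n, X.norm (u n) := by
      intro N
      have e : f = (f - s N) + s N := by abel
      have h2 : X.norm f ≤ X.norm (f - s N) + X.norm (s N) := by
        conv_lhs => rw [e]
        exact hX.norm_add_le _ (hX.sub_mem hf (hsX N)) _ (hsX N)
      have h3 : X.norm (f - s N) = X.norm (s N - f) :=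
        hX.norm_congr (hX.sub_mem (hsX N) hf) (eabs_sub_comm _ _)
      have h4 : X.norm (s N) ≤ ∑' n, X.norm (u n) := by
        refine (hX.norm_sum_le (fun n => (habs n).1) _).2.trans ?_
        simp only [(habs _).2]
        exact hs.sum_le_tsum _ fun n _ => hX.norm_nonneg _ (hu n)
      linarith
    have h2 := hlim.add_const (∑' n, X.norm (u n))
    rw [zero_add] at h2
    exact ge_of_tendsto' h2 h1

/-- Countable subadditivity is the Riesz–Fischer property applied to near-optimal majorants g n of F
n, with errors δ n of total less than ε. Definiteness holds because majorants of arbitrarily small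
norm force F to vanish by the ideal property. -/
theorem isFnNorm (hX : X.IsBFIL) : IsFnNorm X.fnNorm := by
  have hzero : X.fnNorm (fun _ => 0) = 0 := by
    refine le_antisymm ((FnSpace.fnNorm_le hX.zero_mem (.of_forall fun x => zero_le)).trans ?_)
      zero_le
    rw [hX.norm_zero, ENNReal.ofReal_zero]
  have hmono : ∀ {F G : RPos → ℝ≥0∞}, F ≤ᵐ[volume] G → X.fnNorm F ≤ X.fnNorm G := by
    intro F G h
    exact le_iInf fun g => le_iInf fun hg => le_iInf fun h' => FnSpace.fnNorm_le hg (h.trans h')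
  have hmul : ∀ {c : ℝ≥0∞} (F : RPos → ℝ≥0∞), c ≠ ∞ → c ≠ 0 →
      X.fnNorm (fun x => c * F x) ≤ c * X.fnNorm F := by
    intro c F hc h0
    by_contra! hlt
    have hlt' : X.fnNorm F < X.fnNorm (fun x => c * F x) / c :=
      ENNReal.lt_div_iff_mul_lt (.inl h0) (.inl hc) |>.mpr (by rwa [mul_comm])
    obtain ⟨g, hg, hle, hg2⟩ := FnSpace.exists_of_fnNorm_lt hlt'
    have h1 : X.fnNorm (fun x => c * F x) ≤ ENNReal.ofReal (X.norm (c.toReal • g)) := by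
      refine FnSpace.fnNorm_le (hX.smul_mem _ g hg) ?_
      filter_upwards [hle, eabs_smul c.toReal g] with x hx hx'
      rw [hx', Real.enorm_of_nonneg ENNReal.toReal_nonneg, ENNReal.ofReal_toReal hc]
      gcongr
    rw [hX.norm_smul _ g hg, abs_of_nonneg ENNReal.toReal_nonneg,
      ENNReal.ofReal_mul ENNReal.toReal_nonneg, ENNReal.ofReal_toReal hc] at h1
    rw [ENNReal.lt_div_iff_mul_lt (.inl h0) (.inl hc), mul_comm] at hg2
    exact absurd h1 (not_le.mpr hg2)
  refine ⟨hmono, fun {c} F hc => ?_, fun F hF => ?_, fun {F} hF h0 => ?_⟩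
  · rcases eq_or_ne c 0 with rfl | h0
    · simpa using hzero
    refine le_antisymm (hmul F hc h0) ?_
    have h1 := hmul (fun x => c * F x) (ENNReal.inv_ne_top.mpr h0) (ENNReal.inv_ne_zero.mpr hc)
    simp only [← mul_assoc, ENNReal.inv_mul_cancel h0 hc, one_mul] at h1
    calc c * X.fnNorm F ≤ c * (c⁻¹ * X.fnNorm fun x => c * F x) := by gcongr
      _ = _ := by rw [← mul_assoc, ENNReal.mul_inv_cancel h0 hc, one_mul]
  · refine ENNReal.le_of_forall_pos_le_add fun ε hε hfin => ?_
    obtain ⟨δ, hδ, hδε⟩ := ENNReal.exists_pos_sum_of_countable (ENNReal.coe_pos.mpr hε).ne' ℕ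
    have hlt : ∀ n, X.fnNorm (F n) < X.fnNorm (F n) + δ n := fun n =>
      ENNReal.lt_add_right (ENNReal.ne_top_of_tsum_ne_top hfin.ne n)
        (ENNReal.coe_pos.mpr (hδ n)).ne'
    choose g hg hle hgn using fun n => FnSpace.exists_of_fnNorm_lt (hlt n)
    have hsum : ∑' n, ENNReal.ofReal (X.norm (g n)) ≤ ∑' n, X.fnNorm (F n) + ε :=
      calc _ ≤ ∑' n, (X.fnNorm (F n) + δ n) := ENNReal.tsum_le_tsum fun n => (hgn n).le
        _ = ∑' n, X.fnNorm (F n) + ∑' n, (δ n : ℝ≥0∞) := ENNReal.tsum_add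
        _ ≤ _ := by gcongr
    have hne : ∑' n, ENNReal.ofReal (X.norm (g n)) ≠ ∞ :=
      (hsum.trans_lt (ENNReal.add_lt_top.mpr ⟨hfin, ENNReal.coe_lt_top⟩)).ne
    have hs : Summable fun n => X.norm (g n) := by
      have := ENNReal.summable_toReal hne
      simpa only [ENNReal.toReal_ofReal (hX.norm_nonneg _ (hg _))] using this
    obtain ⟨f, hf, hfle, hfn⟩ := hX.exists_tsum_le hg hs
    refine (FnSpace.fnNorm_le hf ?_).trans ((ENNReal.ofReal_le_ofReal hfn).trans ?_)
    · filter_upwards [hfle, ae_all_iff.mpr hle] with x h1 h2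
      exact (ENNReal.tsum_le_tsum h2).trans h1
    · rwa [ENNReal.ofReal_tsum_of_nonneg (fun n => hX.norm_nonneg _ (hg n)) hs]
  · have hex : ∀ ε : ℝ, 0 < ε → ∃ g ∈ X.carrier, F ≤ᵐ[volume] eabs g ∧ X.norm g < ε := by
      intro ε hε
      obtain ⟨g, hg, hle, hlt⟩ := FnSpace.exists_of_fnNorm_lt
        (show X.fnNorm F < ENNReal.ofReal ε by rw [h0]; exact ENNReal.ofReal_pos.mpr hε)
      exact ⟨g, hg, hle, (ENNReal.ofReal_lt_ofReal_iff hε).mp hlt⟩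
    have hfin : ∀ᵐ x, F x < ∞ := by
      obtain ⟨g, -, hle, -⟩ := hex 1 one_pos
      filter_upwards [hle] with x hx using hx.trans_lt (by simp [eabs])
    have e := eabs_ofENN hF hfin
    have hle : ∀ ε : ℝ, 0 < ε → ofENN F hF ∈ X.carrier ∧ X.norm (ofENN F hF) ≤ ε := by
      intro ε hε
      obtain ⟨g, hg, hle, hlt⟩ := hex ε hε
      have := hX.ideal_eabs hg (e.le.trans hle)
      exact ⟨this.1, this.2.trans hlt.le⟩
    have hmem := (hle 1 one_pos).1
    have h0 : ofENN F hF = 0 := hX.eq_zero_of_norm _ hmem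
      (le_antisymm (le_of_forall_pos_le_add fun ε hε => by simpa using (hle ε hε).2)
        (hX.norm_nonneg _ hmem))
    rw [h0] at e
    exact e.symm.trans eabs_zero

/-- In an order continuous lattice, increasing sequences converge in norm to their supremum. -/
theorem tendsto_fnNorm_sub (hX : X.IsBFIL) (hoc : X.OrderContinuous) {F : RPos → ℝ≥0∞}
    {u : ℕ → RPos → ℝ≥0∞} (hF : Measurable F) (hu : ∀ n, Measurable (u n))
    (hmono : ∀ᵐ x, Monotone fun n => u n x)
    (hlim : ∀ᵐ x, Tendsto (fun n => u n x) atTop (𝓝 (F x))) (hfin : X.fnNorm F < ∞) :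
    Tendsto (fun n => X.fnNorm fun x => F x - u n x) atTop (𝓝 0) := by
  have hσ := hX.isFnNorm
  have hFt := hσ.ae_lt_top hF hfin
  have hle : ∀ᵐ x, ∀ n, u n x ≤ F x := by
    filter_upwards [hmono, hlim] with x h1 h2 n using h1.ge_of_tendsto h2 n
  have hut : ∀ n, ∀ᵐ x, u n x < ∞ := fun n => by
    filter_upwards [hle, hFt] with x h1 h2 using (h1 n).trans_lt h2
  let f := ofENN F hF
  let v : ℕ → L0 := fun n => ofENN (u n) (hu n)
  have hf : f ∈ X.carrier := by
    rw [hX.hasFnNorm.mem_iff, hσ.congr (eabs_ofENN hF hFt)]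
    exact hfin
  have hvx : ∀ᵐ x, ∀ n, v n x = (u n x).toReal :=
    ae_all_iff.mpr fun n => coeFn_ofENN (u n) (hu n)
  have hfx : ∀ᵐ x, f x = (F x).toReal := coeFn_ofENN F hF
  have hv : ∀ n, v n ∈ X.carrier := fun n => by
    refine (hX.ideal_eabs hf ?_).1
    filter_upwards [eabs_ofENN (hu n) (hut n), eabs_ofENN hF hFt, hle] with x h1 h2 h3
    rw [h1, h2]; exact h3 n
  have hvmono : Monotone v := fun m n hmn => by
    rw [← AEEqFun.coeFn_le]
    filter_upwards [hvx, hmono, ae_all_iff.mpr hut] with x h1 h2 h3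
    rw [h1, h1]
    exact ENNReal.toReal_mono (h3 n).ne (h2 hmn)
  have hvf : ∀ n, v n ≤ f := fun n => by
    rw [← AEEqFun.coeFn_le]
    filter_upwards [hvx, hfx, hle, hFt] with x h1 h2 h3 h4
    rw [h1, h2]
    exact ENNReal.toReal_mono h4.ne (h3 n)
  obtain ⟨g, hg, hglim⟩ := hoc v hv hvmono ⟨f, hf, hvf⟩
  have hvg := hX.le_of_tendsto_norm hv hvmono hg hglim
  -- The norm limit g is only known to be an upper bound of the v n. Being above their pointwise
  -- limit f, it gives 0 ≤ f - v n ≤ |v n - g|, which is all that is needed.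
  have hfg : f ≤ g := by
    rw [← AEEqFun.coeFn_le]
    have : ∀ᵐ x, ∀ n, v n x ≤ g x := ae_all_iff.mpr fun n => AEEqFun.coeFn_le.mpr (hvg n)
    filter_upwards [this, hvx, hfx, hlim, hFt] with x h1 h2 h3 h4 h5
    rw [h3]
    refine le_of_tendsto' ((ENNReal.tendsto_toReal h5.ne).comp h4) fun n => ?_
    rw [Function.comp_apply, ← h2]
    exact h1 n
  have hlt : ∀ n, X.fnNorm (fun x => F x - u n x) ≤ ENNReal.ofReal (X.norm (v n - g)) := by
    intro n
    refine FnSpace.fnNorm_le (hX.sub_mem (hv n) hg) ?_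
    filter_upwards [hvx, hfx, hle, hFt, AEEqFun.coeFn_sub (v n) g, AEEqFun.coeFn_le.mpr hfg]
      with x h1 h2 h3 h4 h5 h6
    have h7 : F x - u n x = ENNReal.ofReal (f x - v n x) := by
      rw [h1, h2, ENNReal.ofReal_sub _ ENNReal.toReal_nonneg, ENNReal.ofReal_toReal h4.ne,
        ENNReal.ofReal_toReal ((h3 n).trans_lt h4).ne]
    rw [h7, eabs, h5, Real.enorm_eq_ofReal_abs, Pi.sub_apply, abs_sub_comm]
    exact ENNReal.ofReal_le_ofReal ((sub_le_sub_right h6 _).trans (le_abs_self _))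
  have h1 := ENNReal.tendsto_ofReal hglim
  rw [ENNReal.ofReal_zero] at h1
  exact tendsto_of_tendsto_of_tendsto_of_le_of_le tendsto_const_nhds h1 (fun n => zero_le) hlt

/-- The Fatou property, for `[0, ∞]`-valued functions. -/
theorem fnNorm_le_of_fatou (hX : X.IsBFIL) (hfat : X.Fatou) {F : RPos → ℝ≥0∞}
    {u : ℕ → RPos → ℝ≥0∞} (hF : Measurable F) (hu : ∀ n, Measurable (u n))
    (hmono : ∀ᵐ x, Monotone fun n => u n x)
    (hlim : ∀ᵐ x, Tendsto (fun n => u n x) atTop (𝓝 (F x))) (hfin : ∀ᵐ x, F x < ∞)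
    {C : ℝ≥0∞} (hC : C ≠ ∞) (hle : ∀ n, X.fnNorm (u n) ≤ C) : X.fnNorm F ≤ C := by
  have hσ := hX.isFnNorm
  have hut : ∀ n, ∀ᵐ x, u n x < ∞ := fun n =>
    hσ.ae_lt_top (hu n) ((hle n).trans_lt hC.lt_top)
  let f := ofENN F hF
  let v : ℕ → L0 := fun n => ofENN (u n) (hu n)
  have hvx : ∀ᵐ x, ∀ n, v n x = (u n x).toReal :=
    ae_all_iff.mpr fun n => coeFn_ofENN (u n) (hu n)
  have hfx : ∀ᵐ x, f x = (F x).toReal := coeFn_ofENN F hF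
  have hvσ : ∀ n, X.fnNorm (eabs (v n)) = X.fnNorm (u n) := fun n =>
    hσ.congr (eabs_ofENN (hu n) (hut n))
  have hv : ∀ n, v n ∈ X.carrier := fun n => by
    rw [hX.hasFnNorm.mem_iff, hvσ]
    exact (hle n).trans_lt hC.lt_top
  have hvC : ∀ n, X.norm (v n) ≤ C.toReal := fun n => by
    rw [hX.hasFnNorm.norm_eq _ (hv n), hvσ]
    exact ENNReal.toReal_mono hC (hle n)
  obtain ⟨hf, hflim⟩ := hfat v f hv (fun n => by
      rw [← AEEqFun.coeFn_le]
      filter_upwards [hvx, AEEqFun.coeFn_zero (α := RPos) (β := ℝ) (μ := volume)] with x h1 h2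
      rw [h1, h2]; exact ENNReal.toReal_nonneg)
    (fun m n hmn => by
      rw [← AEEqFun.coeFn_le]
      filter_upwards [hvx, hmono, ae_all_iff.mpr hut] with x h1 h2 h3
      rw [h1, h1]
      exact ENNReal.toReal_mono (h3 n).ne (h2 hmn))
    (by
      filter_upwards [hvx, hfx, hlim, hfin] with x h1 h2 h3 h4
      simp only [h1, h2]
      exact (ENNReal.tendsto_toReal h4.ne).comp h3)
    ⟨C.toReal, by rintro _ ⟨n, rfl⟩; exact hvC n⟩
  rw [← hσ.congr (eabs_ofENN hF hfin), ← hX.hasFnNorm.ofReal_norm hf]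
  exact ENNReal.ofReal_le_of_le_toReal (le_of_tendsto' hflim hvC)

end FnSpace.IsBFIL

/-! ### Lebesgue measure on the half-line -/

theorem volume_preimage_coe {B : Set ℝ} (hB : MeasurableSet B) :
    volume {x : RPos | (x : ℝ) ∈ B} = volume (B ∩ Set.Ioi 0) := by
  have h : (volume : Measure RPos).map (fun x : RPos => (x : ℝ)) B = volume (B ∩ Set.Ioi 0) := by
    rw [map_coe_volume, Measure.restrict_apply hB]
  rwa [Measure.map_apply measurable_subtype_coe hB] at h

theorem volume_Ioc_coe {a b : ℝ} (ha : 0 ≤ a) :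
    volume {x : RPos | a < (x : ℝ) ∧ (x : ℝ) ≤ b} = ENNReal.ofReal (b - a) := by
  have h := volume_preimage_coe (B := Set.Ioc a b) measurableSet_Ioc
  rw [Set.inter_eq_left.mpr fun x hx => Set.mem_Ioi.mpr (ha.trans_lt hx.1), Real.volume_Ioc] at h
  exact h

/-- Integrals over (0, x] increase with x, so a bound at almost every x reaches every x through a
good point further to the right. -/
theorem exists_ge_of_ae {p : RPos → Prop} (h : ∀ᵐ x, p x) (y : RPos) : ∃ x, y ≤ x ∧ p x := by
  by_contra! hn
  have h0 : volume {x : RPos | (y : ℝ) < x ∧ (x : ℝ) ≤ y + 1} = 0 :=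
    measure_mono_null (fun x hx => hn x hx.1.le) (ae_iff.mp h)
  rw [volume_Ioc_coe y.2.le] at h0
  simp at h0

/-! ### The Hardy operator on `[0, ∞]`-valued functions -/

/-- The Hardy operator on `[0, ∞]`-valued functions. -/
def avg (F : RPos → ℝ≥0∞) (x : RPos) : ℝ≥0∞ :=
  ENNReal.ofReal (x : ℝ)⁻¹ * ∫⁻ y in Set.Iic x, F y

theorem measurable_avg {F : RPos → ℝ≥0∞} (hF : Measurable F) : Measurable (avg F) := by
  have h : Measurable fun x : RPos => ∫⁻ y in Set.Iic x, F y := by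
    have hs : MeasurableSet {p : RPos × RPos | p.2 ≤ p.1} :=
      measurableSet_le measurable_snd measurable_fst
    have h3 := ((hF.comp (measurable_snd (α := RPos) (β := RPos))).indicator
      hs).lintegral_prod_right' (ν := (volume : Measure RPos))
    convert h3 using 1
    ext x
    rw [← lintegral_indicator measurableSet_Iic]
    rfl
  exact (ENNReal.measurable_ofReal.comp measurable_subtype_coe.inv).mul h

theorem avg_mono {F G : RPos → ℝ≥0∞} (h : F ≤ᵐ[volume] G) (x : RPos) : avg F x ≤ avg G x := by
  exact mul_le_mul_right (lintegral_mono_ae (ae_restrict_of_ae h)) _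

theorem avg_add {F : RPos → ℝ≥0∞} (hF : Measurable F) (G : RPos → ℝ≥0∞) (x : RPos) :
    avg (fun y => F y + G y) x = avg F x + avg G x := by
  unfold avg
  rw [lintegral_add_left hF, mul_add]

theorem lintegral_eq_mul_avg (F : RPos → ℝ≥0∞) (x : RPos) :
    ∫⁻ y in Set.Iic x, F y = ENNReal.ofReal x * avg F x := by
  rw [avg, ← mul_assoc, ENNReal.ofReal_inv_of_pos x.2, ENNReal.mul_inv_cancel, one_mul]
  · exact (ENNReal.ofReal_pos.mpr x.2).ne'
  · exact ENNReal.ofReal_ne_top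

theorem tendsto_avg {F : RPos → ℝ≥0∞} {u : ℕ → RPos → ℝ≥0∞} (hu : ∀ n, Measurable (u n))
    (hmono : ∀ᵐ x, Monotone fun n => u n x)
    (hlim : ∀ᵐ x, Tendsto (fun n => u n x) atTop (𝓝 (F x))) (x : RPos) :
    Tendsto (fun n => avg (u n) x) atTop (𝓝 (avg F x)) :=
  ENNReal.Tendsto.const_mul (lintegral_tendsto_of_tendsto_of_monotone
    (fun n => (hu n).aemeasurable) (ae_restrict_of_ae hmono) (ae_restrict_of_ae hlim))
    (.inr ENNReal.ofReal_ne_top)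

theorem avg_lt_top_of_ae {F : RPos → ℝ≥0∞} (h : ∀ᵐ x, avg F x < ∞) (x : RPos) :
    ∫⁻ y in Set.Iic x, F y < ∞ := by
  obtain ⟨y, hxy, hy⟩ := exists_ge_of_ae h x
  refine (lintegral_mono_set (Set.Iic_subset_Iic.mpr hxy)).trans_lt ?_
  rw [lintegral_eq_mul_avg]
  exact ENNReal.mul_lt_top ENNReal.ofReal_lt_top hy

/-- The function norm `F ↦ ‖S F‖_X`. -/
def FnSpace.hardyNorm (X : FnSpace) (F : RPos → ℝ≥0∞) : ℝ≥0∞ := X.fnNorm (avg F)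

/-- S is positive and commutes with countable sums, so the axioms transfer from X. For definiteness,
SF = 0 a.e. gives arbitrarily large x with ∫ F = 0 over (0, x]. -/
theorem FnSpace.IsBFIL.isFnNorm_hardyNorm {X : FnSpace} (hX : X.IsBFIL) :
    IsFnNorm X.hardyNorm where
  mono h := hX.isFnNorm.mono (.of_forall fun x => avg_mono h x)
  const_mul {c} F hc := by
    rw [FnSpace.hardyNorm, FnSpace.hardyNorm, ← hX.isFnNorm.const_mul _ hc]
    congr 1
    ext x
    rw [avg, avg, lintegral_const_mul' _ _ hc, mul_left_comm]
  tsum_le u hu := by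
    refine le_trans (le_of_eq ?_) (hX.isFnNorm.tsum_le _ fun n => measurable_avg (hu n))
    rw [FnSpace.hardyNorm]
    congr 1
    ext x
    simp only [avg]
    rw [lintegral_tsum fun n => (hu n).aemeasurable, ENNReal.tsum_mul_left]
  eq_zero {F} hF h := by
    have h0 := hX.isFnNorm.eq_zero (measurable_avg hF) h
    have h1 : ∀ n : ℕ, ∀ᵐ y, y ∈ Set.Iic (⟨n + 1, Set.mem_Ioi.mpr n.cast_add_one_pos⟩ : RPos) → F y = 0 := by
      intro n
      obtain ⟨y, hy, hy0⟩ := exists_ge_of_ae h0 (⟨n + 1, Set.mem_Ioi.mpr n.cast_add_one_pos⟩ : RPos)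
      have h2 : ∫⁻ z in Set.Iic y, F z = 0 := by
        rw [lintegral_eq_mul_avg, hy0, Pi.zero_apply, mul_zero]
      rw [lintegral_eq_zero_iff hF] at h2
      filter_upwards [(ae_restrict_iff' measurableSet_Iic).mp h2] with z hz hzn
      exact hz (hzn.trans hy)
    filter_upwards [ae_all_iff.mpr h1] with y hy
    obtain ⟨n, hn⟩ := exists_nat_ge (y : ℝ)
    exact hy n (show (y : ℝ) ≤ n + 1 by linarith)

theorem coeFn_hardy (f : L0) : hardy f =ᵐ[volume] hardyFun f := AEEqFun.coeFn_mk _ _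

theorem hardyFun_congr {f g : RPos → ℝ} (h : f =ᵐ[volume] g) : hardyFun f = hardyFun g := by
  ext x
  rw [hardyFun, hardyFun, integral_congr_ae (ae_restrict_of_ae h)]

theorem enorm_hardyFun_abs {f : RPos → ℝ} {x : RPos} (hf : IntegrableOn f (Set.Iic x)) :
    ‖hardyFun (fun y => |f y|) x‖ₑ = avg (fun y => ‖f y‖ₑ) x := by
  rw [hardyFun, enorm_mul, avg, Real.enorm_of_nonneg (inv_nonneg.mpr x.2.le),
    Real.enorm_of_nonneg (integral_nonneg fun y => abs_nonneg _),
    ofReal_integral_eq_lintegral_ofReal hf.abs (.of_forall fun y => abs_nonneg _)]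
  simp only [Real.enorm_eq_ofReal_abs]

theorem enorm_hardyFun_le (f : RPos → ℝ) (x : RPos) :
    ‖hardyFun f x‖ₑ ≤ avg (fun y => ‖f y‖ₑ) x := by
  rw [hardyFun, enorm_mul, avg, Real.enorm_of_nonneg (inv_nonneg.mpr x.2.le)]
  gcongr
  exact enorm_integral_le_lintegral_enorm _

theorem hardy_add {f g : L0} (hf : ∀ x : RPos, IntegrableOn f (Set.Iic x))
    (hg : ∀ x : RPos, IntegrableOn g (Set.Iic x)) : hardy (f + g) = hardy f + hardy g := by
  apply AEEqFun.ext
  filter_upwards [coeFn_hardy (f + g), coeFn_hardy f, coeFn_hardy g,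
    AEEqFun.coeFn_add (hardy f) (hardy g)] with x h1 h2 h3 h4
  rw [h1, h4, Pi.add_apply, h2, h3, hardyFun_congr (AEEqFun.coeFn_add f g), hardyFun, hardyFun,
    hardyFun, ← mul_add, ← integral_add (hf x) (hg x)]
  rfl

theorem hardy_smul (c : ℝ) (f : L0) : hardy (c • f) = c • hardy f := by
  apply AEEqFun.ext
  filter_upwards [coeFn_hardy (c • f), coeFn_hardy f,
    AEEqFun.coeFn_smul c (hardy f)] with x h1 h2 h3
  rw [h1, h3, Pi.smul_apply, h2, hardyFun_congr (AEEqFun.coeFn_smul c f), hardyFun, hardyFun,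
    smul_eq_mul, mul_left_comm]
  congr 1
  exact integral_const_mul c _

theorem eabs_hardy_abs {f : L0} (hf : ∀ x : RPos, IntegrableOn f (Set.Iic x)) :
    eabs (hardy |f|) =ᵐ[volume] avg (eabs f) := by
  filter_upwards [coeFn_hardy |f|] with x hx
  rw [eabs, hx, hardyFun_congr (AEEqFun.coeFn_abs f)]
  exact enorm_hardyFun_abs (hf x)

theorem eabs_hardy_le (f : L0) : eabs (hardy f) ≤ᵐ[volume] avg (eabs f) := by
  filter_upwards [coeFn_hardy f] with x hx
  rw [eabs, hx]
  exact enorm_hardyFun_le f x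

theorem FnSpace.IsBFIL.integrableOn_of_hardyNorm {X : FnSpace} (hX : X.IsBFIL) {f : L0}
    (h : X.hardyNorm (eabs f) < ∞) (x : RPos) : IntegrableOn f (Set.Iic x) :=
  ⟨f.aestronglyMeasurable.restrict,
    avg_lt_top_of_ae (hX.isFnNorm.ae_lt_top (measurable_avg (measurable_eabs f)) h) x⟩

theorem FnSpace.IsBFIL.hasFnNorm_hardyDomain {X : FnSpace} (hX : X.IsBFIL) :
    (hardyDomain X).HasFnNorm X.hardyNorm := by
  refine ⟨fun f => ⟨fun hf => ?_, fun h => ?_⟩, fun f hf => ?_⟩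
  · rw [FnSpace.hardyNorm, ← hX.isFnNorm.congr (eabs_hardy_abs hf.1)]
    exact (hX.hasFnNorm.mem_iff _).mp hf.2
  · have hi := hX.integrableOn_of_hardyNorm h
    refine ⟨hi, (hX.hasFnNorm.mem_iff _).mpr ?_⟩
    rwa [hX.isFnNorm.congr (eabs_hardy_abs hi)]
  · rw [FnSpace.hardyNorm, ← hX.isFnNorm.congr (eabs_hardy_abs hf.1)]
    exact hX.hasFnNorm.norm_eq _ hf.2

/-- The lattice `[S, X]`, bundled. -/
def BFIL.domain (X : BFIL) : BFIL where
  toFnSpace := hardyDomain X.toFnSpace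
  isBFIL := X.isBFIL.hasFnNorm_hardyDomain.isBFIL X.isBFIL.isFnNorm_hardyNorm

namespace BFIL

variable (X : BFIL)

theorem Elem.toFn_injective {X : BFIL} {f g : X.Elem} (h : f.toFn = g.toFn) : f = g :=
  Subtype.ext h

/-- An element of `X`, from a function. -/
def mkElem {X : BFIL} (f : L0) (hf : f ∈ X.carrier) : X.Elem := (⟨f, hf⟩ : X.submodule)

theorem Elem.toFn_add {X : BFIL} (f g : X.Elem) : (f + g).toFn = f.toFn + g.toFn := rfl

theorem Elem.toFn_sub {X : BFIL} (f g : X.Elem) : (f - g).toFn = f.toFn - g.toFn := rfl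

theorem Elem.toFn_smul {X : BFIL} (c : ℝ) (f : X.Elem) : (c • f).toFn = c • f.toFn := rfl

theorem Elem.mem {X : BFIL} (f : X.Elem) : f.toFn ∈ X.carrier := f.2

theorem Elem.norm_def {X : BFIL} (f : X.Elem) : ‖f‖ = X.norm f.toFn := rfl

theorem Elem.enorm_eq {X : BFIL} (f : X.Elem) : ‖f‖ₑ = X.fnNorm (eabs f.toFn) := by
  rw [← ofReal_norm, f.norm_def, X.isBFIL.hasFnNorm.ofReal_norm f.mem]

theorem Elem.enorm_domain_eq {X : BFIL} (f : X.domain.Elem) :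
    ‖f‖ₑ = X.hardyNorm (eabs f.toFn) := by
  rw [← ofReal_norm, f.norm_def]
  exact X.isBFIL.hasFnNorm_hardyDomain.ofReal_norm f.mem

theorem fnNorm_hardy_le (f : L0) : X.fnNorm (eabs (hardy f)) ≤ X.hardyNorm (eabs f) :=
  X.isBFIL.isFnNorm.mono (eabs_hardy_le f)

/-- The Hardy operator, as a bounded operator from `[S, X]` to `X`. -/
def hardyCLM : X.domain.Elem →L[ℝ] X.Elem :=
  LinearMap.mkContinuous
    { toFun := fun f => mkElem (hardy f.toFn) <| (X.isBFIL.hasFnNorm.mem_iff _).mpr <|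
        (X.fnNorm_hardy_le f.toFn).trans_lt <| by
          rw [← Elem.enorm_domain_eq]; exact enorm_lt_top
      map_add' := fun f g => Elem.toFn_injective (hardy_add f.mem.1 g.mem.1)
      map_smul' := fun c f => Elem.toFn_injective (hardy_smul c f.toFn) }
    1 (fun f => by
      rw [one_mul, ← enorm_le_iff_norm_le, Elem.enorm_eq, Elem.enorm_domain_eq]
      exact X.fnNorm_hardy_le f.toFn)

theorem toFn_hardyCLM (f : X.domain.Elem) : (X.hardyCLM f).toFn = hardy f.toFn := rfl

theorem enorm_hardyCLM_le (f : X.domain.Elem) : ‖X.hardyCLM f‖ₑ ≤ ‖f‖ₑ := by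
  rw [Elem.enorm_eq, Elem.enorm_domain_eq]
  exact X.fnNorm_hardy_le f.toFn

theorem eabs_hardyCLM_of_nonneg {f : X.domain.Elem} (hf : 0 ≤ f.toFn) :
    eabs (X.hardyCLM f).toFn =ᵐ[volume] avg (eabs f.toFn) := by
  have h : |f.toFn| = f.toFn := by
    apply AEEqFun.ext
    filter_upwards [AEEqFun.coeFn_abs f.toFn, AEEqFun.coeFn_le.mpr hf,
      AEEqFun.coeFn_zero (α := RPos) (β := ℝ) (μ := volume)] with x h1 h2 h3
    rw [h1, abs_of_nonneg]
    simpa [h3] using h2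
  have := eabs_hardy_abs f.mem.1
  rwa [h] at this

/-- S is isometric on the positive cone of [S, X]. This is what lets norming functionals of X
compute norms in [S, X]. -/
theorem enorm_hardyCLM_of_nonneg {f : X.domain.Elem} (hf : 0 ≤ f.toFn) :
    ‖X.hardyCLM f‖ₑ = ‖f‖ₑ := by
  rw [Elem.enorm_eq, Elem.enorm_domain_eq, X.isBFIL.isFnNorm.congr (X.eabs_hardyCLM_of_nonneg hf)]
  rfl

end BFIL

/-! ### The fundamental function -/

/-- The indicator function of a set, with values in `[0, ∞]`. -/
def ind (A : Set RPos) : RPos → ℝ≥0∞ := A.indicator fun _ => 1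

theorem measurable_ind {A : Set RPos} (hA : MeasurableSet A) : Measurable (ind A) :=
  measurable_const.indicator hA

theorem ind_of_mem {A : Set RPos} {x : RPos} (h : x ∈ A) : ind A x = 1 :=
  Set.indicator_of_mem h _

theorem ind_of_notMem {A : Set RPos} {x : RPos} (h : x ∉ A) : ind A x = 0 :=
  Set.indicator_of_notMem h _

theorem ind_mono {A B : Set RPos} (h : A ⊆ B) (x : RPos) : ind A x ≤ ind B x :=
  Set.indicator_le_indicator_of_subset h (fun _ => zero_le) x

theorem coeFn_chi {A : Set RPos} (hA : MeasurableSet A) :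
    chi A hA =ᵐ[volume] A.indicator fun _ => (1 : ℝ) := AEEqFun.coeFn_mk _ _

theorem eabs_chi {A : Set RPos} (hA : MeasurableSet A) : eabs (chi A hA) =ᵐ[volume] ind A := by
  filter_upwards [coeFn_chi hA] with x hx
  rw [eabs, hx]
  by_cases h : x ∈ A <;> simp [ind, h]

/-- The interval `(a, b]`, as a subset of the half-line. -/
def ioc (a b : ℝ) : Set RPos := {x | a < (x : ℝ) ∧ (x : ℝ) ≤ b}

theorem measurableSet_ioc (a b : ℝ) : MeasurableSet (ioc a b) :=
  (measurableSet_lt measurable_const measurable_subtype_coe).inter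
    (measurableSet_le measurable_subtype_coe measurable_const)

theorem setOf_le_eq_ioc (t : ℝ) : {x : RPos | (x : ℝ) ≤ t} = ioc 0 t := by
  ext x
  exact ⟨fun h => ⟨x.2, h⟩, fun h => h.2⟩

/-- The function `x ↦ 1 / x` on `(ε, ∞)`. -/
def theta (ε : ℝ) : RPos → ℝ≥0∞ :=
  {x : RPos | ε < (x : ℝ)}.indicator fun x => ENNReal.ofReal (x : ℝ)⁻¹

theorem volume_chi_superlevel {A : Set RPos} (hA : MeasurableSet A) {s : ℝ} (hs : 0 ≤ s) :
    volume {x : RPos | s < |chi A hA x|} = if s < 1 then volume A else 0 := by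
  have h : {x : RPos | s < |chi A hA x|} =ᵐ[volume] (if s < 1 then A else ∅ : Set RPos) := by
    filter_upwards [coeFn_chi hA] with x hx
    apply propext
    change s < |chi A hA x| ↔ x ∈ (if s < 1 then A else ∅ : Set RPos)
    rw [hx]
    split_ifs with h <;> by_cases hxA : x ∈ A <;> simp [hxA] <;> linarith
  rw [measure_congr h]
  split_ifs <;> simp

namespace BFIL

variable {X : BFIL}

/-- The distribution function of an indicator depends only on the measure of the set. The case of
infinite norm is covered by symmetry. -/
theorem fnNorm_ind_eq (hri : X.RearrangementInvariant) {A B : Set RPos} (hA : MeasurableSet A)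
    (hB : MeasurableSet B) (h : volume A = volume B) : X.fnNorm (ind A) = X.fnNorm (ind B) := by
  have hσ := X.isBFIL.isFnNorm
  have key : ∀ {A B : Set RPos}, MeasurableSet A → MeasurableSet B → volume A = volume B →
      X.fnNorm (ind B) ≤ X.fnNorm (ind A) := by
    intro A B hA hB h
    by_cases hfin : X.fnNorm (ind A) < ∞
    · rw [← hσ.congr (eabs_chi hA)] at hfin ⊢
      have hmem := (X.isBFIL.hasFnNorm.mem_iff _).mpr hfin
      obtain ⟨h1, h2⟩ := hri _ hmem (chi B hB) fun s hs => by
        rw [volume_chi_superlevel hA hs, volume_chi_superlevel hB hs, h]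
      rw [← hσ.congr (eabs_chi hB), ← X.isBFIL.hasFnNorm.ofReal_norm h1,
        ← X.isBFIL.hasFnNorm.ofReal_norm hmem, h2]
    · rw [not_lt_top_iff.mp hfin]; exact le_top
  exact le_antisymm (key hB hA h.symm) (key hA hB h)

theorem fnNorm_ind_ioc (hri : X.RearrangementInvariant) {a b : ℝ} (ha : 0 ≤ a) :
    X.fnNorm (ind (ioc a b)) = X.fnNorm (ind (ioc 0 (b - a))) := by
  refine fnNorm_ind_eq hri (measurableSet_ioc _ _) (measurableSet_ioc _ _) ?_
  rw [ioc, ioc, volume_Ioc_coe ha, volume_Ioc_coe le_rfl, sub_zero]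

/-- A nonzero f exceeds some level 1/(n+1) on a set of positive measure. A subset of finite positive
measure has an indicator in X, and rearrangement moves it to an interval at the origin. -/
theorem exists_fnNorm_ioc_lt_top (hri : X.RearrangementInvariant)
    (hne : ∃ f ∈ X.carrier, f ≠ 0) : ∃ a > 0, X.fnNorm (ind (ioc 0 a)) < ∞ := by
  have hσ := X.isBFIL.isFnNorm
  obtain ⟨f, hf, hf0⟩ := hne
  obtain ⟨n, hn⟩ : ∃ n : ℕ, volume {x | 1 ≤ ((n + 1 : ℕ) : ℝ≥0∞) * eabs f x} ≠ 0 := by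
    by_contra! hall
    apply hf0
    apply AEEqFun.ext
    have : ∀ᵐ x, ∀ n : ℕ, ¬ (1 ≤ ((n + 1 : ℕ) : ℝ≥0∞) * eabs f x) := ae_all_iff.mpr fun n => by
      rw [ae_iff]; simpa using hall n
    filter_upwards [this, AEEqFun.coeFn_zero (α := RPos) (β := ℝ) (μ := volume)] with x hx h0
    rw [h0, Pi.zero_apply]
    by_contra hne
    have h1 : eabs f x ≠ 0 := by simpa [eabs] using hne
    obtain ⟨n, hn⟩ := ENNReal.exists_nat_mul_gt h1 ENNReal.one_ne_top
    refine hx n (hn.le.trans ?_)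
    gcongr
    exact n.le_succ
  have hE : MeasurableSet {x | 1 ≤ ((n + 1 : ℕ) : ℝ≥0∞) * eabs f x} :=
    measurableSet_le measurable_const ((measurable_eabs f).const_mul _)
  obtain ⟨t, ht, htE, h0, hlt⟩ := Measure.exists_subset_measure_lt_top hE (pos_iff_ne_zero.mpr hn)
  refine ⟨(volume t).toReal, ENNReal.toReal_pos h0.ne' hlt.ne, ?_⟩
  rw [← fnNorm_ind_eq hri ht (measurableSet_ioc _ _)]
  · calc X.fnNorm (ind t) ≤ X.fnNorm (fun x => ((n + 1 : ℕ) : ℝ≥0∞) * eabs f x) := by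
          refine hσ.mono (.of_forall fun x => ?_)
          by_cases hx : x ∈ t
          · rw [ind_of_mem hx]; exact htE hx
          · rw [ind_of_notMem hx]; exact zero_le
      _ = ((n + 1 : ℕ) : ℝ≥0∞) * X.fnNorm (eabs f) := hσ.const_mul _ (by simp)
      _ < ∞ := ENNReal.mul_lt_top (by simp) ((X.isBFIL.hasFnNorm.mem_iff f).mp hf)
  · rw [ioc, volume_Ioc_coe le_rfl, sub_zero, ENNReal.ofReal_toReal hlt.ne]

/-- Any interval (0, t] is covered by finitely many translates of (0, a], all of the same finite
norm. -/
theorem fnNorm_ioc_lt_top (hri : X.RearrangementInvariant) (hne : ∃ f ∈ X.carrier, f ≠ 0)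
    (t : ℝ) : X.fnNorm (ind (ioc 0 t)) < ∞ := by
  have hσ := X.isBFIL.isFnNorm
  obtain ⟨a, ha, hfin⟩ := exists_fnNorm_ioc_lt_top hri hne
  have hn : ∀ n : ℕ, X.fnNorm (ind (ioc 0 (n * a))) < ∞ := by
    intro n
    induction n with
    | zero =>
      have : ind (ioc 0 (((0 : ℕ) : ℝ) * a)) = fun _ => 0 := by
        ext x
        refine ind_of_notMem fun h => ?_
        have := h.1.trans_le h.2
        simp at this
      rw [this, hσ.zero]; exact ENNReal.zero_lt_top
    | succ n ih =>
      have h1 : X.fnNorm (ind (ioc (n * a) ((n + 1 : ℕ) * a))) < ∞ := by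
        rw [fnNorm_ind_ioc hri (by positivity)]
        convert hfin using 4
        push_cast; ring
      refine (hσ.mono (.of_forall fun x => ?_)).trans_lt
        ((hσ.add_le (measurable_ind (measurableSet_ioc _ _))
          (measurable_ind (measurableSet_ioc _ _))).trans_lt (ENNReal.add_lt_top.mpr ⟨ih, h1⟩))
      by_cases hx : x ∈ ioc 0 ((n + 1 : ℕ) * a)
      · rw [ind_of_mem hx]
        rcases le_or_gt (x : ℝ) (n * a) with h | h
        · rw [ind_of_mem (A := ioc 0 (n * a)) ⟨hx.1, h⟩]; exact le_self_add
        · rw [ind_of_mem (A := ioc (n * a) ((n + 1 : ℕ) * a)) ⟨h, hx.2⟩]; exact le_add_self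
      · rw [ind_of_notMem hx]; exact zero_le
  obtain ⟨n, hn'⟩ := exists_nat_ge (t / a)
  rw [div_le_iff₀ ha] at hn'
  exact (hσ.mono (.of_forall (ind_mono (A := ioc 0 t) (B := ioc 0 (n * a))
    fun x hx => ⟨hx.1, hx.2.trans hn'⟩))).trans_lt (hn n)

theorem fnNorm_ioc_eq (hri : X.RearrangementInvariant) (hne : ∃ f ∈ X.carrier, f ≠ 0) (t : ℝ) :
    X.fnNorm (ind (ioc 0 t)) = ENNReal.ofReal (X.fundamental t) := by
  have hσ := X.isBFIL.isFnNorm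
  have hm := measurableSet_ioc 0 t
  have e : X.fundamental t = X.norm (chi (ioc 0 t) hm) := by
    simp only [FnSpace.fundamental, setOf_le_eq_ioc]
  rw [e, X.isBFIL.hasFnNorm.ofReal_norm, hσ.congr (eabs_chi hm)]
  rw [X.isBFIL.hasFnNorm.mem_iff, hσ.congr (eabs_chi hm)]
  exact fnNorm_ioc_lt_top hri hne t

theorem fundamental_eq (hri : X.RearrangementInvariant) (hne : ∃ f ∈ X.carrier, f ≠ 0) (t : ℝ) :
    X.fundamental t = (X.fnNorm (ind (ioc 0 t))).toReal := by
  have hm := measurableSet_ioc 0 t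
  have e : X.fundamental t = X.norm (chi (ioc 0 t) hm) := by
    simp only [FnSpace.fundamental, setOf_le_eq_ioc]
  rw [e, X.isBFIL.hasFnNorm.norm_eq, X.isBFIL.isFnNorm.congr (eabs_chi hm)]
  rw [X.isBFIL.hasFnNorm.mem_iff, X.isBFIL.isFnNorm.congr (eabs_chi hm)]
  exact fnNorm_ioc_lt_top hri hne t

theorem fundamental_nonneg (hri : X.RearrangementInvariant) (hne : ∃ f ∈ X.carrier, f ≠ 0)
    (t : ℝ) : 0 ≤ X.fundamental t := by
  rw [fundamental_eq hri hne]; exact ENNReal.toReal_nonneg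

theorem fundamental_mono (hri : X.RearrangementInvariant) (hne : ∃ f ∈ X.carrier, f ≠ 0) :
    Monotone X.fundamental := fun s t hst => by
  rw [fundamental_eq hri hne, fundamental_eq hri hne]
  exact ENNReal.toReal_mono (fnNorm_ioc_lt_top hri hne t).ne
    (X.isBFIL.isFnNorm.mono (.of_forall (ind_mono fun x hx => ⟨hx.1, hx.2.trans hst⟩)))

/-- A weak form of the quasiconcavity of the fundamental function: average over the `m + 1` sets
that arise from `(0, t + h]` by the removal of one of `m + 1` disjoint intervals of length `h`. -/
theorem mul_fundamental_add_le (hri : X.RearrangementInvariant) (hne : ∃ f ∈ X.carrier, f ≠ 0)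
    {t h : ℝ} (hh : 0 < h) (m : ℕ) (hm : m * h ≤ t) :
    m * X.fundamental (t + h) ≤ (m + 1) * X.fundamental t := by
  have hσ := X.isBFIL.isFnNorm
  let E : ℕ → Set RPos := fun j => ioc 0 (t + h) \ ioc (j * h) ((j + 1) * h)
  have hE : ∀ j, MeasurableSet (E j) := fun j => (measurableSet_ioc _ _).diff (measurableSet_ioc _ _)
  have hEn : ∀ j ∈ Finset.range (m + 1), X.fnNorm (ind (E j)) = X.fnNorm (ind (ioc 0 t)) := by
    intro j hj
    refine fnNorm_ind_eq hri (hE j) (measurableSet_ioc _ _) ?_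
    have hjm : (j : ℝ) ≤ m := by
      exact_mod_cast Nat.lt_succ_iff.mp (Finset.mem_range.mp hj)
    have hsub : ioc (j * h) ((j + 1) * h) ⊆ ioc 0 (t + h) := fun x hx =>
      ⟨x.2, hx.2.trans (by nlinarith)⟩
    have hv : volume (ioc (j * h) ((j + 1) * h)) = ENNReal.ofReal h := by
      rw [ioc, volume_Ioc_coe (by positivity)]; congr 1; ring
    rw [measure_sdiff hsub (measurableSet_ioc _ _).nullMeasurableSet (by simp [hv]), hv, ioc, ioc,
      volume_Ioc_coe le_rfl, volume_Ioc_coe le_rfl, ← ENNReal.ofReal_sub _ hh.le]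
    congr 1; ring
  have hpt : ∀ x, (m : ℝ≥0∞) * ind (ioc 0 (t + h)) x ≤
      ∑ j ∈ Finset.range (m + 1), ind (E j) x := by
    intro x
    by_cases hx : x ∈ ioc 0 (t + h)
    swap
    · simp [ind_of_notMem hx]
    rw [ind_of_mem hx, mul_one]
    -- The removed intervals are disjoint, so x is missing from at most one of the m + 1 sets E j.
    obtain ⟨k, hk⟩ : ∃ k : ℕ, ∀ j : ℕ, j ≠ k → x ∉ ioc (j * h) ((j + 1) * h) := by
      by_cases hex : ∃ k : ℕ, x ∈ ioc (k * h) ((k + 1) * h)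
      · obtain ⟨k, hk⟩ := hex
        refine ⟨k, fun j hjk hj => hjk ?_⟩
        have h1 : (j : ℝ) < k + 1 := lt_of_mul_lt_mul_right (hj.1.trans_le hk.2) hh.le
        have h2 : (k : ℝ) < j + 1 := lt_of_mul_lt_mul_right (hk.1.trans_le hj.2) hh.le
        have h3 : j < k + 1 := by exact_mod_cast h1
        have h4 : k < j + 1 := by exact_mod_cast h2
        omega
      · push Not at hex
        exact ⟨0, fun j _ => hex j⟩
    calc (m : ℝ≥0∞) ≤ (((Finset.range (m + 1)).erase k).card : ℝ≥0∞) := by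
          have := Finset.pred_card_le_card_erase (s := Finset.range (m + 1)) (a := k)
          rw [Finset.card_range] at this
          exact_mod_cast this
      _ = ∑ j ∈ (Finset.range (m + 1)).erase k, (1 : ℝ≥0∞) := by simp
      _ = ∑ j ∈ (Finset.range (m + 1)).erase k, ind (E j) x :=
          Finset.sum_congr rfl fun j hj =>
            (ind_of_mem (A := E j) ⟨hx, hk j (Finset.ne_of_mem_erase hj)⟩).symm
      _ ≤ _ := Finset.sum_le_sum_of_subset (Finset.erase_subset _ _)
  have hsum : ∀ N : ℕ, X.fnNorm (fun x => ∑ j ∈ Finset.range N, ind (E j) x) ≤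
      ∑ j ∈ Finset.range N, X.fnNorm (ind (E j)) := by
    intro N
    induction N with
    | zero => simp [hσ.zero]
    | succ N ih =>
      simp only [Finset.sum_range_succ]
      exact (hσ.add_le (Finset.measurable_fun_sum _ fun j _ => measurable_ind (hE j))
        (measurable_ind (hE N))).trans (by gcongr)
  have hfinal : (m : ℝ≥0∞) * X.fnNorm (ind (ioc 0 (t + h))) ≤
      (m + 1 : ℕ) * X.fnNorm (ind (ioc 0 t)) := by
    rw [← hσ.const_mul _ (by simp)]
    refine (hσ.mono (.of_forall hpt)).trans ((hsum _).trans_eq ?_)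
    rw [Finset.sum_congr rfl hEn]
    simp
  rw [fundamental_eq hri hne, fundamental_eq hri hne]
  have := ENNReal.toReal_mono
    (ENNReal.mul_ne_top (by simp) (fnNorm_ioc_lt_top hri hne t).ne) hfinal
  rw [ENNReal.toReal_mul, ENNReal.toReal_mul, ENNReal.toReal_natCast, ENNReal.toReal_natCast] at this
  exact_mod_cast this

/-- A Lipschitz bound for φ on [a, b], extracted from the averaging inequality without concavity of
φ. -/
theorem fundamental_sub_le (hri : X.RearrangementInvariant) (hne : ∃ f ∈ X.carrier, f ≠ 0)
    {a b s r : ℝ} (ha : 0 < a) (has : a ≤ s) (hsr : s ≤ r) (hrb : r ≤ b) :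
    X.fundamental r - X.fundamental s ≤ 2 * X.fundamental b / a * (r - s) := by
  have hmono := fundamental_mono hri hne
  have hnn := fundamental_nonneg hri hne
  rcases hsr.eq_or_lt with rfl | hlt
  · simp
  have hb : 0 ≤ X.fundamental b := hnn b
  set h := r - s with hh
  have hpos : 0 < h := sub_pos.mpr hlt
  rcases le_or_gt h s with hle | hgt
  -- With the largest m such that m h ≤ s, averaging gives φ(r) - φ(s) ≤ φ(b)/m. Since a ≤ s < (m +
  -- 1)h ≤ 2mh, this is at most 2φ(b)h/a.
  · set m := ⌊s / h⌋₊ with hm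
    have h1 : 1 ≤ m := Nat.le_floor (by rw [Nat.cast_one, le_div_iff₀ hpos]; linarith)
    have h1' : (1 : ℝ) ≤ m := by exact_mod_cast h1
    have h2 : (m : ℝ) ≤ s / h := Nat.floor_le (div_nonneg (by linarith) hpos.le)
    have h3 : s / h < m + 1 := Nat.lt_floor_add_one _
    rw [le_div_iff₀ hpos] at h2
    rw [div_lt_iff₀ hpos] at h3
    have key := mul_fundamental_add_le hri hne hpos m h2
    rw [show s + h = r by rw [hh]; ring] at key
    have hs := hmono (hsr.trans hrb)
    have h4 : X.fundamental r - X.fundamental s ≤ X.fundamental b / m := by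
      rw [le_div_iff₀ (by linarith)]
      nlinarith
    refine h4.trans ?_
    rw [div_mul_eq_mul_div, div_le_div_iff₀ (by linarith) ha]
    have h5 : a ≤ 2 * h * m := by nlinarith
    nlinarith
  -- Here the increment h exceeds s ≥ a, so monotonicity of φ alone suffices.
  · have h5 : X.fundamental r - X.fundamental s ≤ X.fundamental b := by
      linarith [hmono hrb, hnn s]
    refine h5.trans ?_
    rw [div_mul_eq_mul_div, le_div_iff₀ ha]
    nlinarith

/-- The hypothesis concerns φ' only, and a monotone φ could grow through a singular part that φ'
does not see. Local Lipschitz continuity makes φ the integral of its derivative. -/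
theorem lipschitzOnWith_fundamental (hri : X.RearrangementInvariant)
    (hne : ∃ f ∈ X.carrier, f ≠ 0) {a b : ℝ} (ha : 0 < a) :
    LipschitzOnWith (2 * X.fundamental b / a).toNNReal X.fundamental (Set.Icc a b) := by
  have hK : 0 ≤ 2 * X.fundamental b / a := by
    have := fundamental_nonneg hri hne b
    positivity
  apply LipschitzOnWith.of_dist_le_mul
  have key : ∀ x ∈ Set.Icc a b, ∀ y ∈ Set.Icc a b, x ≤ y →
      dist (X.fundamental x) (X.fundamental y) ≤ (2 * X.fundamental b / a).toNNReal * dist x y := by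
    intro x hx y hy hxy
    rw [dist_comm, dist_comm x y, Real.dist_eq, Real.dist_eq, abs_of_nonneg (sub_nonneg.mpr hxy),
      abs_of_nonneg (sub_nonneg.mpr (fundamental_mono hri hne hxy)), Real.coe_toNNReal _ hK]
    exact fundamental_sub_le hri hne ha hx.1 hxy hy.2
  intro x hx y hy
  rcases le_total x y with h | h
  · exact key x hx y hy h
  · rw [dist_comm, dist_comm x y]; exact key y hy x hx h

/-- On [t, 2t] one has φ'(s) ≤ 2t φ'(s)/s, because φ' ≥ 0 and s ≤ 2t. -/
theorem fundamental_two_mul_sub_le (hri : X.RearrangementInvariant)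
    (hne : ∃ f ∈ X.carrier, f ≠ 0) (hθ : ThetaCondition X.fundamental) {t : ℝ} (ht : 0 < t) :
    X.fundamental (2 * t) - X.fundamental t ≤
      2 * t * ∫ s in t..(2 * t), deriv X.fundamental s / s := by
  have hle : t ≤ 2 * t := by linarith
  have hac : AbsolutelyContinuousOnInterval X.fundamental t (2 * t) := by
    apply LipschitzOnWith.absolutelyContinuousOnInterval
    rw [Set.uIcc_of_le hle]
    exact lipschitzOnWith_fundamental hri hne ht
  rw [← hac.integral_deriv_eq_sub, ← intervalIntegral.integral_const_mul]
  have hi : IntervalIntegrable (fun s => deriv X.fundamental s / s) volume t (2 * t) := by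
    rw [intervalIntegrable_iff_integrableOn_Ioc_of_le hle]
    exact (hθ t ht).mono_set Set.Ioc_subset_Ioi_self
  refine intervalIntegral.integral_mono_on hle hac.intervalIntegrable_deriv (hi.const_mul _) ?_
  intro s hs
  have hs0 : 0 < s := ht.trans_le hs.1
  have hd : 0 ≤ deriv X.fundamental s := (fundamental_mono hri hne).deriv_nonneg
  rw [mul_div_assoc', le_div_iff₀ hs0, mul_comm]
  exact mul_le_mul_of_nonneg_right hs.2 hd

/-- Dividing the doubling estimate by 2^(k+1) ε gives a(k+1) ≤ a(k)/2 + c(k), where the c(k) are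
integrals of φ'(s)/s over adjacent dyadic intervals and have bounded sum. -/
theorem summable_dyadic (hri : X.RearrangementInvariant) (hne : ∃ f ∈ X.carrier, f ≠ 0)
    (hθ : ThetaCondition X.fundamental) {ε : ℝ} (hε : 0 < ε) :
    Summable fun k : ℕ => X.fundamental (2 ^ k * ε) / (2 ^ k * ε) := by
  set a : ℕ → ℝ := fun k => X.fundamental (2 ^ k * ε) / (2 ^ k * ε) with ha
  set c : ℕ → ℝ := fun k => ∫ s in (2 ^ k * ε)..(2 ^ (k + 1) * ε), deriv X.fundamental s / s
  set I := ∫ s in Set.Ioi ε, deriv X.fundamental s / s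
  have hpos : ∀ k : ℕ, 0 < 2 ^ k * ε := fun k => by positivity
  have ha0 : ∀ k, 0 ≤ a k := fun k => div_nonneg (fundamental_nonneg hri hne _) (hpos k).le
  have hmono : Monotone fun k : ℕ => 2 ^ k * ε := fun i j hij => by
    dsimp only; gcongr; norm_num
  have hint : ∀ k : ℕ, IntervalIntegrable (fun s => deriv X.fundamental s / s) volume
      (2 ^ k * ε) (2 ^ (k + 1) * ε) := fun k => by
    rw [intervalIntegrable_iff_integrableOn_Ioc_of_le (hmono k.le_succ)]
    exact (hθ _ (hpos k)).mono_set Set.Ioc_subset_Ioi_self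
  have hstep : ∀ k, a (k + 1) ≤ a k / 2 + c k := by
    intro k
    have h1 := fundamental_two_mul_sub_le hri hne hθ (hpos k)
    have e : 2 * (2 ^ k * ε) = 2 ^ (k + 1) * ε := by ring
    rw [e] at h1
    have h2 : a (k + 1) = X.fundamental (2 ^ (k + 1) * ε) / (2 ^ (k + 1) * ε) := rfl
    have h3 : a k / 2 = X.fundamental (2 ^ k * ε) / (2 ^ (k + 1) * ε) := by
      rw [ha, ← e]; field_simp
    rw [h2, h3, div_le_iff₀ (hpos _), add_mul, div_mul_cancel₀ _ (hpos _).ne']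
    linarith
  have hc : ∀ N, ∑ k ∈ Finset.range N, c k ≤ I := by
    intro N
    have h1 : ∑ k ∈ Finset.range N, c k =
        ∫ s in (2 ^ 0 * ε)..(2 ^ N * ε), deriv X.fundamental s / s :=
      intervalIntegral.sum_integral_adjacent_intervals fun k _ => hint k
    rw [h1, pow_zero, one_mul, intervalIntegral.integral_of_le (by simpa using hmono N.zero_le)]
    refine setIntegral_mono_set (hθ ε hε) ?_ Set.Ioc_subset_Ioi_self.eventuallyLE
    filter_upwards [ae_restrict_mem measurableSet_Ioi] with s hs
    exact div_nonneg (fundamental_mono hri hne).deriv_nonneg (hε.trans hs).le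
  -- Summing the recursion gives s - a(0) ≤ s/2 + I for each partial sum s, whence the constant
  -- 2(a(0) + I).
  refine summable_of_sum_range_le (c := 2 * (a 0 + I)) ha0 fun N => ?_
  have h1 : ∑ k ∈ Finset.range N, a (k + 1) ≤ (∑ k ∈ Finset.range N, a k) / 2 + I := by
    refine (Finset.sum_le_sum fun k _ => hstep k).trans ?_
    rw [Finset.sum_add_distrib, ← Finset.sum_div]
    linarith [hc N]
  have h2 := Finset.sum_range_succ' a N
  have h3 := Finset.sum_range_succ a N
  linarith [ha0 N]

/-! ### Functions supported away from the origin -/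

/-- On each dyadic interval 1/x is at most its value at the left end. The k-th interval has length
2^k ε, so by rearrangement invariance it contributes φ(2^k ε)/(2^k ε). -/
theorem fnNorm_theta_lt_top (hri : X.RearrangementInvariant) (hne : ∃ f ∈ X.carrier, f ≠ 0)
    (hθ : ThetaCondition X.fundamental) {ε : ℝ} (hε : 0 < ε) : X.fnNorm (theta ε) < ∞ := by
  have hσ := X.isBFIL.isFnNorm
  let u : ℕ → RPos → ℝ≥0∞ := fun k x =>
    ENNReal.ofReal (2 ^ k * ε)⁻¹ * ind (ioc (2 ^ k * ε) (2 ^ (k + 1) * ε)) x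
  have hu : ∀ k, Measurable (u k) := fun k => (measurable_ind (measurableSet_ioc _ _)).const_mul _
  have hpos : ∀ k : ℕ, 0 < 2 ^ k * ε := fun k => by positivity
  have hun : ∀ k, X.fnNorm (u k) = ENNReal.ofReal (X.fundamental (2 ^ k * ε) / (2 ^ k * ε)) := by
    intro k
    rw [hσ.const_mul _ ENNReal.ofReal_ne_top, fnNorm_ind_ioc hri (hpos k).le,
      fnNorm_ioc_eq hri hne, ← ENNReal.ofReal_mul (inv_nonneg.mpr (hpos k).le), div_eq_inv_mul]
    congr 4
    ring
  have hle : theta ε ≤ᵐ[volume] fun x => ∑' k, u k x := by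
    refine .of_forall fun x => ?_
    by_cases hx : ε < (x : ℝ)
    swap
    · simp [theta, hx]
    have hex : ∃ k : ℕ, (x : ℝ) ≤ 2 ^ k * ε := by
      obtain ⟨k, hk⟩ := pow_unbounded_of_one_lt ((x : ℝ) / ε) (one_lt_two)
      rw [div_lt_iff₀ hε] at hk
      exact ⟨k, hk.le⟩
    classical
    have hspec := Nat.find_spec hex
    have hmin := fun m => Nat.find_min hex (m := m)
    set K := Nat.find hex
    -- K is the first index with x ≤ 2^K ε. It is positive since x > ε, and K - 1 indexes the dyadic
    -- interval that contains x.
    obtain ⟨k, hk⟩ : ∃ k, K = k + 1 := Nat.exists_eq_succ_of_ne_zero (by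
      intro h0
      rw [h0] at hspec
      simp at hspec
      linarith)
    have hlt : 2 ^ k * ε < x := not_le.mp (hmin k (by omega))
    rw [hk] at hspec
    refine le_trans ?_ (ENNReal.le_tsum k)
    rw [theta, Set.indicator_of_mem (by exact hx)]
    simp only [u]
    rw [ind_of_mem (A := ioc (2 ^ k * ε) (2 ^ (k + 1) * ε)) ⟨hlt, hspec⟩, mul_one]
    exact ENNReal.ofReal_le_ofReal (inv_anti₀ (hpos k) hlt.le)
  refine (hσ.mono hle).trans_lt ((hσ.tsum_le u hu).trans_lt ?_)
  simp only [hun]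
  rw [← ENNReal.ofReal_tsum_of_nonneg
    (fun k => div_nonneg (fundamental_nonneg hri hne _) (hpos k).le)
    (summable_dyadic hri hne hθ hε)]
  exact ENNReal.ofReal_lt_top

end BFIL

/-- The basic estimate: SF vanishes on (0, ε] and is at most (∫F)/x beyond it. Through it Lebesgue
integrability away from the origin yields membership in [S, X]. -/
theorem avg_le_theta {F : RPos → ℝ≥0∞} {ε : ℝ} (h : ∀ᵐ x : RPos, (x : ℝ) ≤ ε → F x = 0)
    (x : RPos) : avg F x ≤ (∫⁻ y, F y) * theta ε x := by
  by_cases hx : ε < (x : ℝ)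
  · rw [theta, Set.indicator_of_mem (by exact hx), avg, mul_comm]
    gcongr
    exact Measure.restrict_le_self
  · have : ∫⁻ y in Set.Iic x, F y = 0 := by
      rw [← nonpos_iff_eq_zero, ← lintegral_zero (μ := volume.restrict (Set.Iic x))]
      refine lintegral_mono_ae ?_
      filter_upwards [ae_restrict_of_ae h, ae_restrict_mem measurableSet_Iic] with y hy hyx
      exact (hy (le_trans hyx (not_lt.mp hx))).le
    rw [avg, this, mul_zero]
    exact zero_le

theorem BFIL.hardyNorm_le (X : BFIL) {F : RPos → ℝ≥0∞} {ε : ℝ}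
    (h : ∀ᵐ x : RPos, (x : ℝ) ≤ ε → F x = 0) (hfin : ∫⁻ y, F y ≠ ∞) :
    X.hardyNorm F ≤ (∫⁻ y, F y) * X.fnNorm (theta ε) := by
  rw [← X.isBFIL.isFnNorm.const_mul _ hfin]
  exact X.isBFIL.isFnNorm.mono (.of_forall (avg_le_theta h))

/-! ### Truncation -/

/-- The functions `n · χ_{(1/(n+1), n]}`, that increase to infinity. -/
def bump (n : ℕ) (x : RPos) : ℝ≥0∞ := n * ind (ioc (1 / ((n : ℝ) + 1)) n) x

theorem measurable_bump (n : ℕ) : Measurable (bump n) :=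
  (measurable_ind (measurableSet_ioc _ _)).const_mul _

theorem lintegral_bump_ne_top (n : ℕ) : ∫⁻ x, bump n x ≠ ∞ := by
  simp only [bump]
  rw [lintegral_const_mul _ (measurable_ind (measurableSet_ioc _ _)), ind,
    lintegral_indicator_const (measurableSet_ioc _ _), ioc, volume_Ioc_coe (by positivity)]
  exact ENNReal.mul_ne_top (by simp) (by simp)

theorem bump_of_le {n : ℕ} {x : RPos} (h : (x : ℝ) ≤ 1 / ((n : ℝ) + 1)) : bump n x = 0 := by
  rw [bump, ind_of_notMem fun hx => absurd hx.1 (not_lt.mpr h), mul_zero]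

theorem bump_lt_top (n : ℕ) (x : RPos) : bump n x < ∞ := by
  refine ENNReal.mul_lt_top (by simp) ?_
  by_cases h : x ∈ ioc (1 / ((n : ℝ) + 1)) n
  · rw [ind_of_mem h]; exact ENNReal.one_lt_top
  · rw [ind_of_notMem h]; exact ENNReal.zero_lt_top

theorem bump_mono (x : RPos) : Monotone fun n => bump n x := by
  intro m n hmn
  have h : (m : ℝ) ≤ n := by exact_mod_cast hmn
  have hsub : ioc (1 / ((m : ℝ) + 1)) m ⊆ ioc (1 / ((n : ℝ) + 1)) n := fun y hy =>
    ⟨lt_of_le_of_lt (by gcongr) hy.1, hy.2.trans h⟩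
  exact mul_le_mul' (by exact_mod_cast hmn) (ind_mono hsub x)

theorem eventually_bump_eq (x : RPos) : ∀ᶠ n : ℕ in atTop, bump n x = n := by
  obtain ⟨N, hN⟩ := exists_nat_gt (max (x : ℝ) (x : ℝ)⁻¹)
  filter_upwards [eventually_ge_atTop N] with n hn
  have hn' : max (x : ℝ) (x : ℝ)⁻¹ < n := hN.trans_le (by exact_mod_cast hn)
  rw [bump, ind_of_mem, mul_one]
  refine ⟨?_, (le_max_left _ _).trans hn'.le⟩
  have h1 : (x : ℝ)⁻¹ < n + 1 := (le_max_right _ _).trans_lt (hn'.trans (lt_add_one _))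
  rw [one_div]
  exact (inv_lt_comm₀ (by positivity) x.2).mpr h1

theorem tendsto_min_bump (F : RPos → ℝ≥0∞) (x : RPos) :
    Tendsto (fun n => min (F x) (bump n x)) atTop (𝓝 (F x)) := by
  have h1 : Tendsto (fun n => bump n x) atTop (𝓝 ∞) :=
    ENNReal.tendsto_nat_nhds_top.congr' (by
      filter_upwards [eventually_bump_eq x] with n hn using hn.symm)
  simpa using (tendsto_const_nhds (x := F x)).min h1

theorem min_bump_mono (F : RPos → ℝ≥0∞) (x : RPos) : Monotone fun n => min (F x) (bump n x) :=
  fun _ _ h => min_le_min_left _ (bump_mono x h)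

theorem measurable_min_bump {F : RPos → ℝ≥0∞} (hF : Measurable F) (n : ℕ) :
    Measurable fun x => min (F x) (bump n x) := hF.min (measurable_bump n)

/-- The Lorentz type condition that `1 / x`, away from the origin, belongs to `X`. -/
def ContainsTheta (X : BFIL) : Prop := ∀ ε : ℝ, 0 < ε → X.fnNorm (theta ε) < ∞

namespace BFIL

variable {X : BFIL}

theorem hardyNorm_lt_top (hΘ : ContainsTheta X) {F : RPos → ℝ≥0∞} {ε : ℝ} (hε : 0 < ε)
    (h : ∀ᵐ x : RPos, (x : ℝ) ≤ ε → F x = 0) (hfin : ∫⁻ y, F y ≠ ∞) : X.hardyNorm F < ∞ :=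
  (X.hardyNorm_le h hfin).trans_lt (ENNReal.mul_lt_top hfin.lt_top (hΘ ε hε))

theorem hardyNorm_lt_top_of_le_bump (hΘ : ContainsTheta X) {F : RPos → ℝ≥0∞} {n : ℕ}
    (h : F ≤ᵐ[volume] bump n) : X.hardyNorm F < ∞ := by
  refine hardyNorm_lt_top hΘ (ε := 1 / ((n : ℝ) + 1)) (by positivity) ?_
    ((lintegral_mono_ae h).trans_lt (lintegral_bump_ne_top n).lt_top).ne
  filter_upwards [h] with x hx hxn
  rw [bump_of_le hxn] at hx
  exact nonpos_iff_eq_zero.mp hx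

/-- Functions below a bump live on a fixed (ε, ∞), where the [S, X] norm is at most a constant times
the L¹ norm, so Lebesgue's theorem applies. -/
theorem dominatesConvergence_bump (hΘ : ContainsTheta X) (n : ℕ) :
    DominatesConvergence X.hardyNorm (bump n) := by
  intro H hH hle ht
  set ε : ℝ := 1 / ((n : ℝ) + 1) with hε
  have hε0 : 0 < ε := by positivity
  have h1 : Tendsto (fun k => ∫⁻ x, H k x) atTop (𝓝 0) := by
    have := tendsto_lintegral_of_dominated_convergence (μ := volume) (F := H) (f := fun _ => 0)
      (bump n) hH hle (lintegral_bump_ne_top n) ht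
    simpa using this
  have h2 := ENNReal.Tendsto.mul_const (b := X.fnNorm (theta ε)) h1 (.inr (hΘ ε hε0).ne)
  rw [zero_mul] at h2
  refine tendsto_of_tendsto_of_tendsto_of_le_of_le tendsto_const_nhds h2 (fun k => zero_le)
    fun k => X.hardyNorm_le ?_
      ((lintegral_mono_ae (hle k)).trans_lt (lintegral_bump_ne_top n).lt_top).ne
  filter_upwards [hle k] with x hx hxn
  rw [bump_of_le hxn] at hx
  exact nonpos_iff_eq_zero.mp hx

/-- Split F into a part below a bump and a tail of small norm. Together with
`DominatesConvergence.tendsto_tail`, this shows that for a.e. finite F dominated convergence need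
only be tested on truncations. -/
theorem dominatesConvergence_of_tail (hΘ : ContainsTheta X) {F : RPos → ℝ≥0∞} (hF : Measurable F)
    (h : Tendsto (fun n => X.hardyNorm fun x => F x - min (F x) (bump n x)) atTop (𝓝 0)) :
    DominatesConvergence X.hardyNorm F := by
  refine .of_split X.isBFIL.isFnNorm_hardyNorm fun ε hε => ?_
  rw [ENNReal.tendsto_nhds_zero] at h
  obtain ⟨n, hn⟩ := (h ε hε).exists
  exact ⟨bump n, _, measurable_bump n, hF.sub (measurable_min_bump hF n),
    dominatesConvergence_bump hΘ n, hn, .of_forall fun x =>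
      le_add_tsub.trans (add_le_add_left (min_le_right _ _) _)⟩

end BFIL

theorem DominatesConvergence.tendsto_tail {σ : (RPos → ℝ≥0∞) → ℝ≥0∞} {F : RPos → ℝ≥0∞}
    (h : DominatesConvergence σ F) (hF : Measurable F) (hfin : ∀ᵐ x, F x < ∞) :
    Tendsto (fun n => σ fun x => F x - min (F x) (bump n x)) atTop (𝓝 0) := by
  refine h _ (fun n => hF.sub (measurable_min_bump hF n))
    (fun n => .of_forall fun x => tsub_le_self) ?_
  filter_upwards [hfin] with x hx
  have := ENNReal.Tendsto.sub (tendsto_const_nhds (x := F x)) (tendsto_min_bump F x)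
    (.inl hx.ne)
  simpa using this

/-! ### The vector measure `A ↦ S χ_A` -/

namespace BFIL

variable {X : BFIL}

theorem mem_domain_iff (f : L0) : f ∈ X.domain.carrier ↔ X.hardyNorm (eabs f) < ∞ :=
  X.isBFIL.hasFnNorm_hardyDomain.mem_iff f

theorem hardyNorm_ind_le {A : Set RPos} (hA : MeasurableSet A) (hv : volume A ≠ ∞) {ε : ℝ}
    (h : volume (A ∩ {x : RPos | (x : ℝ) ≤ ε}) = 0) :
    X.hardyNorm (ind A) ≤ volume A * X.fnNorm (theta ε) := by
  have hi : ∫⁻ x, ind A x = volume A := by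
    rw [ind, lintegral_indicator_const hA, one_mul]
  rw [← hi] at hv ⊢
  refine X.hardyNorm_le ?_ hv
  filter_upwards [measure_eq_zero_iff_ae_notMem.mp h] with x hx hxε
  exact ind_of_notMem fun hxA => hx ⟨hxA, hxε⟩

theorem chi_mem_domain (hΘ : ContainsTheta X) {A : Set RPos} (hA : A ∈ boundedAway) :
    chi A hA.1 ∈ X.domain.carrier := by
  rw [mem_domain_iff, X.isBFIL.isFnNorm_hardyNorm.congr (eabs_chi hA.1)]
  obtain ⟨hm, hv, ε, hε, h0⟩ := hA
  exact (hardyNorm_ind_le hm hv.ne h0).trans_lt (ENNReal.mul_lt_top hv (hΘ ε hε))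

open Classical in
/-- The characteristic function of a set of the δ-ring, as an element of `[S, X]`. -/
def chiElem (hΘ : ContainsTheta X) (A : Set RPos) : X.domain.Elem :=
  if hA : A ∈ boundedAway then mkElem (chi A hA.1) (chi_mem_domain hΘ hA) else 0

theorem toFn_chiElem (hΘ : ContainsTheta X) {A : Set RPos} (hA : A ∈ boundedAway) :
    (chiElem hΘ A).toFn = chi A hA.1 := by
  rw [chiElem, dif_pos hA]; rfl

theorem coeFn_chiElem (hΘ : ContainsTheta X) {A : Set RPos} (hA : A ∈ boundedAway) :
    (chiElem hΘ A).toFn =ᵐ[volume] A.indicator fun _ => (1 : ℝ) := by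
  rw [toFn_chiElem hΘ hA]; exact coeFn_chi hA.1

theorem enorm_chiElem_le (hΘ : ContainsTheta X) {A : Set RPos} (hA : A ∈ boundedAway) {ε : ℝ}
    (h : volume (A ∩ {x : RPos | (x : ℝ) ≤ ε}) = 0) :
    ‖chiElem hΘ A‖ₑ ≤ volume A * X.fnNorm (theta ε) := by
  rw [Elem.enorm_domain_eq, toFn_chiElem hΘ hA,
    X.isBFIL.isFnNorm_hardyNorm.congr (eabs_chi hA.1)]
  exact hardyNorm_ind_le hA.1 hA.2.1.ne h

theorem chiElem_union (hΘ : ContainsTheta X) {A B : Set RPos} (hA : A ∈ boundedAway)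
    (hB : B ∈ boundedAway) (hd : Disjoint A B) :
    chiElem hΘ (A ∪ B) = chiElem hΘ A + chiElem hΘ B := by
  apply Elem.toFn_injective
  apply AEEqFun.ext
  rw [Elem.toFn_add]
  filter_upwards [coeFn_chiElem hΘ (boundedAway_union hA hB), coeFn_chiElem hΘ hA,
    coeFn_chiElem hΘ hB, AEEqFun.coeFn_add (chiElem hΘ A).toFn (chiElem hΘ B).toFn]
    with x h1 h2 h3 h4
  rw [h1, h4, Pi.add_apply, h2, h3, Set.indicator_union_of_disjoint hd]

theorem chiElem_empty (hΘ : ContainsTheta X) : chiElem hΘ ∅ = 0 := by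
  have := chiElem_union hΘ boundedAway_empty boundedAway_empty (Set.disjoint_empty _)
  simpa using this

/-- The remainder after a finite set of indices is the indicator of the uncovered part, whose norm
is at most its Lebesgue measure times ‖θ_ε‖. The same ε serves for all remainders, since the union
avoids (0, ε]. The series thus converges already in [S, X], and applying S gives ν. -/
theorem hasSum_chiElem (hΘ : ContainsTheta X) {A : ℕ → Set RPos} (hA : ∀ n, A n ∈ boundedAway)
    (hd : Pairwise (Function.onFun Disjoint A)) (hU : (⋃ n, A n) ∈ boundedAway) :
    HasSum (fun n => chiElem hΘ (A n)) (chiElem hΘ (⋃ n, A n)) := by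
  have hfin : ∀ s : Finset ℕ, (⋃ n ∈ s, A n) ∈ boundedAway ∧
      chiElem hΘ (⋃ n ∈ s, A n) = ∑ n ∈ s, chiElem hΘ (A n) := by
    intro s
    induction s using Finset.induction_on with
    | empty => simpa using ⟨boundedAway_empty, chiElem_empty hΘ⟩
    | insert a s ha ih =>
      rw [Finset.set_biUnion_insert, Finset.sum_insert ha]
      refine ⟨boundedAway_union (hA a) ih.1, ?_⟩
      rw [chiElem_union hΘ (hA a) ih.1, ih.2]
      rw [Set.disjoint_iUnion₂_right]
      intro i hi
      exact hd fun h => ha (h ▸ hi)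
  have hrest : ∀ s : Finset ℕ, chiElem hΘ (⋃ n, A n) - ∑ n ∈ s, chiElem hΘ (A n) =
      chiElem hΘ ((⋃ n, A n) \ ⋃ n ∈ s, A n) := by
    intro s
    rw [← (hfin s).2, sub_eq_iff_eq_add', ← chiElem_union hΘ (hfin s).1
      (boundedAway_of_subset hU (hU.1.diff (hfin s).1.1) Set.sdiff_subset)
      Set.disjoint_sdiff_right, Set.union_sdiff_cancel]
    exact Set.iUnion₂_subset fun n _ => Set.subset_iUnion A n
  obtain ⟨hm, hv, ε, hε, h0⟩ := id hU
  have htsum : ∑' n, volume (A n) ≠ ∞ := by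
    rw [← measure_iUnion hd fun n => (hA n).1]; exact hv.ne
  have h1 := ENNReal.Tendsto.mul_const (b := X.fnNorm (theta ε))
    (ENNReal.tendsto_tsum_compl_atTop_zero htsum) (.inr (hΘ ε hε).ne)
  rw [zero_mul] at h1
  rw [HasSum, tendsto_iff_edist_tendsto_0]
  refine tendsto_of_tendsto_of_tendsto_of_le_of_le tendsto_const_nhds h1 (fun s => zero_le)
    fun s => ?_
  dsimp only
  rw [edist_comm, edist_eq_enorm_sub, hrest s]
  refine (enorm_chiElem_le hΘ (boundedAway_of_subset hU (hU.1.diff (hfin s).1.1) Set.sdiff_subset)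
    (measure_mono_null (Set.inter_subset_inter_left _ Set.sdiff_subset) h0)).trans ?_
  gcongr
  refine (measure_mono (t := ⋃ n : {n // n ∉ s}, A n) ?_).trans (measure_iUnion_le _)
  rintro x ⟨hx, hxs⟩
  obtain ⟨n, hn⟩ := Set.mem_iUnion.mp hx
  exact Set.mem_iUnion.mpr ⟨⟨n, fun hns => hxs (Set.mem_biUnion hns hn)⟩, hn⟩

theorem chiElem_of_notMem (hΘ : ContainsTheta X) {A : Set RPos} (hA : A ∉ boundedAway) :
    chiElem hΘ A = 0 := dif_neg hA

/-- The vector measure `A ↦ S χ_A`. -/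
def hardyMeasure (hΘ : ContainsTheta X) : RingMeasure X.Elem where
  toFun A := X.hardyCLM (chiElem hΘ A)
  apply_of_notMem A hA := by rw [chiElem_of_notMem hΘ hA, map_zero]
  hasSum_iUnion A hA hd hU := X.hardyCLM.hasSum (hasSum_chiElem hΘ hA hd hU)

theorem toFn_hardyMeasure (hΘ : ContainsTheta X) {A : Set RPos} (hA : A ∈ boundedAway) :
    ((hardyMeasure hΘ).toFun A).toFn = hardy (chi A hA.1) := by
  rw [← toFn_chiElem hΘ hA]; rfl

theorem enorm_hardyMeasure_le (hΘ : ContainsTheta X) {A : Set RPos} (hA : A ∈ boundedAway) {ε : ℝ}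
    (h : volume (A ∩ {x : RPos | (x : ℝ) ≤ ε}) = 0) :
    ‖(hardyMeasure hΘ).toFun A‖ₑ ≤ volume A * X.fnNorm (theta ε) :=
  (X.enorm_hardyCLM_le _).trans (enorm_chiElem_le hΘ hA h)

end BFIL

/-! ### Scalar measures dominated by Lebesgue measure away from the origin -/

/-- The half-line `(ε, ∞)`. -/
def beyond (ε : ℝ) : Set RPos := {x | ε < (x : ℝ)}

theorem measurableSet_beyond (ε : ℝ) : MeasurableSet (beyond ε) :=
  measurableSet_lt measurable_const measurable_subtype_coe

theorem mem_boundedAway_of_subset_beyond {A : Set RPos} {ε : ℝ} (hε : 0 < ε)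
    (hA : MeasurableSet A) (hv : volume A < ∞) (h : A ⊆ beyond ε) : A ∈ boundedAway := by
  refine ⟨hA, hv, ε, hε, ?_⟩
  have : A ∩ {x : RPos | (x : ℝ) ≤ ε} = ∅ := by
    ext x
    simp only [Set.mem_inter_iff, Set.mem_ofPred_eq, Set.mem_empty_iff_false, iff_false, not_and,
      not_le]
    exact fun hx => h hx
  rw [this, measure_empty]

namespace RingMeasure

variable {μ : RingMeasure ℝ}

/-- A scalar measure that is dominated by Lebesgue measure away from the origin. -/
def IsDominated (μ : RingMeasure ℝ) : Prop :=
  ∀ ε : ℝ, 0 < ε → ∃ K : ℝ≥0∞, K ≠ ∞ ∧ ∀ A ∈ boundedAway,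
    volume (A ∩ {x : RPos | (x : ℝ) ≤ ε}) = 0 → ‖μ.toFun A‖ₑ ≤ K * volume A

theorem IsDominated.neg (h : μ.IsDominated) : μ.neg.IsDominated := fun ε hε => by
  obtain ⟨K, hK, hle⟩ := h ε hε
  exact ⟨K, hK, fun A hA h0 => by simpa [RingMeasure.neg] using hle A hA h0⟩

theorem ofReal_le_enorm (r : ℝ) : ENNReal.ofReal r ≤ ‖r‖ₑ := by
  rw [Real.enorm_eq_ofReal_abs]; exact ENNReal.ofReal_le_ofReal (le_abs_self r)

/-- This lets integrals against the scalar measures be taken on Lebesgue classes of functions. -/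
theorem IsDominated.upper_absolutelyContinuous (h : μ.IsDominated) :
    μ.upper ≪ (volume : Measure RPos) := by
  refine Measure.AbsolutelyContinuous.mk fun A hA h0 => ?_
  rw [μ.upper_apply hA, ← nonpos_iff_eq_zero]
  refine μ.upperFun_le fun B hB hBA => ?_
  have hB0 : volume B = 0 := measure_mono_null hBA h0
  obtain ⟨K, hK, hle⟩ := h 1 one_pos
  refine (ofReal_le_enorm _).trans ?_
  simpa [hB0] using hle B hB (measure_mono_null Set.inter_subset_left hB0)

theorem IsDominated.exists_restrict_upper_le (h : μ.IsDominated) {ε : ℝ} (hε : 0 < ε) :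
    ∃ K : ℝ≥0∞, K ≠ ∞ ∧
      μ.upper.restrict (beyond ε) ≤ K • (volume : Measure RPos).restrict (beyond ε) := by
  obtain ⟨K, hK, hle⟩ := h ε hε
  refine ⟨K, hK, Measure.le_iff.mpr fun A hA => ?_⟩
  rw [Measure.restrict_apply hA, Measure.smul_apply, Measure.restrict_apply hA, smul_eq_mul,
    μ.upper_apply (hA.inter (measurableSet_beyond ε))]
  refine μ.upperFun_le fun B hB hBA => (ofReal_le_enorm _).trans ((hle B hB ?_).trans ?_)
  · have : B ∩ {x : RPos | (x : ℝ) ≤ ε} = ∅ := by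
      ext x
      simp only [Set.mem_inter_iff, Set.mem_ofPred_eq, Set.mem_empty_iff_false, iff_false, not_and,
        not_le]
      exact fun hx => (hBA hx).2
    rw [this, measure_empty]
  · gcongr

theorem IsDominated.upper_lt_top (h : μ.IsDominated) {ε : ℝ} (hε : 0 < ε) {A : Set RPos}
    (hA : MeasurableSet A) (hv : volume A < ∞) (hs : A ⊆ beyond ε) : μ.upper A < ∞ := by
  obtain ⟨K, hK, hle⟩ := h.exists_restrict_upper_le hε
  have := hle A
  rw [Measure.restrict_apply hA, Set.inter_eq_left.mpr hs, Measure.smul_apply,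
    Measure.restrict_apply hA, Set.inter_eq_left.mpr hs, smul_eq_mul] at this
  exact this.trans_lt (ENNReal.mul_lt_top hK.lt_top hv)

/-- The Jordan decomposition. -/
theorem apply_eq_sub {A : Set RPos} (hA : A ∈ boundedAway) (hu : μ.upper A < ∞)
    (hl : μ.lower A < ∞) : μ.toFun A = (μ.upper A).toReal - (μ.lower A).toReal := by
  -- Passing to complements in A turns -μ(B) into μ(A \ B) - μ(A), so the supremum defining μ⁻(A) is
  -- the one defining μ⁺(A) shifted by -μ(A).
  have hsub : ∀ B ∈ boundedAway, B ⊆ A → μ.toFun A = μ.toFun B + μ.toFun (A \ B) := by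
    intro B hB hBA
    rw [← μ.apply_union hB (boundedAway_of_subset hA (hA.1.diff hB.1) Set.sdiff_subset)
      Set.disjoint_sdiff_right, Set.union_sdiff_cancel hBA]
  have e : ∀ C ∈ boundedAway, C ⊆ A →
      μ.toFun C ≤ (μ.upper A).toReal ∧ -μ.toFun C ≤ (μ.lower A).toReal := by
    intro C hC hCA
    constructor
    · rw [upper_apply _ hA.1] at hu ⊢
      exact (ENNReal.ofReal_le_iff_le_toReal hu.ne).mp (μ.le_upperFun hC hCA)
    · rw [lower, upper_apply _ hA.1] at hl ⊢
      exact (ENNReal.ofReal_le_iff_le_toReal hl.ne).mp (μ.neg.le_upperFun hC hCA)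
  have hA' : ∀ B ∈ boundedAway, B ⊆ A → A \ B ∈ boundedAway := fun B hB _ =>
    boundedAway_of_subset hA (hA.1.diff hB.1) Set.sdiff_subset
  have hpos : 0 ≤ μ.toFun A + (μ.lower A).toReal := by
    linarith [(e A hA subset_rfl).2]
  have hpos' : 0 ≤ -μ.toFun A + (μ.upper A).toReal := by
    linarith [(e A hA subset_rfl).1]
  apply le_antisymm
  · have h1 : μ.lower A ≤ ENNReal.ofReal (-μ.toFun A + (μ.upper A).toReal) := by
      rw [lower, upper_apply _ hA.1]
      refine μ.neg.upperFun_le fun B hB hBA => ENNReal.ofReal_le_ofReal ?_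
      have h2 := hsub B hB hBA
      have h3 := (e _ (hA' B hB hBA) Set.sdiff_subset).1
      change -μ.toFun B ≤ _
      linarith
    have := ENNReal.toReal_mono ENNReal.ofReal_ne_top h1
    rw [ENNReal.toReal_ofReal hpos'] at this
    linarith
  · have h1 : μ.upper A ≤ ENNReal.ofReal (μ.toFun A + (μ.lower A).toReal) := by
      rw [upper_apply _ hA.1]
      refine μ.upperFun_le fun B hB hBA => ENNReal.ofReal_le_ofReal ?_
      have h2 := hsub B hB hBA
      have h3 := (e _ (hA' B hB hBA) Set.sdiff_subset).2
      linarith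
    have := ENNReal.toReal_mono ENNReal.ofReal_ne_top h1
    rw [ENNReal.toReal_ofReal hpos] at this
    linarith

/-- The Hahn decomposition, on a set of the δ-ring. -/
theorem IsDominated.exists_hahn (h : μ.IsDominated) {ε : ℝ} (hε : 0 < ε) {A : Set RPos}
    (hA : MeasurableSet A) (hv : volume A < ∞) (hs : A ⊆ beyond ε) :
    ∃ P, MeasurableSet P ∧ μ.lower (A ∩ P) = 0 ∧ μ.upper (A \ P) = 0 := by
  have hu := h.upper_lt_top hε hA hv hs
  have hl : μ.lower A < ∞ := h.neg.upper_lt_top hε hA hv hs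
  have : IsFiniteMeasure (μ.upper.restrict A) := ⟨by rwa [Measure.restrict_apply_univ]⟩
  have : IsFiniteMeasure (μ.lower.restrict A) := ⟨by rwa [Measure.restrict_apply_univ]⟩
  -- On subsets of A ∩ P one has μ⁻ ≤ μ⁺, hence μ ≥ 0 by the Jordan decomposition, and the supremum
  -- defining μ⁻(A ∩ P) is 0. The argument for μ⁺ on A \ P is symmetric.
  obtain ⟨P, hP, h1, h2⟩ := hahn_decomposition (μ.upper.restrict A) (μ.lower.restrict A)
  have hAb := mem_boundedAway_of_subset_beyond hε hA hv hs
  have hjordan : ∀ B ∈ boundedAway, B ⊆ A →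
      μ.toFun B = (μ.upper B).toReal - (μ.lower B).toReal := fun B hB hBA =>
    apply_eq_sub hB ((measure_mono hBA).trans_lt hu) ((measure_mono hBA).trans_lt hl)
  refine ⟨P, hP, ?_, ?_⟩
  · rw [lower, upper_apply _ (hA.inter hP), ← nonpos_iff_eq_zero]
    refine μ.neg.upperFun_le fun B hB hBA => ?_
    have hBA' : B ⊆ A := hBA.trans Set.inter_subset_left
    have h3 := h1 B hB.1 (hBA.trans Set.inter_subset_right)
    rw [Measure.restrict_apply hB.1, Measure.restrict_apply hB.1,
      Set.inter_eq_left.mpr hBA'] at h3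
    have h4 := ENNReal.toReal_mono ((measure_mono hBA').trans_lt hu).ne h3
    rw [nonpos_iff_eq_zero, ENNReal.ofReal_eq_zero]
    change -μ.toFun B ≤ 0
    rw [hjordan B hB hBA']
    linarith
  · rw [upper_apply _ (hA.diff hP), ← nonpos_iff_eq_zero]
    refine μ.upperFun_le fun B hB hBA => ?_
    have hBA' : B ⊆ A := hBA.trans Set.sdiff_subset
    have h3 := h2 B hB.1 (fun x hx => (hBA hx).2)
    rw [Measure.restrict_apply hB.1, Measure.restrict_apply hB.1,
      Set.inter_eq_left.mpr hBA'] at h3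
    have h4 := ENNReal.toReal_mono ((measure_mono hBA').trans_lt hl).ne h3
    rw [nonpos_iff_eq_zero, ENNReal.ofReal_eq_zero, hjordan B hB hBA']
    linarith

theorem IsDominated.integrable_upper (h : μ.IsDominated) {ε : ℝ} (hε : 0 < ε) {f : RPos → ℝ}
    (hf : Integrable f ((volume : Measure RPos).restrict (beyond ε))) :
    Integrable f (μ.upper.restrict (beyond ε)) := by
  obtain ⟨K, hK, hle⟩ := h.exists_restrict_upper_le hε
  exact (hf.smul_measure hK).mono_measure hle

theorem IsDominated.tendsto_integral_upper (h : μ.IsDominated) {ε : ℝ} (hε : 0 < ε)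
    {u : ℕ → RPos → ℝ} {f : RPos → ℝ}
    (hu : ∀ n, Integrable (u n) ((volume : Measure RPos).restrict (beyond ε)))
    (hf : Integrable f ((volume : Measure RPos).restrict (beyond ε)))
    (hlim : Tendsto (fun n => ∫⁻ x in beyond ε, ‖u n x - f x‖ₑ) atTop (𝓝 0)) :
    Tendsto (fun n => ∫ x in beyond ε, u n x ∂μ.upper) atTop
      (𝓝 (∫ x in beyond ε, f x ∂μ.upper)) := by
  obtain ⟨K, hK, hle⟩ := h.exists_restrict_upper_le hε
  refine tendsto_integral_of_L1 f (h.integrable_upper hε hf).aestronglyMeasurable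
    (.of_forall fun n => h.integrable_upper hε (hu n)) ?_
  have h1 := ENNReal.Tendsto.const_mul (a := K) hlim (.inr hK)
  rw [mul_zero] at h1
  refine tendsto_of_tendsto_of_tendsto_of_le_of_le tendsto_const_nhds h1 (fun n => zero_le)
    fun n => ?_
  refine (lintegral_mono' hle le_rfl).trans_eq ?_
  rw [lintegral_smul_measure, smul_eq_mul]

end RingMeasure

/-! ### The Hardy operator as an integral, away from the origin -/

namespace BFIL

variable {X : BFIL}

theorem isDominated_comp (hΘ : ContainsTheta X) (L : StrongDual ℝ X.Elem) :
    ((hardyMeasure hΘ).comp L).IsDominated := fun ε hε => by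
  refine ⟨‖L‖ₑ * X.fnNorm (theta ε), ENNReal.mul_ne_top (by simp) (hΘ ε hε).ne, fun A hA h0 => ?_⟩
  calc ‖L ((hardyMeasure hΘ).toFun A)‖ₑ ≤ ‖L‖ₑ * ‖(hardyMeasure hΘ).toFun A‖ₑ :=
        L.le_opENorm _
    _ ≤ ‖L‖ₑ * (volume A * X.fnNorm (theta ε)) := by
        gcongr; exact enorm_hardyMeasure_le hΘ hA h0
    _ = _ := by ring

/-- For functions supported away from the origin, the Hardy operator is the integral with respect
to the vector measure. -/
theorem apply_hardyCLM_eq_setIntegral (hΘ : ContainsTheta X) (L : StrongDual ℝ X.Elem) {ε : ℝ}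
    (hε : 0 < ε) {f : RPos → ℝ} (hf : Integrable f ((volume : Measure RPos).restrict (beyond ε)))
    (d : X.domain.Elem) (hd : d.toFn =ᵐ[volume] (beyond ε).indicator f) :
    L (X.hardyCLM d) = (∫ x in beyond ε, f x ∂((hardyMeasure hΘ).comp L).upper) -
      ∫ x in beyond ε, f x ∂((hardyMeasure hΘ).comp L).lower := by
  set μ := (hardyMeasure hΘ).comp L with hμ
  have hdom : μ.IsDominated := isDominated_comp hΘ L
  have hb := measurableSet_beyond ε
  -- Extension by zero is bounded from L¹(ε, ∞) to [S, X], so both sides of the claim are continuous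
  -- for the L¹ norm.
  have hnorm : ∀ (g : RPos → ℝ), Integrable g ((volume : Measure RPos).restrict (beyond ε)) →
      ∀ e : L0, e =ᵐ[volume] (beyond ε).indicator g →
        X.hardyNorm (eabs e) ≤ (∫⁻ x in beyond ε, ‖g x‖ₑ) * X.fnNorm (theta ε) := by
    intro g hg e he
    have h1 : eabs e =ᵐ[volume] (beyond ε).indicator fun x => ‖g x‖ₑ := by
      filter_upwards [he] with x hx
      rw [eabs, hx, enorm_indicator_eq_indicator_enorm]
    rw [X.isBFIL.isFnNorm_hardyNorm.congr h1, ← lintegral_indicator hb]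
    refine X.hardyNorm_le (.of_forall fun x hx => ?_) ?_
    · exact Set.indicator_of_notMem (s := beyond ε) (fun h => absurd h (not_lt.mpr hx)) _
    rw [lintegral_indicator hb]
    exact hg.2.ne
  have hex : ∀ (g : RPos → ℝ), Integrable g ((volume : Measure RPos).restrict (beyond ε)) →
      ∃ e : X.domain.Elem, e.toFn =ᵐ[volume] (beyond ε).indicator g := by
    intro g hg
    have hm : AEStronglyMeasurable ((beyond ε).indicator g) (volume : Measure RPos) :=
      (integrable_indicator_iff hb).mpr hg |>.aestronglyMeasurable
    have he : AEEqFun.mk _ hm =ᵐ[volume] (beyond ε).indicator g := AEEqFun.coeFn_mk _ _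
    refine ⟨mkElem (AEEqFun.mk _ hm) ((mem_domain_iff _).mpr ((hnorm g hg _ he).trans_lt
      (ENNReal.mul_lt_top hg.2 (hΘ ε hε)))), he⟩
  revert d
  -- Density argument: on indicators the claim is the definition of ν with the Jordan decomposition,
  -- and it passes to sums, L¹ limits and a.e. equal functions.
  refine Integrable.induction (μ := (volume : Measure RPos).restrict (beyond ε)) (P := fun f =>
    ∀ d : X.domain.Elem, d.toFn =ᵐ[volume] (beyond ε).indicator f →
      L (X.hardyCLM d) = (∫ x in beyond ε, f x ∂μ.upper) - ∫ x in beyond ε, f x ∂μ.lower)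
    ?_ ?_ ?_ ?_ hf
  · intro c s hs hv d hd
    rw [Measure.restrict_apply hs] at hv
    have hmeas := hs.inter hb
    have hmem := mem_boundedAway_of_subset_beyond hε hmeas hv Set.inter_subset_right
    have e : d = c • chiElem hΘ (s ∩ beyond ε) := by
      apply Elem.toFn_injective
      apply AEEqFun.ext
      rw [Elem.toFn_smul]
      filter_upwards [hd, coeFn_chiElem hΘ hmem,
        AEEqFun.coeFn_smul c (chiElem hΘ (s ∩ beyond ε)).toFn] with x h1 h2 h3
      rw [h1, h3, Pi.smul_apply, h2]
      by_cases hx1 : x ∈ s <;> by_cases hx2 : x ∈ beyond ε <;> simp [hx1, hx2]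
    have hu := hdom.upper_lt_top hε hmeas hv Set.inter_subset_right
    have hl : μ.lower (s ∩ beyond ε) < ∞ :=
      hdom.neg.upper_lt_top hε hmeas hv Set.inter_subset_right
    have hval : μ.toFun (s ∩ beyond ε) = L (X.hardyCLM (chiElem hΘ (s ∩ beyond ε))) := rfl
    rw [e, map_smul, map_smul, ← hval, RingMeasure.apply_eq_sub hmem hu hl,
      integral_indicator_const _ hs, integral_indicator_const _ hs, measureReal_restrict_apply hs,
      measureReal_restrict_apply hs, smul_eq_mul, smul_eq_mul, smul_eq_mul, Measure.real,
      Measure.real]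
    ring
  · intro f g _ hfi hgi hPf hPg d hd
    obtain ⟨df, hdf⟩ := hex f hfi
    obtain ⟨dg, hdg⟩ := hex g hgi
    have e : d = df + dg := by
      apply Elem.toFn_injective
      apply AEEqFun.ext
      rw [Elem.toFn_add]
      filter_upwards [hd, hdf, hdg, AEEqFun.coeFn_add df.toFn dg.toFn] with x h1 h2 h3 h4
      rw [h1, h4, Pi.add_apply, h2, h3, Set.indicator_add']
      rfl
    rw [e, map_add, map_add, hPf df hdf, hPg dg hdg]
    simp only [Pi.add_apply]
    rw [integral_add (hdom.integrable_upper hε hfi) (hdom.integrable_upper hε hgi),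
      RingMeasure.lower,
      integral_add (hdom.neg.integrable_upper hε hfi) (hdom.neg.integrable_upper hε hgi)]
    ring
  · apply IsSeqClosed.isClosed
    intro u f hu hlim d hd
    have hL1 : Tendsto (fun n => ∫⁻ x in beyond ε, ‖u n x - f x‖ₑ) atTop (𝓝 0) := by
      rw [tendsto_iff_edist_tendsto_0] at hlim
      refine hlim.congr fun n => ?_
      rw [L1.edist_def]
      simp only [edist_eq_enorm_sub]
    have hui : ∀ n, Integrable (u n) ((volume : Measure RPos).restrict (beyond ε)) := fun n =>
      L1.integrable_coeFn _
    have hfi := L1.integrable_coeFn f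
    choose e he using fun n => hex (u n) (hui n)
    have hed : Tendsto e atTop (𝓝 d) := by
      rw [tendsto_iff_edist_tendsto_0]
      have h1 := ENNReal.Tendsto.mul_const (b := X.fnNorm (theta ε)) hL1 (.inr (hΘ ε hε).ne)
      rw [zero_mul] at h1
      refine tendsto_of_tendsto_of_tendsto_of_le_of_le tendsto_const_nhds h1 (fun n => zero_le)
        fun n => ?_
      dsimp only
      rw [edist_eq_enorm_sub, Elem.enorm_domain_eq]
      refine hnorm (fun x => u n x - f x) ((hui n).sub hfi) _ ?_
      rw [Elem.toFn_sub]
      filter_upwards [he n, hd, AEEqFun.coeFn_sub (e n).toFn d.toFn] with x h1 h2 h3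
      rw [h3, Pi.sub_apply, h1, h2]
      by_cases hx : x ∈ beyond ε <;> simp [hx]
    have h1 : Tendsto (fun n => L (X.hardyCLM (e n))) atTop (𝓝 (L (X.hardyCLM d))) :=
      ((L.continuous.comp X.hardyCLM.continuous).tendsto d).comp hed
    have h2 := (hdom.tendsto_integral_upper hε hui hfi hL1).sub
      (hdom.neg.tendsto_integral_upper hε hui hfi hL1)
    refine tendsto_nhds_unique h1 (h2.congr fun n => ?_)
    exact (hu n (e n) (he n)).symm
  · intro f g hfg hfi hPf d hd
    have hac : ∀ {ν : RingMeasure ℝ}, ν.IsDominated → f =ᵐ[ν.upper.restrict (beyond ε)] g := by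
      intro ν hν
      obtain ⟨K, hK, hle⟩ := hν.exists_restrict_upper_le hε
      exact (Measure.absolutelyContinuous_of_le_smul hle).ae_le hfg
    have h1 := hPf d (hd.trans ((ae_eq_restrict_iff_indicator_ae_eq hb).mp hfg).symm)
    rw [h1, integral_congr_ae (hac hdom)]
    congr 1
    exact integral_congr_ae (hac hdom.neg)

end BFIL

/-! ### Variations of the scalar measures, the weak norm and weakly integrable functions -/

theorem RingMeasure.IsDominated.variation_absolutelyContinuous {μ : RingMeasure ℝ}
    (h : μ.IsDominated) : μ.variation ≪ (volume : Measure RPos) :=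
  Measure.AbsolutelyContinuous.add_left h.upper_absolutelyContinuous
    h.neg.upper_absolutelyContinuous

theorem RingMeasure.upper_le_variation (μ : RingMeasure ℝ) : μ.upper ≤ μ.variation :=
  Measure.le_add_right le_rfl

theorem RingMeasure.lower_le_variation (μ : RingMeasure ℝ) : μ.lower ≤ μ.variation :=
  Measure.le_add_left le_rfl

/-- A real function of finite norm, as an element of `[S, X]`. -/
theorem BFIL.exists_domainElem {X : BFIL} {g : RPos → ℝ} (hg : Measurable g)
    (h : X.hardyNorm (fun x => ‖g x‖ₑ) < ∞) :
    ∃ d : X.domain.Elem, d.toFn =ᵐ[volume] g := by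
  let f : L0 := AEEqFun.mk g hg.aestronglyMeasurable
  have hf : f =ᵐ[volume] g := AEEqFun.coeFn_mk _ _
  refine ⟨mkElem f ((mem_domain_iff f).mpr ?_), hf⟩
  rwa [X.isBFIL.isFnNorm_hardyNorm.congr (by filter_upwards [hf] with x hx; rw [eabs, hx])]

theorem BFIL.enorm_domainElem {X : BFIL} {F : RPos → ℝ≥0∞} {d : X.domain.Elem}
    (h : eabs d.toFn =ᵐ[volume] F) : ‖d‖ₑ = X.hardyNorm F := by
  rw [Elem.enorm_domain_eq, X.isBFIL.isFnNorm_hardyNorm.congr h]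

theorem eq_zero_of_le_bump {g : RPos → ℝ} {n : ℕ} (hle : ∀ x, ‖g x‖ₑ ≤ bump n x) {x : RPos}
    (hx : x ∉ beyond (1 / ((n : ℝ) + 1))) : g x = 0 := by
  have h := hle x
  rw [bump_of_le (not_lt.mp hx)] at h
  simpa using h

theorem integrable_of_le_bump {g : RPos → ℝ} (hg : Measurable g) {n : ℕ}
    (hle : ∀ x, ‖g x‖ₑ ≤ bump n x) : Integrable g :=
  ⟨hg.aestronglyMeasurable, (lintegral_mono hle).trans_lt (lintegral_bump_ne_top n).lt_top⟩

theorem RingMeasure.IsDominated.integrable_upper_of_le_bump {μ : RingMeasure ℝ}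
    (h : μ.IsDominated) {g : RPos → ℝ} (hg : Measurable g) {n : ℕ}
    (hle : ∀ x, ‖g x‖ₑ ≤ bump n x) : Integrable g μ.upper := by
  refine (integrableOn_iff_integrable_of_support_subset fun x hx => ?_).mp
    (h.integrable_upper (ε := 1 / ((n : ℝ) + 1)) (by positivity)
      (integrable_of_le_bump hg hle).restrict)
  by_contra hn
  exact hx (eq_zero_of_le_bump hle hn)

namespace BFIL

variable {X : BFIL}

theorem apply_hardyCLM_eq_integral (hΘ : ContainsTheta X) (L : StrongDual ℝ X.Elem)
    {g : RPos → ℝ} (hg : Measurable g) {n : ℕ} (hle : ∀ x, ‖g x‖ₑ ≤ bump n x)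
    {d : X.domain.Elem} (hd : d.toFn =ᵐ[volume] g) :
    L (X.hardyCLM d) = (∫ x, g x ∂((hardyMeasure hΘ).comp L).upper) -
      ∫ x, g x ∂((hardyMeasure hΘ).comp L).lower := by
  have h0 : ∀ x, x ∉ beyond (1 / ((n : ℝ) + 1)) → g x = 0 := fun x => eq_zero_of_le_bump hle
  rw [apply_hardyCLM_eq_setIntegral hΘ L (ε := 1 / ((n : ℝ) + 1)) (by positivity)
    (integrable_of_le_bump hg hle).restrict d,
    setIntegral_eq_integral_of_forall_compl_eq_zero h0,
    setIntegral_eq_integral_of_forall_compl_eq_zero h0]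
  refine hd.trans (.of_forall fun x => ?_)
  by_cases hx : x ∈ beyond (1 / ((n : ℝ) + 1))
  · rw [Set.indicator_of_mem hx]
  · rw [Set.indicator_of_notMem hx, h0 x hx]

theorem enorm_toReal_of_le_bump {H : RPos → ℝ≥0∞} {n : ℕ} (hle : ∀ x, H x ≤ bump n x) (x : RPos) :
    ‖(H x).toReal‖ₑ = H x := by
  rw [Real.enorm_of_nonneg ENNReal.toReal_nonneg,
    ENNReal.ofReal_toReal ((hle x).trans_lt (bump_lt_top n x)).ne]

theorem ofReal_integral_toReal {H : RPos → ℝ≥0∞} {n : ℕ} (hle : ∀ x, H x ≤ bump n x)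
    {m : Measure RPos} (hi : Integrable (fun x => (H x).toReal) m) :
    ENNReal.ofReal (∫ x, (H x).toReal ∂m) = ∫⁻ x, H x ∂m := by
  rw [ofReal_integral_eq_lintegral_ofReal hi (.of_forall fun x => ENNReal.toReal_nonneg)]
  exact lintegral_congr fun x =>
    ENNReal.ofReal_toReal ((hle x).trans_lt (bump_lt_top n x)).ne

/-- Changing the sign of H off a Hahn set P gives g with |g| = H and ∫ H d|x*ν| = x*(Sg). The bound
then uses only |Sg| ≤ SH. -/
theorem lintegral_variation_le_of_le_bump (hΘ : ContainsTheta X) (L : StrongDual ℝ X.Elem)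
    {H : RPos → ℝ≥0∞} (hH : Measurable H) {n : ℕ} (hle : ∀ x, H x ≤ bump n x) :
    ∫⁻ x, H x ∂((hardyMeasure hΘ).comp L).variation ≤ ‖L‖ₑ * X.hardyNorm H := by
  set μ := (hardyMeasure hΘ).comp L with hμ
  have hdom : μ.IsDominated := isDominated_comp hΘ L
  set A := ioc (1 / ((n : ℝ) + 1)) n with hA
  have hv : volume A < ∞ := by
    rw [hA, ioc, volume_Ioc_coe (by positivity)]; exact ENNReal.ofReal_lt_top
  obtain ⟨P, hP, hl0, hu0⟩ := hdom.exists_hahn (ε := 1 / ((n : ℝ) + 1)) (by positivity)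
    (measurableSet_ioc _ _) hv fun x hx => hx.1
  have hH0 : ∀ x, x ∉ A → H x = 0 := fun x hx => by
    have := hle x
    rw [bump, ind_of_notMem hx, mul_zero] at this
    exact nonpos_iff_eq_zero.mp this
  let h : RPos → ℝ := fun x => (H x).toReal
  have hm : Measurable h := hH.ennreal_toReal
  have hhe : ∀ x, ‖h x‖ₑ = H x := enorm_toReal_of_le_bump hle
  classical
  let g : RPos → ℝ := P.piecewise h (-h)
  have hg : Measurable g := Measurable.piecewise hP hm hm.neg
  have hge : ∀ x, ‖g x‖ₑ = H x := fun x => by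
    by_cases hx : x ∈ P <;> simp [g, hx, hhe]
  have hgle : ∀ x, ‖g x‖ₑ ≤ bump n x := fun x => (hge x).trans_le (hle x)
  have hhle : ∀ x, ‖h x‖ₑ ≤ bump n x := fun x => (hhe x).trans_le (hle x)
  obtain ⟨d, hd⟩ := exists_domainElem (X := X) hg
    (hardyNorm_lt_top_of_le_bump hΘ (.of_forall hgle))
  have hdn : ‖d‖ₑ = X.hardyNorm H := enorm_domainElem <| by
    filter_upwards [hd] with x hx
    rw [eabs, hx, hge]
  have hgu : g =ᵐ[μ.upper] h := by
    filter_upwards [measure_eq_zero_iff_ae_notMem.mp hu0] with x hx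
    by_cases hxP : x ∈ P
    · simp [g, hxP]
    · have : H x = 0 := hH0 x fun hxA => hx ⟨hxA, hxP⟩
      simp [g, hxP, h, this]
  have hgl : g =ᵐ[μ.lower] fun x => -h x := by
    filter_upwards [measure_eq_zero_iff_ae_notMem.mp hl0] with x hx
    by_cases hxP : x ∈ P
    · have : H x = 0 := hH0 x fun hxA => hx ⟨hxA, hxP⟩
      simp [g, hxP, h, this]
    · simp [g, hxP]
  have key := apply_hardyCLM_eq_integral hΘ L hg hgle hd
  rw [← hμ, integral_congr_ae hgu, integral_congr_ae hgl, integral_neg, sub_neg_eq_add] at key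
  have hiu := hdom.integrable_upper_of_le_bump hm hhle
  have hil : Integrable h μ.lower := hdom.neg.integrable_upper_of_le_bump hm hhle
  calc ∫⁻ x, H x ∂μ.variation = ENNReal.ofReal (L (X.hardyCLM d)) := by
        rw [RingMeasure.variation, lintegral_add_measure, key,
          ENNReal.ofReal_add (integral_nonneg fun _ => ENNReal.toReal_nonneg)
            (integral_nonneg fun _ => ENNReal.toReal_nonneg),
          ofReal_integral_toReal hle hiu, ofReal_integral_toReal hle hil]
    _ ≤ ‖L (X.hardyCLM d)‖ₑ := RingMeasure.ofReal_le_enorm _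
    _ ≤ ‖L‖ₑ * ‖X.hardyCLM d‖ₑ := L.le_opENorm _
    _ ≤ ‖L‖ₑ * X.hardyNorm H := by
        rw [← hdn]; gcongr; exact X.enorm_hardyCLM_le d

theorem lintegral_eq_iSup_min_bump {F : RPos → ℝ≥0∞} (hF : Measurable F) (m : Measure RPos) :
    ∫⁻ x, F x ∂m = ⨆ n, ∫⁻ x, min (F x) (bump n x) ∂m := by
  rw [← lintegral_iSup (fun n => measurable_min_bump hF n)
    (fun i j hij x => min_bump_mono F x hij)]
  refine lintegral_congr fun x => ?_
  exact (iSup_eq_of_tendsto (min_bump_mono F x) (tendsto_min_bump F x)).symm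

theorem lintegral_variation_le (hΘ : ContainsTheta X) (L : StrongDual ℝ X.Elem)
    {F : RPos → ℝ≥0∞} (hF : Measurable F) :
    ∫⁻ x, F x ∂((hardyMeasure hΘ).comp L).variation ≤
      ‖L‖ₑ * ⨆ n, X.hardyNorm fun x => min (F x) (bump n x) := by
  rw [lintegral_eq_iSup_min_bump hF]
  refine iSup_le fun n => (lintegral_variation_le_of_le_bump hΘ L (measurable_min_bump hF n)
    fun _ => min_le_right _ _).trans ?_
  gcongr
  exact le_iSup (fun n => X.hardyNorm fun x => min (F x) (bump n x)) n

/-- The function norm `F ↦ sup {∫ F d|x* ν| : ‖x*‖ ≤ 1}`. -/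
def weakNorm (hΘ : ContainsTheta X) (F : RPos → ℝ≥0∞) : ℝ≥0∞ :=
  ⨆ (L : StrongDual ℝ X.Elem) (_ : ‖L‖ ≤ 1), ∫⁻ x, F x ∂((hardyMeasure hΘ).comp L).variation

theorem le_weakNorm (hΘ : ContainsTheta X) {L : StrongDual ℝ X.Elem} (hL : ‖L‖ ≤ 1)
    (F : RPos → ℝ≥0∞) :
    ∫⁻ x, F x ∂((hardyMeasure hΘ).comp L).variation ≤ weakNorm hΘ F :=
  le_iSup₂_of_le L hL le_rfl

theorem weakNorm_mono (hΘ : ContainsTheta X) {F G : RPos → ℝ≥0∞} (h : F ≤ᵐ[volume] G) :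
    weakNorm hΘ F ≤ weakNorm hΘ G :=
  iSup₂_le fun L hL => (lintegral_mono_ae
    ((isDominated_comp hΘ L).variation_absolutelyContinuous.ae_le h)).trans (le_weakNorm hΘ hL G)

/-- Choose a functional norming SH. Its value there is ∫ H dμ⁺ - ∫ H dμ⁻ ≤ ∫ H d|μ|, where μ = x*ν.
-/
theorem hardyNorm_le_weakNorm_of_le_bump (hΘ : ContainsTheta X) {H : RPos → ℝ≥0∞}
    (hH : Measurable H) {n : ℕ} (hle : ∀ x, H x ≤ bump n x) : X.hardyNorm H ≤ weakNorm hΘ H := by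
  have hhe := enorm_toReal_of_le_bump hle
  have hhle : ∀ x, ‖(H x).toReal‖ₑ ≤ bump n x := fun x => (hhe x).trans_le (hle x)
  obtain ⟨d, hd⟩ := exists_domainElem (X := X) hH.ennreal_toReal
    (hardyNorm_lt_top_of_le_bump hΘ (.of_forall hhle))
  have hdn : ‖d‖ₑ = X.hardyNorm H := enorm_domainElem <| by
    filter_upwards [hd] with x hx
    rw [eabs, hx, hhe]
  have hd0 : 0 ≤ d.toFn := by
    rw [← AEEqFun.coeFn_le]
    filter_upwards [hd, AEEqFun.coeFn_zero (α := RPos) (β := ℝ) (μ := volume)] with x h1 h2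
    rw [h1, h2]; exact ENNReal.toReal_nonneg
  obtain ⟨L, hL, hLd⟩ := exists_dual_vector'' ℝ (X.hardyCLM d)
  have hdom := isDominated_comp hΘ L
  have key := apply_hardyCLM_eq_integral hΘ L hH.ennreal_toReal hhle hd
  have hl : 0 ≤ ∫ x, (H x).toReal ∂((hardyMeasure hΘ).comp L).lower :=
    integral_nonneg fun _ => ENNReal.toReal_nonneg
  calc X.hardyNorm H = ‖X.hardyCLM d‖ₑ := by rw [X.enorm_hardyCLM_of_nonneg hd0, hdn]
    _ = ENNReal.ofReal (L (X.hardyCLM d)) := by rw [hLd, ← ofReal_norm]; rfl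
    _ ≤ ENNReal.ofReal (∫ x, (H x).toReal ∂((hardyMeasure hΘ).comp L).upper) :=
        ENNReal.ofReal_le_ofReal (by linarith)
    _ = ∫⁻ x, H x ∂((hardyMeasure hΘ).comp L).upper :=
        ofReal_integral_toReal hle (hdom.integrable_upper_of_le_bump hH.ennreal_toReal hhle)
    _ ≤ ∫⁻ x, H x ∂((hardyMeasure hΘ).comp L).variation :=
        lintegral_mono' (RingMeasure.upper_le_variation _) le_rfl
    _ ≤ weakNorm hΘ H := le_weakNorm hΘ hL H

theorem hardyNorm_min_bump_le (hΘ : ContainsTheta X) {F : RPos → ℝ≥0∞} (hF : Measurable F)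
    (n : ℕ) : X.hardyNorm (fun x => min (F x) (bump n x)) ≤ weakNorm hΘ F :=
  (hardyNorm_le_weakNorm_of_le_bump hΘ (measurable_min_bump hF n) fun _ => min_le_right _ _).trans
    (weakNorm_mono hΘ (.of_forall fun _ => min_le_left _ _))

/-- The weak norm is thereby expressed through [S, X] alone: it is ‖S·‖ on truncations, extended by
monotone limits. This is the source of its Fatou property and its minimality. -/
theorem weakNorm_eq_iSup (hΘ : ContainsTheta X) {F : RPos → ℝ≥0∞} (hF : Measurable F) :
    weakNorm hΘ F = ⨆ n, X.hardyNorm fun x => min (F x) (bump n x) := by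
  refine le_antisymm (iSup₂_le fun L hL => ?_) (iSup_le fun n => hardyNorm_min_bump_le hΘ hF n)
  refine (lintegral_variation_le hΘ L hF).trans (mul_le_of_le_one_left' ?_)
  rw [← ofReal_norm]
  exact ENNReal.ofReal_le_one.mpr hL

theorem weakNorm_le_hardyNorm (hΘ : ContainsTheta X) {F : RPos → ℝ≥0∞} (hF : Measurable F) :
    weakNorm hΘ F ≤ X.hardyNorm F := by
  rw [weakNorm_eq_iSup hΘ hF]
  exact iSup_le fun n => X.isBFIL.isFnNorm_hardyNorm.mono (.of_forall fun _ => min_le_left _ _)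

theorem isFnNorm_weakNorm (hΘ : ContainsTheta X) : IsFnNorm (weakNorm hΘ) where
  mono h := weakNorm_mono hΘ h
  const_mul {c} F hc := by
    simp only [weakNorm, ENNReal.mul_iSup]
    refine iSup_congr fun L => iSup_congr fun _ => ?_
    rw [lintegral_const_mul' _ _ hc]
  tsum_le u hu := iSup₂_le fun L hL => by
    rw [lintegral_tsum fun n => (hu n).aemeasurable]
    exact ENNReal.tsum_le_tsum fun n => le_weakNorm hΘ hL (u n)
  eq_zero {F} hF h0 := by
    have h1 : ∀ n, (fun x => min (F x) (bump n x)) =ᵐ[volume] 0 := fun n =>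
      X.isBFIL.isFnNorm_hardyNorm.eq_zero (measurable_min_bump hF n)
        (le_antisymm ((hardyNorm_min_bump_le hΘ hF n).trans h0.le) zero_le)
    filter_upwards [ae_all_iff.mpr h1] with x hx
    have h2 := tendsto_min_bump F x
    simp only [hx, Pi.zero_apply] at h2
    exact tendsto_nhds_unique h2 tendsto_const_nhds |>.trans rfl

theorem abs_apply_le_toReal_lintegral (hΘ : ContainsTheta X) (L : StrongDual ℝ X.Elem)
    {H F : RPos → ℝ≥0∞} (hH : Measurable H) {n : ℕ} (hle : ∀ x, H x ≤ bump n x)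
    (hHF : ∀ x, H x ≤ F x) (hF : ∫⁻ x, F x ∂((hardyMeasure hΘ).comp L).variation ≠ ∞)
    {d : X.domain.Elem} (hd : d.toFn =ᵐ[volume] fun x => (H x).toReal) :
    |L (X.hardyCLM d)| ≤ (∫⁻ x, F x ∂((hardyMeasure hΘ).comp L).variation).toReal := by
  set μ := (hardyMeasure hΘ).comp L with hμ
  have hdom : μ.IsDominated := isDominated_comp hΘ L
  have hhle : ∀ x, ‖(H x).toReal‖ₑ ≤ bump n x := fun x =>
    (enorm_toReal_of_le_bump hle x).trans_le (hle x)
  have hm := hH.ennreal_toReal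
  have hu0 : 0 ≤ ∫ x, (H x).toReal ∂μ.upper := integral_nonneg fun _ => ENNReal.toReal_nonneg
  have hl0 : 0 ≤ ∫ x, (H x).toReal ∂μ.lower := integral_nonneg fun _ => ENNReal.toReal_nonneg
  have h1 : ENNReal.ofReal (∫ x, (H x).toReal ∂μ.upper + ∫ x, (H x).toReal ∂μ.lower) ≤
      ∫⁻ x, F x ∂μ.variation := by
    rw [ENNReal.ofReal_add hu0 hl0,
      ofReal_integral_toReal hle (hdom.integrable_upper_of_le_bump hm hhle),
      ofReal_integral_toReal hle (m := μ.lower) (hdom.neg.integrable_upper_of_le_bump hm hhle),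
      ← lintegral_add_measure]
    exact lintegral_mono hHF
  have h2 := (ENNReal.ofReal_le_iff_le_toReal hF).mp h1
  rw [apply_hardyCLM_eq_integral hΘ L hm hhle hd, ← hμ, abs_le]
  constructor <;> linarith

theorem exists_truncation (hΘ : ContainsTheta X) {F : RPos → ℝ≥0∞} (hF : Measurable F) (n : ℕ) :
    ∃ d : X.domain.Elem, (d.toFn =ᵐ[volume] fun x => (min (F x) (bump n x)).toReal) ∧
      0 ≤ d.toFn ∧ eabs d.toFn =ᵐ[volume] fun x => min (F x) (bump n x) := by
  have hle : ∀ x, min (F x) (bump n x) ≤ bump n x := fun _ => min_le_right _ _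
  have hhe := enorm_toReal_of_le_bump hle
  obtain ⟨d, hd⟩ := exists_domainElem (X := X) (measurable_min_bump hF n).ennreal_toReal
    (hardyNorm_lt_top_of_le_bump hΘ (.of_forall fun x => (hhe x).trans_le (hle x)))
  refine ⟨d, hd, ?_, ?_⟩
  · rw [← AEEqFun.coeFn_le]
    filter_upwards [hd, AEEqFun.coeFn_zero (α := RPos) (β := ℝ) (μ := volume)] with x h1 h2
    rw [h1, h2]; exact ENNReal.toReal_nonneg
  · filter_upwards [hd] with x hx
    rw [eabs, hx, hhe]

/-- Membership only gives finiteness functional by functional. For each x*, |x*(S(|f| ∧ b_n))| ≤ ∫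
|f| d|x*ν| uniformly in n, so Banach–Steinhaus in the bidual bounds the norms of S(|f| ∧ b_n), and
their supremum is the weak norm. -/
theorem hasFnNorm_weakL1 (hΘ : ContainsTheta X) :
    (weakL1 (hardyMeasure hΘ)).HasFnNorm (weakNorm hΘ) := by
  refine ⟨fun f => ⟨fun hf => ?_, fun h L => ?_⟩, fun f _ => rfl⟩
  · choose d hd hd0 hde using exists_truncation hΘ (measurable_eabs f)
    have hbs : ∀ L : StrongDual ℝ X.Elem, ∃ C, ∀ n,
        ‖NormedSpace.inclusionInDoubleDual ℝ X.Elem (X.hardyCLM (d n)) L‖ ≤ C := fun L =>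
      ⟨_, fun n => abs_apply_le_toReal_lintegral hΘ L (measurable_min_bump (measurable_eabs f) n)
        (fun _ => min_le_right _ _) (fun _ => min_le_left _ _) (hf L).2.ne (hd n)⟩
    obtain ⟨C, hC⟩ := banach_steinhaus hbs
    rw [weakNorm_eq_iSup hΘ (measurable_eabs f)]
    refine (iSup_le fun n => ?_).trans_lt (ENNReal.ofReal_lt_top (r := C))
    rw [← enorm_domainElem (hde n), ← X.enorm_hardyCLM_of_nonneg (hd0 n), ← ofReal_norm]
    refine ENNReal.ofReal_le_ofReal ?_
    rw [← (NormedSpace.inclusionInDoubleDualLi ℝ (E := X.Elem)).norm_map]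
    exact hC n
  · refine ⟨f.stronglyMeasurable.aestronglyMeasurable, ?_⟩
    refine (lintegral_variation_le hΘ L (measurable_eabs f)).trans_lt ?_
    rw [← weakNorm_eq_iSup hΘ (measurable_eabs f)]
    exact ENNReal.mul_lt_top (by simp) h

/-- A supremum of integrals commutes with increasing limits, by monotone convergence for each |x*ν|.
-/
theorem tendsto_weakNorm (hΘ : ContainsTheta X) {u : ℕ → RPos → ℝ≥0∞} {F : RPos → ℝ≥0∞}
    (hu : ∀ n, Measurable (u n)) (hmono : ∀ᵐ x, Monotone fun n => u n x)
    (hlim : ∀ᵐ x, Tendsto (fun n => u n x) atTop (𝓝 (F x))) :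
    Tendsto (fun n => weakNorm hΘ (u n)) atTop (𝓝 (weakNorm hΘ F)) := by
  have hm : Monotone fun n => weakNorm hΘ (u n) := fun i j hij => weakNorm_mono hΘ (by
    filter_upwards [hmono] with x hx using hx hij)
  have hle : ∀ n, weakNorm hΘ (u n) ≤ weakNorm hΘ F := fun n => weakNorm_mono hΘ (by
    filter_upwards [hmono, hlim] with x h1 h2 using h1.ge_of_tendsto h2 n)
  have e : weakNorm hΘ F = ⨆ n, weakNorm hΘ (u n) := by
    refine le_antisymm (iSup₂_le fun L hL => ?_) (iSup_le hle)
    have hac := (isDominated_comp hΘ L).variation_absolutelyContinuous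
    exact le_of_tendsto' (lintegral_tendsto_of_tendsto_of_monotone
      (fun n => (hu n).aemeasurable) (hac.ae_le hmono) (hac.ae_le hlim))
      fun n => (le_weakNorm hΘ hL (u n)).trans (le_iSup (fun n => weakNorm hΘ (u n)) n)
  rw [e]
  exact tendsto_atTop_iSup hm

theorem fatou_weakL1 (hΘ : ContainsTheta X) : (weakL1 (hardyMeasure hΘ)).Fatou := by
  intro u f hu hu0 hmono hlim hb
  have hY := hasFnNorm_weakL1 hΘ
  have hu0' : ∀ᵐ x, ∀ n, 0 ≤ u n x := by
    filter_upwards [ae_all_iff.mpr fun n => AEEqFun.coeFn_le.mpr (hu0 n),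
      AEEqFun.coeFn_zero (α := RPos) (β := ℝ) (μ := volume)] with x h1 h2 n
    simpa [h2] using h1 n
  have hmono' : ∀ᵐ x, ∀ n, u n x ≤ u (n + 1) x :=
    ae_all_iff.mpr fun n => AEEqFun.coeFn_le.mpr (hmono n.le_succ)
  have ht := tendsto_weakNorm hΘ (u := fun n => eabs (u n)) (F := eabs f)
    (fun n => measurable_eabs _)
    (by
      filter_upwards [hu0', hmono'] with x h1 h2
      refine monotone_nat_of_le_succ fun n => ?_
      rw [eabs, eabs, Real.enorm_of_nonneg (h1 n), Real.enorm_of_nonneg (h1 (n + 1))]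
      exact ENNReal.ofReal_le_ofReal (h2 n))
    (by filter_upwards [hlim] with x hx using hx.enorm)
  obtain ⟨C, hC⟩ := hb
  have hle : weakNorm hΘ (eabs f) ≤ ENNReal.ofReal C := le_of_tendsto' ht fun n => by
    rw [← hY.ofReal_norm (hu n)]
    exact ENNReal.ofReal_le_ofReal (hC ⟨n, rfl⟩)
  have hlt := hle.trans_lt ENNReal.ofReal_lt_top
  exact ⟨(hY.mem_iff f).mpr hlt, (ENNReal.tendsto_toReal hlt.ne).comp ht⟩

end BFIL

namespace BFIL

variable {X : BFIL}

/-! ### Weakly convergent increasing sequences -/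

/-- Mazur's theorem: a closed convex set is weakly closed, by Hahn–Banach separation. -/
theorem exists_convexHull_norm_sub_lt {E : Type*} [NormedAddCommGroup E] [NormedSpace ℝ E]
    {u : ℕ → E} {v : E} (h : ∀ L : StrongDual ℝ E, Tendsto (fun n => L (u n)) atTop (𝓝 (L v)))
    {ε : ℝ} (hε : 0 < ε) : ∃ w ∈ convexHull ℝ (Set.range u), ‖w - v‖ < ε := by
  have hv : v ∈ closure (convexHull ℝ (Set.range u)) := by
    by_contra hv
    obtain ⟨L, s, hs, hsv⟩ := geometric_hahn_banach_closed_point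
      (convex_convexHull ℝ (Set.range u)).closure isClosed_closure hv
    refine absurd (le_of_tendsto' (h L) fun n => ?_) (not_le.mpr hsv)
    exact (hs _ (subset_closure (subset_convexHull ℝ _ ⟨n, rfl⟩))).le
  obtain ⟨w, hw, hlt⟩ := Metric.mem_closure_iff.mp hv ε hε
  exact ⟨w, hw, by rwa [dist_comm, dist_eq_norm] at hlt⟩

theorem convex_combination_le {f g h : L0} (hf : f ≤ h) (hg : g ≤ h) {a b : ℝ} (ha : 0 ≤ a)
    (hb : 0 ≤ b) (hab : a + b = 1) : a • f + b • g ≤ h := by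
  rw [← AEEqFun.coeFn_le] at *
  filter_upwards [hf, hg, AEEqFun.coeFn_add (a • f) (b • g), AEEqFun.coeFn_smul a f,
    AEEqFun.coeFn_smul b g] with x h1 h2 h3 h4 h5
  rw [h3, Pi.add_apply, h4, h5, Pi.smul_apply, Pi.smul_apply, smul_eq_mul, smul_eq_mul]
  have : b = 1 - a := by linarith
  subst this
  nlinarith

theorem le_convex_combination {f g h : L0} (hf : h ≤ f) (hg : h ≤ g) {a b : ℝ} (ha : 0 ≤ a)
    (hb : 0 ≤ b) (hab : a + b = 1) : h ≤ a • f + b • g := by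
  rw [← AEEqFun.coeFn_le] at *
  filter_upwards [hf, hg, AEEqFun.coeFn_add (a • f) (b • g), AEEqFun.coeFn_smul a f,
    AEEqFun.coeFn_smul b g] with x h1 h2 h3 h4 h5
  rw [h3, Pi.add_apply, h4, h5, Pi.smul_apply, Pi.smul_apply, smul_eq_mul, smul_eq_mul]
  have : b = 1 - a := by linarith
  subst this
  nlinarith

theorem Elem.norm_sub_le_of_between {w w' z v : X.Elem} (h : w.toFn ≤ z.toFn)
    (h' : z.toFn ≤ w'.toFn) : ‖z - v‖ ≤ ‖w - v‖ + ‖w' - v‖ := by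
  have key : ‖z - v‖ₑ ≤ ‖w - v‖ₑ + ‖w' - v‖ₑ := by
    rw [Elem.enorm_eq, Elem.enorm_eq, Elem.enorm_eq]
    refine (X.isBFIL.isFnNorm.mono ?_).trans
      (X.isBFIL.isFnNorm.add_le (measurable_eabs _) (measurable_eabs _))
    rw [Elem.toFn_sub, Elem.toFn_sub, Elem.toFn_sub]
    filter_upwards [AEEqFun.coeFn_le.mpr h, AEEqFun.coeFn_le.mpr h',
      AEEqFun.coeFn_sub z.toFn v.toFn, AEEqFun.coeFn_sub w.toFn v.toFn,
      AEEqFun.coeFn_sub w'.toFn v.toFn] with x h1 h2 h3 h4 h5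
    simp only [eabs, h3, h4, h5, Pi.sub_apply, Real.enorm_eq_ofReal_abs]
    rw [← ENNReal.ofReal_add (abs_nonneg _) (abs_nonneg _)]
    apply ENNReal.ofReal_le_ofReal
    rw [abs_le]
    constructor <;> cases abs_cases (w.toFn x - v.toFn x) <;>
      cases abs_cases (w'.toFn x - v.toFn x) <;> linarith
  rw [← ofReal_norm, ← ofReal_norm, ← ofReal_norm,
    ← ENNReal.ofReal_add (norm_nonneg _) (norm_nonneg _)] at key
  exact (ENNReal.ofReal_le_ofReal_iff (by positivity)).mp key

/-- In a Banach lattice, increasing weakly convergent sequences converge in norm. -/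
theorem tendsto_of_monotone_of_weak {u : ℕ → X.Elem} {v : X.Elem}
    (hmono : Monotone fun n => (u n).toFn)
    (h : ∀ L : StrongDual ℝ X.Elem, Tendsto (fun n => L (u n)) atTop (𝓝 (L v))) :
    Tendsto u atTop (𝓝 v) := by
  rw [Metric.tendsto_atTop]
  intro ε hε
  -- A convex combination near v lies below some u K, since finitely many terms of an increasing
  -- sequence have a largest one.
  obtain ⟨w, hw, hwv⟩ := exists_convexHull_norm_sub_lt h (half_pos hε)
  obtain ⟨K, hK⟩ : ∃ K, w.toFn ≤ (u K).toFn := by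
    have hc : Convex ℝ {w : X.Elem | ∃ K, w.toFn ≤ (u K).toFn} := by
      rintro f ⟨i, hi⟩ g ⟨j, hj⟩ a b ha hb hab
      exact ⟨max i j, convex_combination_le (hi.trans (hmono (le_max_left i j)))
        (hj.trans (hmono (le_max_right i j))) ha hb hab⟩
    exact convexHull_min (by rintro _ ⟨n, rfl⟩; exact ⟨n, le_rfl⟩) hc hw
  refine ⟨K, fun n hn => ?_⟩
  -- A combination of the terms from index n on lies above u n. So u n is squeezed between two
  -- elements within ε / 2 of v.
  obtain ⟨w', hw', hwv'⟩ := exists_convexHull_norm_sub_lt (u := fun k => u (k + n))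
    (fun L => (h L).comp (tendsto_add_atTop_nat n)) (half_pos hε)
  have hnw : (u n).toFn ≤ w'.toFn := by
    have hc : Convex ℝ {w : X.Elem | (u n).toFn ≤ w.toFn} := fun f hf g hg a b ha hb hab =>
      le_convex_combination hf hg ha hb hab
    exact convexHull_min (by rintro _ ⟨k, rfl⟩; exact hmono (Nat.le_add_left n k)) hc hw'
  rw [dist_eq_norm]
  linarith [Elem.norm_sub_le_of_between (v := v) (hK.trans (hmono hn)) hnw]

/-! ### The integrable functions -/

/-- By subadditivity ‖SF‖ is at most ‖S(F ∧ b_n)‖ plus the norm of the tail. The first term is at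
most the weak norm and the second tends to 0. -/
theorem weakNorm_eq_hardyNorm (hΘ : ContainsTheta X) {F : RPos → ℝ≥0∞} (hF : Measurable F)
    (h : DominatesConvergence X.hardyNorm F) (hfin : ∀ᵐ x, F x < ∞) :
    weakNorm hΘ F = X.hardyNorm F := by
  refine le_antisymm (weakNorm_le_hardyNorm hΘ hF) ?_
  have ht := (tendsto_const_nhds (x := weakNorm hΘ F)).add (h.tendsto_tail hF hfin)
  rw [add_zero] at ht
  refine ge_of_tendsto' ht fun n => ?_
  refine le_trans ?_ (add_le_add_left (hardyNorm_min_bump_le hΘ hF n) _)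
  refine (X.isBFIL.isFnNorm_hardyNorm.mono (.of_forall fun x => ?_)).trans
    (X.isBFIL.isFnNorm_hardyNorm.add_le (measurable_min_bump hF n)
      (hF.sub (measurable_min_bump hF n)))
  exact (add_tsub_cancel_of_le (min_le_left _ _)).ge

/-- The truncation of a real function to values in `[-bump n, bump n]`. -/
def clamp (f : RPos → ℝ) (n : ℕ) (x : RPos) : ℝ :=
  max (-(bump n x).toReal) (min (f x) (bump n x).toReal)

theorem measurable_clamp {f : RPos → ℝ} (hf : Measurable f) (n : ℕ) : Measurable (clamp f n) :=
  (measurable_bump n).ennreal_toReal.neg.max (hf.min (measurable_bump n).ennreal_toReal)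

theorem abs_clamp (f : RPos → ℝ) (n : ℕ) (x : RPos) :
    |clamp f n x| = min |f x| (bump n x).toReal ∧
      |f x - clamp f n x| = |f x| - min |f x| (bump n x).toReal := by
  have hb : 0 ≤ (bump n x).toReal := ENNReal.toReal_nonneg
  rw [clamp]
  generalize (bump n x).toReal = b at *
  generalize f x = y
  rcases le_total y b with h1 | h1 <;> rcases le_total (-b) y with h2 | h2 <;>
    rcases abs_cases y with ⟨h3, h4⟩ | ⟨h3, h4⟩ <;> rw [h3]
  · rw [min_eq_left h1, max_eq_right h2, h3]; simp
  · rw [min_eq_left h1, max_eq_right h2, h3, min_eq_left (by linarith)]; simp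
  · rw [min_eq_left h1, max_eq_left h2, abs_neg, abs_of_nonneg hb,
      abs_of_nonneg (by linarith)]
    constructor <;> linarith
  · rw [min_eq_left h1, max_eq_left h2, min_eq_right (by linarith), abs_neg, abs_of_nonneg hb,
      abs_of_nonpos (by linarith)]
    constructor <;> linarith
  · rw [min_eq_right h1, max_eq_right (by linarith), abs_of_nonneg hb, abs_of_nonneg (by linarith)]
    simp
  · linarith
  · rw [min_eq_right h1, max_eq_right (by linarith), abs_of_nonneg hb, abs_of_nonneg (by linarith)]
    simp
  · rw [min_eq_right h1, max_eq_right (by linarith), abs_of_nonneg hb, min_eq_right (by linarith),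
      abs_of_nonpos (by linarith)]
    constructor <;> linarith

theorem ofReal_min_bump (r : ℝ) (n : ℕ) (x : RPos) :
    ENNReal.ofReal (min r (bump n x).toReal) = min (ENNReal.ofReal r) (bump n x) := by
  rw [ENNReal.ofReal_min, ENNReal.ofReal_toReal (bump_lt_top n x).ne]

theorem enorm_clamp (f : RPos → ℝ) (n : ℕ) (x : RPos) :
    ‖clamp f n x‖ₑ = min ‖f x‖ₑ (bump n x) := by
  rw [Real.enorm_eq_ofReal_abs, (abs_clamp f n x).1, ofReal_min_bump, ← Real.enorm_eq_ofReal_abs]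

theorem enorm_sub_clamp (f : RPos → ℝ) (n : ℕ) (x : RPos) :
    ‖f x - clamp f n x‖ₑ = ‖f x‖ₑ - min ‖f x‖ₑ (bump n x) := by
  rw [Real.enorm_eq_ofReal_abs, (abs_clamp f n x).2,
    ENNReal.ofReal_sub _ (le_min (abs_nonneg _) ENNReal.toReal_nonneg), ofReal_min_bump,
    ← Real.enorm_eq_ofReal_abs]

theorem tendsto_clamp (f : RPos → ℝ) (x : RPos) :
    Tendsto (fun n => clamp f n x) atTop (𝓝 (f x)) := by
  have h := ENNReal.Tendsto.sub (tendsto_const_nhds (x := ‖f x‖ₑ))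
    (tendsto_min_bump (fun x => ‖f x‖ₑ) x) (.inl enorm_ne_top)
  rw [tsub_self] at h
  rw [tendsto_iff_edist_tendsto_0]
  refine h.congr fun n => ?_
  rw [edist_comm, edist_eq_enorm_sub, enorm_sub_clamp]

theorem tendsto_integral_indicator_clamp {m : Measure RPos} {f : RPos → ℝ} (hf : Measurable f)
    (hi : Integrable f m) {A : Set RPos} (hA : MeasurableSet A) :
    Tendsto (fun n => ∫ x, A.indicator (clamp f n) x ∂m) atTop (𝓝 (∫ x in A, f x ∂m)) := by
  rw [← integral_indicator hA]
  refine tendsto_integral_of_dominated_convergence (fun x => ‖f x‖)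
    (fun n => ((measurable_clamp hf n).indicator hA).aestronglyMeasurable) hi.norm
    (fun n => .of_forall fun x => ?_) (.of_forall fun x => ?_)
  · refine (norm_indicator_le_norm_self _ _).trans ?_
    rw [Real.norm_eq_abs, (abs_clamp f n x).1]
    exact min_le_left _ _
  · by_cases hx : x ∈ A
    · simpa [hx] using tendsto_clamp f x
    · simp [hx]

/-- The integral over A is S(f χ_A). For the clamped functions the formula x*(Sg) = ∫ g d(x*ν) is
known; the left side converges because the tails vanish in [S, X], the right side by dominated
convergence. -/
theorem strongL1_mem_of_dominates (hΘ : ContainsTheta X) {f : L0}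
    (hdc : DominatesConvergence X.hardyNorm (eabs f)) (hfin : X.hardyNorm (eabs f) < ∞) :
    f ∈ (strongL1 (hardyMeasure hΘ)).carrier := by
  have hσ := X.isBFIL.isFnNorm_hardyNorm
  have hF := measurable_eabs f
  have hint : f ∈ (weakL1 (hardyMeasure hΘ)).carrier := ((hasFnNorm_weakL1 hΘ).mem_iff f).mpr
    ((weakNorm_le_hardyNorm hΘ hF).trans_lt hfin)
  refine ⟨hint, fun A hA => ?_⟩
  have hind : ∀ x, ‖A.indicator f x‖ₑ ≤ eabs f x := fun x => enorm_indicator_le_enorm_self f x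
  obtain ⟨d, hd⟩ := exists_domainElem (X := X) (f.measurable.indicator hA)
    ((hσ.mono (.of_forall hind)).trans_lt hfin)
  let g : ℕ → RPos → ℝ := fun n => A.indicator (clamp f n)
  have hg : ∀ n, Measurable (g n) := fun n => (measurable_clamp f.measurable n).indicator hA
  have hgle : ∀ n x, ‖g n x‖ₑ ≤ bump n x := fun n x => by
    refine (enorm_indicator_le_enorm_self _ x).trans ?_
    rw [enorm_clamp]
    exact min_le_right _ _
  choose e he using fun n => exists_domainElem (X := X) (hg n)
    (hardyNorm_lt_top_of_le_bump hΘ (.of_forall (hgle n)))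
  have hlim : Tendsto e atTop (𝓝 d) := by
    rw [tendsto_iff_edist_tendsto_0]
    refine tendsto_of_tendsto_of_tendsto_of_le_of_le tendsto_const_nhds
      (hdc.tendsto_tail hF (.of_forall fun x => enorm_lt_top)) (fun n => zero_le) fun n => ?_
    dsimp only
    rw [edist_comm, edist_eq_enorm_sub, Elem.enorm_domain_eq]
    refine hσ.mono ?_
    rw [Elem.toFn_sub]
    filter_upwards [hd, he n, AEEqFun.coeFn_sub d.toFn (e n).toFn] with x h1 h2 h3
    rw [eabs, h3, Pi.sub_apply, h1, h2]
    by_cases hx : x ∈ A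
    · simp only [g, Set.indicator_of_mem hx, eabs]
      exact (enorm_sub_clamp f n x).le
    · simp [g, hx]
  refine ⟨X.hardyCLM d, fun L => ?_⟩
  have h1 : Tendsto (fun n => L (X.hardyCLM (e n))) atTop (𝓝 (L (X.hardyCLM d))) :=
    ((L.continuous.comp X.hardyCLM.continuous).tendsto d).comp hlim
  have h2 := (tendsto_integral_indicator_clamp f.measurable
    ((hint L).mono_measure (RingMeasure.upper_le_variation _)) hA).sub
    (tendsto_integral_indicator_clamp f.measurable
      ((hint L).mono_measure (RingMeasure.lower_le_variation _)) hA)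
  refine tendsto_nhds_unique h1 (h2.congr fun n => ?_)
  exact (apply_hardyCLM_eq_integral hΘ L (hg n) (hgle n) (he n)).symm

theorem tendsto_integral_min_bump {m : Measure RPos} {f : RPos → ℝ} (hf : Measurable f)
    (hi : Integrable f m) :
    Tendsto (fun n => ∫ x, (min ‖f x‖ₑ (bump n x)).toReal ∂m) atTop (𝓝 (∫ x, |f x| ∂m)) := by
  refine tendsto_integral_of_dominated_convergence (fun x => |f x|)
    (fun n => (measurable_min_bump hf.enorm n).ennreal_toReal.aestronglyMeasurable) hi.abs
    (fun n => .of_forall fun x => ?_) (.of_forall fun x => ?_)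
  · rw [Real.norm_of_nonneg ENNReal.toReal_nonneg, ← Real.norm_eq_abs, ← toReal_enorm]
    exact ENNReal.toReal_mono enorm_ne_top (min_le_left _ _)
  · rw [← Real.norm_eq_abs, ← toReal_enorm]
    exact (ENNReal.tendsto_toReal enorm_ne_top).comp (tendsto_min_bump (fun x => ‖f x‖ₑ) x)

theorem integral_abs_eq {m : Measure RPos} {f : RPos → ℝ} (hf : Measurable f)
    (hi : Integrable f m) :
    ∫ x, |f x| ∂m = (∫ x in {x | 0 ≤ f x}, f x ∂m) - ∫ x in {x | 0 ≤ f x}ᶜ, f x ∂m := by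
  have hA : MeasurableSet {x | 0 ≤ f x} := measurableSet_le measurable_const hf
  rw [← integral_add_compl hA hi.abs, sub_eq_add_neg, ← integral_neg]
  congr 1
  · exact setIntegral_congr_fun hA fun x hx => abs_of_nonneg hx
  · exact setIntegral_congr_fun hA.compl fun x hx => abs_of_neg (not_le.mp hx)

/-- The weak limit of S(|f| ∧ b_n) is supplied by the integrals of f. Monotonicity upgrades it to a
norm limit, which dominates S|f| and forces the tails to vanish. -/
theorem dominates_of_mem_strongL1 (hΘ : ContainsTheta X) {f : L0}
    (hf : f ∈ (strongL1 (hardyMeasure hΘ)).carrier) :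
    DominatesConvergence X.hardyNorm (eabs f) ∧ X.hardyNorm (eabs f) < ∞ := by
  obtain ⟨hint, hex⟩ := hf
  have hσ := X.isBFIL.isFnNorm
  have hF := measurable_eabs f
  have hA : MeasurableSet {x | 0 ≤ f x} := measurableSet_le measurable_const f.measurable
  obtain ⟨v₁, hv₁⟩ := hex _ hA
  obtain ⟨v₂, hv₂⟩ := hex _ hA.compl
  -- The integral of f over {f ≥ 0} minus that over {f < 0}, hence the ν-integral of |f|.
  set v := v₁ - v₂ with hv
  choose d hd hd0 hde using exists_truncation hΘ hF
  have hweak : ∀ L : StrongDual ℝ X.Elem,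
      Tendsto (fun n => L (X.hardyCLM (d n))) atTop (𝓝 (L v)) := by
    intro L
    have hu := (hint L).mono_measure (RingMeasure.upper_le_variation _)
    have hl := (hint L).mono_measure (RingMeasure.lower_le_variation _)
    have e : L v = (∫ x, |f x| ∂((hardyMeasure hΘ).comp L).upper) -
        ∫ x, |f x| ∂((hardyMeasure hΘ).comp L).lower := by
      rw [hv, map_sub, hv₁, hv₂, integral_abs_eq f.measurable hu,
        integral_abs_eq f.measurable hl, RingMeasure.integral, RingMeasure.integral]
      ring
    rw [e]
    refine ((tendsto_integral_min_bump f.measurable hu).sub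
      (tendsto_integral_min_bump f.measurable hl)).congr fun n => ?_
    refine (apply_hardyCLM_eq_integral hΘ L (measurable_min_bump hF n).ennreal_toReal
      (n := n) (fun x => ?_) (hd n)).symm
    rw [enorm_toReal_of_le_bump (n := n) (H := fun x => min (eabs f x) (bump n x))
      fun _ => min_le_right _ _]
    exact min_le_right _ _
  have hue : ∀ n, eabs (X.hardyCLM (d n)).toFn =ᵐ[volume]
      avg fun x => min (eabs f x) (bump n x) := fun n =>
    (X.eabs_hardyCLM_of_nonneg (hd0 n)).trans (.of_forall fun x =>
      le_antisymm (avg_mono (hde n).le x) (avg_mono (hde n).symm.le x))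
  have hu0 : ∀ᵐ x, ∀ n, 0 ≤ (X.hardyCLM (d n)).toFn x := ae_all_iff.mpr fun n => by
    have hdn : ∀ᵐ x, 0 ≤ (d n).toFn x := by
      filter_upwards [hd n] with x hx
      rw [hx]; exact ENNReal.toReal_nonneg
    filter_upwards [coeFn_hardy (d n).toFn] with x hx
    rw [toFn_hardyCLM, hx]
    exact mul_nonneg (inv_nonneg.mpr x.2.le) (integral_nonneg_of_ae (ae_restrict_of_ae hdn))
  have hmono : Monotone fun n => (X.hardyCLM (d n)).toFn := by
    intro i j hij
    rw [← AEEqFun.coeFn_le]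
    filter_upwards [hue i, hue j, hu0] with x h1 h2 h3
    have h4 : eabs (X.hardyCLM (d i)).toFn x ≤ eabs (X.hardyCLM (d j)).toFn x := by
      rw [h1, h2]
      exact avg_mono (.of_forall fun y => min_bump_mono (eabs f) y hij) x
    rw [eabs, eabs, enorm_le_iff_norm_le, Real.norm_of_nonneg (h3 i),
      Real.norm_of_nonneg (h3 j)] at h4
    exact h4
  have hlim := tendsto_of_monotone_of_weak hmono hweak
  have hnorm : Tendsto (fun n => X.norm ((X.hardyCLM (d n)).toFn - v.toFn)) atTop (𝓝 0) :=
    tendsto_iff_norm_sub_tendsto_zero.mp hlim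
  have hle : ∀ᵐ x, ∀ n, (X.hardyCLM (d n)).toFn x ≤ v.toFn x := ae_all_iff.mpr fun n =>
    AEEqFun.coeFn_le.mpr (X.isBFIL.le_of_tendsto_norm (fun n => (X.hardyCLM (d n)).mem) hmono
      v.mem hnorm n)
  -- S|f| is the pointwise limit of S(|f| ∧ b_n) ≤ v. This puts f in [S, X] and bounds the tail S|f|
  -- - S(|f| ∧ b_n) by |v - S(|f| ∧ b_n)|.
  have havg : avg (eabs f) ≤ᵐ[volume] eabs v.toFn := by
    filter_upwards [ae_all_iff.mpr hue, hu0, hle] with x h1 h2 h3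
    refine le_of_tendsto' (tendsto_avg (fun n => measurable_min_bump hF n)
      (.of_forall fun y => min_bump_mono (eabs f) y)
      (.of_forall fun y => tendsto_min_bump (eabs f) y) x) fun n => ?_
    rw [← h1 n, eabs, eabs, enorm_le_iff_norm_le, Real.norm_of_nonneg (h2 n), Real.norm_eq_abs]
    exact (h3 n).trans (le_abs_self _)
  refine ⟨dominatesConvergence_of_tail hΘ hF ?_, ?_⟩
  · have h0 : Tendsto (fun n => ‖v - X.hardyCLM (d n)‖ₑ) atTop (𝓝 0) := by
      rw [tendsto_iff_edist_tendsto_0] at hlim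
      refine hlim.congr fun n => ?_
      rw [edist_comm, edist_eq_enorm_sub]
    refine tendsto_of_tendsto_of_tendsto_of_le_of_le tendsto_const_nhds h0 (fun n => zero_le)
      fun n => ?_
    dsimp only
    rw [Elem.enorm_eq]
    refine hσ.mono ?_
    rw [Elem.toFn_sub]
    filter_upwards [havg, hue n, eabs_add_le (v.toFn - (X.hardyCLM (d n)).toFn)
      (X.hardyCLM (d n)).toFn] with x h1 h2 h3
    rw [sub_add_cancel] at h3
    have hne : eabs (X.hardyCLM (d n)).toFn x ≠ ∞ := enorm_ne_top
    rw [← ENNReal.add_le_add_iff_right hne]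
    refine le_trans (le_of_eq ?_) (h1.trans h3)
    rw [h2, ← avg_add (F := fun x => eabs f x - min (eabs f x) (bump n x))
      (hF.sub (measurable_min_bump hF n))]
    congr 1
    ext y
    exact tsub_add_cancel_of_le (min_le_left _ _)
  · refine (hσ.mono havg).trans_lt ?_
    rw [← Elem.enorm_eq]
    exact enorm_lt_top

theorem hasFnNorm_strongL1 (hΘ : ContainsTheta X) :
    (strongL1 (hardyMeasure hΘ)).HasFnNorm (ocPart X.hardyNorm) := by
  refine ⟨fun f => ⟨fun hf => ocPart_lt_top.mpr (dominates_of_mem_strongL1 hΘ hf), fun h => ?_⟩,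
    fun f hf => ?_⟩
  · obtain ⟨h1, h2⟩ := ocPart_lt_top.mp h
    exact strongL1_mem_of_dominates hΘ h1 h2
  · have h := (dominates_of_mem_strongL1 hΘ hf).1
    rw [ocPart_of_dominates h, ← weakNorm_eq_hardyNorm hΘ (measurable_eabs f) h
      (.of_forall fun x => enorm_lt_top)]
    rfl

end BFIL

/-! ### Extremality of the two spaces, and the cases of equality -/

/-- Removes the finiteness of F from `fnNorm_le_of_fatou`. This matters for F = SG, where finiteness
is not known beforehand and must come from the bound C. -/
theorem FnSpace.IsBFIL.fnNorm_le_of_tendsto {X : FnSpace} (hX : X.IsBFIL) (hfat : X.Fatou)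
    {F : RPos → ℝ≥0∞} {u : ℕ → RPos → ℝ≥0∞} (hF : Measurable F) (hu : ∀ n, Measurable (u n))
    (hmono : ∀ᵐ x, Monotone fun n => u n x)
    (hlim : ∀ᵐ x, Tendsto (fun n => u n x) atTop (𝓝 (F x)))
    {C : ℝ≥0∞} (hC : C ≠ ∞) (hle : ∀ n, X.fnNorm (u n) ≤ C) : X.fnNorm F ≤ C := by
  have hσ := hX.isFnNorm
  have hE : MeasurableSet {x | F x = ∞} := hF (measurableSet_singleton _)
  -- On {F = ∞} the functions u n ∧ k increase to the finite constant k, so the Fatou property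
  -- applies to them. A bound independent of k makes {F = ∞} null.
  have hk : ∀ k : ℕ, k * X.fnNorm (ind {x | F x = ∞}) ≤ C := by
    intro k
    rw [← hσ.const_mul _ (ENNReal.natCast_ne_top k)]
    have hm : Measurable fun x => (k : ℝ≥0∞) * ind {x | F x = ∞} x :=
      (measurable_ind hE).const_mul _
    refine hX.fnNorm_le_of_fatou hfat (u := fun n x => min (u n x) (k * ind {x | F x = ∞} x)) hm
      (fun n => (hu n).min hm) ?_ ?_ (.of_forall fun x => ?_) hC fun n =>
        (hσ.mono (.of_forall fun _ => min_le_left _ _)).trans (hle n)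
    · filter_upwards [hmono] with x hx i j hij using min_le_min_right _ (hx hij)
    · filter_upwards [hlim] with x hx
      have h := hx.min (tendsto_const_nhds (x := (k : ℝ≥0∞) * ind {x | F x = ∞} x))
      by_cases hxE : F x = ∞
      · rwa [hxE, min_eq_right le_top] at h
      · rw [ind_of_notMem (A := {x | F x = ∞}) hxE, mul_zero] at h ⊢
        rwa [min_eq_right zero_le] at h
    · refine ENNReal.mul_lt_top (ENNReal.natCast_lt_top k) ?_
      by_cases hxE : F x = ∞
      · rw [ind_of_mem (A := {x | F x = ∞}) hxE]; exact ENNReal.one_lt_top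
      · rw [ind_of_notMem (A := {x | F x = ∞}) hxE]; exact ENNReal.zero_lt_top
  have h0 : X.fnNorm (ind {x | F x = ∞}) = 0 := by
    by_contra hne
    obtain ⟨k, hk'⟩ := ENNReal.exists_nat_mul_gt hne hC
    exact absurd (hk k) (not_le.mpr hk')
  refine hX.fnNorm_le_of_fatou hfat hF hu hmono hlim ?_ hC hle
  filter_upwards [hσ.eq_zero (measurable_ind hE) h0] with x hx
  by_contra hxE
  rw [ind_of_mem (A := {x | F x = ∞}) (not_lt_top_iff.mp hxE)] at hx
  exact one_ne_zero hx

theorem FnSpace.HasFnNorm.same {Y Z : FnSpace} {σ τ : (RPos → ℝ≥0∞) → ℝ≥0∞} (hY : Y.HasFnNorm σ)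
    (hZ : Z.HasFnNorm τ) (h : ∀ f, σ (eabs f) = τ (eabs f)) : Y.Same Z := by
  have hmem : ∀ f, f ∈ Y.carrier ↔ f ∈ Z.carrier := fun f => by
    rw [hY.mem_iff, hZ.mem_iff, h]
  exact ⟨Set.ext hmem, fun f hf => by
    rw [hY.norm_eq f hf, hZ.norm_eq f ((hmem f).mp hf), h]⟩

namespace BFIL

variable {X : BFIL}

/-- Order continuity makes the truncation tails vanish in Y. The automatically bounded inclusion
carries this to [S, X], where vanishing tails characterize L¹(ν). -/
theorem embeds_strongL1 (hΘ : ContainsTheta X) (Y : BFIL) (hoc : Y.OrderContinuous)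
    (h : Y.carrier ⊆ (hardyDomain X.toFnSpace).carrier) :
    Y.Embeds (strongL1 (hardyMeasure hΘ)) := by
  have hσ := Y.isBFIL.isFnNorm
  obtain ⟨C, hC, hle⟩ := Y.isBFIL.hasFnNorm.exists_le_mul hσ X.isBFIL.isFnNorm_hardyNorm
    X.isBFIL.hasFnNorm_hardyDomain h
  refine Y.isBFIL.hasFnNorm.embeds (hasFnNorm_strongL1 hΘ) hC fun f hf => ?_
  have hF := measurable_eabs f
  have ht := Y.isBFIL.tendsto_fnNorm_sub hoc hF (measurable_min_bump hF)
    (.of_forall (min_bump_mono _)) (.of_forall (tendsto_min_bump _)) hf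
  have ht' := ENNReal.Tendsto.const_mul (a := C) ht (.inr hC)
  rw [mul_zero] at ht'
  have hdc : DominatesConvergence X.hardyNorm (eabs f) := dominatesConvergence_of_tail hΘ hF <|
    tendsto_of_tendsto_of_tendsto_of_le_of_le tendsto_const_nhds ht' (fun n => zero_le)
      fun n => hle _ (hF.sub (measurable_min_bump hF n))
        ((hσ.mono (.of_forall fun x => tsub_le_self)).trans_lt hf)
  rw [ocPart_of_dominates hdc]
  exact hle _ hF hf

/-- Truncations lie in [S, X], where the Y norm is at most C times ‖S·‖ and so at most C times the
weak norm of f. The Fatou property of Y removes the truncation. -/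
theorem weakL1_embeds (hΘ : ContainsTheta X) (Y : BFIL) (hfat : Y.Fatou)
    (h : (hardyDomain X.toFnSpace).carrier ⊆ Y.carrier) :
    (weakL1 (hardyMeasure hΘ)).Embeds Y.toFnSpace := by
  obtain ⟨C, hC, hle⟩ := X.isBFIL.hasFnNorm_hardyDomain.exists_le_mul
    X.isBFIL.isFnNorm_hardyNorm Y.isBFIL.isFnNorm Y.isBFIL.hasFnNorm h
  refine (hasFnNorm_weakL1 hΘ).embeds Y.isBFIL.hasFnNorm hC fun f hf => ?_
  have hF := measurable_eabs f
  refine Y.isBFIL.fnNorm_le_of_tendsto hfat hF (measurable_min_bump hF)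
    (.of_forall (min_bump_mono _)) (.of_forall (tendsto_min_bump _))
    (ENNReal.mul_ne_top hC hf.ne) fun n => ?_
  refine (hle _ (measurable_min_bump hF n)
    (hardyNorm_lt_top_of_le_bump hΘ (.of_forall fun _ => min_le_right _ _))).trans ?_
  gcongr
  exact hardyNorm_min_bump_le hΘ hF n

/-- S(F ∧ b_n) increases to SF, so order continuity of X gives ‖SF - S(F ∧ b_n)‖ → 0, which is the
norm of the tail in [S, X]. -/
theorem ocPart_hardyNorm_eq (hΘ : ContainsTheta X) (hoc : X.OrderContinuous)
    {F : RPos → ℝ≥0∞} (hF : Measurable F) : ocPart X.hardyNorm F = X.hardyNorm F := by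
  rcases eq_or_ne (X.hardyNorm F) ∞ with h | h
  · refine le_antisymm ?_ (le_ocPart _ F)
    rw [h]; exact le_top
  refine ocPart_of_dominates (dominatesConvergence_of_tail hΘ hF ?_)
  have hm := measurable_min_bump hF
  have ht := X.isBFIL.tendsto_fnNorm_sub hoc (measurable_avg hF) (fun n => measurable_avg (hm n))
    (.of_forall fun x i j hij => avg_mono (.of_forall fun y => min_bump_mono F y hij) x)
    (.of_forall (tendsto_avg hm (.of_forall (min_bump_mono F)) (.of_forall (tendsto_min_bump F))))
    h.lt_top
  refine ht.congr fun n => X.isBFIL.isFnNorm.congr ?_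
  have hlt : X.fnNorm (avg F) < ∞ := h.lt_top
  filter_upwards [X.isBFIL.isFnNorm.ae_lt_top (measurable_avg hF) hlt] with x hx
  have hne : avg (fun x => min (F x) (bump n x)) x ≠ ∞ :=
    ((avg_mono (.of_forall fun y => min_le_left _ _) x).trans_lt hx).ne
  refine (ENNReal.eq_sub_of_add_eq hne ?_).symm
  rw [← avg_add (F := fun x => F x - min (F x) (bump n x)) (hF.sub (hm n))]
  congr 1
  ext y
  exact tsub_add_cancel_of_le (min_le_left _ _)

/-- The Fatou property of X, applied to S(F ∧ b_n) increasing to SF, recovers ‖SF‖ from its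
truncations. -/
theorem weakNorm_eq_hardyNorm_of_fatou (hΘ : ContainsTheta X) (hfat : X.Fatou)
    {F : RPos → ℝ≥0∞} (hF : Measurable F) : weakNorm hΘ F = X.hardyNorm F := by
  refine le_antisymm (weakNorm_le_hardyNorm hΘ hF) ?_
  rcases eq_or_ne (weakNorm hΘ F) ∞ with h | h
  · rw [h]; exact le_top
  have hm := measurable_min_bump hF
  exact X.isBFIL.fnNorm_le_of_tendsto hfat (measurable_avg hF) (fun n => measurable_avg (hm n))
    (.of_forall fun x i j hij => avg_mono (.of_forall fun y => min_bump_mono F y hij) x)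
    (.of_forall (tendsto_avg hm (.of_forall (min_bump_mono F)) (.of_forall (tendsto_min_bump F))))
    h fun n => hardyNorm_min_bump_le hΘ hF n

end BFIL

end HardyDomain

end

/-! ### Assembly of the proposition -/

theorem proposition3p2 (X : BFIL) (hri : X.RearrangementInvariant)
    (hne : ∃ f ∈ X.carrier, f ≠ 0) (hθ : ThetaCondition X.fundamental) :
    ∃ ν : RingMeasure X.Elem,
      (∀ (A : Set RPos) (hA : A ∈ boundedAway), (ν.toFun A).toFn = hardy (chi A hA.1)) ∧
      ((hardyDomain X.toFnSpace).IsBFIL ∧ (strongL1 ν).IsBFIL ∧ (weakL1 ν).IsBFIL) ∧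
      ((strongL1 ν).Embeds (hardyDomain X.toFnSpace) ∧
        (∀ f ∈ (strongL1 ν).carrier, (hardyDomain X.toFnSpace).norm f = (strongL1 ν).norm f) ∧
        (hardyDomain X.toFnSpace).Embeds (weakL1 ν) ∧
        ∀ f ∈ (hardyDomain X.toFnSpace).carrier,
          (weakL1 ν).norm f ≤ (hardyDomain X.toFnSpace).norm f) ∧
      ((strongL1 ν).OrderContinuous ∧
        ∀ Y : BFIL, Y.OrderContinuous → Y.carrier ⊆ (hardyDomain X.toFnSpace).carrier →
          Y.Embeds (strongL1 ν)) ∧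
      ((weakL1 ν).Fatou ∧
        ∀ Y : BFIL, Y.Fatou → (hardyDomain X.toFnSpace).carrier ⊆ Y.carrier →
          (weakL1 ν).Embeds Y.toFnSpace) ∧
      (X.OrderContinuous → (strongL1 ν).Same (hardyDomain X.toFnSpace)) ∧
      (X.Fatou → (weakL1 ν).Same (hardyDomain X.toFnSpace)) := by
  -- Rearrangement invariance, nontriviality of X and the integral condition enter here only; all
  -- that follows rests on θ_ε ∈ X.
  have hΘ : ContainsTheta X := fun ε hε => BFIL.fnNorm_theta_lt_top hri hne hθ hε
  have hS := X.isBFIL.isFnNorm_hardyNorm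
  have hD := X.isBFIL.hasFnNorm_hardyDomain
  have hL := BFIL.hasFnNorm_strongL1 hΘ
  have hW := BFIL.hasFnNorm_weakL1 hΘ
  refine ⟨BFIL.hardyMeasure hΘ, fun A hA => BFIL.toFn_hardyMeasure hΘ hA,
    ⟨hD.isBFIL hS, hL.isBFIL (isFnNorm_ocPart hS), hW.isBFIL (BFIL.isFnNorm_weakNorm hΘ)⟩,
    ⟨?_, ?_, ?_, ?_⟩, ⟨hL.orderContinuous hS, BFIL.embeds_strongL1 hΘ⟩,
    ⟨BFIL.fatou_weakL1 hΘ, BFIL.weakL1_embeds hΘ⟩, fun hoc => ?_, fun hfat => ?_⟩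
  · exact hL.embeds hD ENNReal.one_ne_top fun f _ => by
      rw [one_mul]; exact le_ocPart _ _
  · intro f hf
    have h := ocPart_lt_top.mp ((hL.mem_iff f).mp hf)
    rw [hL.norm_eq f hf, hD.norm_eq f ((hD.mem_iff f).mpr h.2), ocPart_of_dominates h.1]
  · exact hD.embeds hW ENNReal.one_ne_top fun f _ => by
      rw [one_mul]; exact BFIL.weakNorm_le_hardyNorm hΘ (measurable_eabs f)
  · intro f hf
    have hlt := (hD.mem_iff f).mp hf
    have hle := BFIL.weakNorm_le_hardyNorm hΘ (measurable_eabs f)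
    rw [hD.norm_eq f hf, hW.norm_eq f ((hW.mem_iff f).mpr (hle.trans_lt hlt))]
    exact ENNReal.toReal_mono hlt.ne hle
  · exact hL.same hD fun f => BFIL.ocPart_hardyNorm_eq hΘ hoc (measurable_eabs f)
  · exact hW.same hD fun f => BFIL.weakNorm_eq_hardyNorm_of_fatou hΘ hfat (measurable_eabs f)
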